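/- Let $\mathfrak g$ be a Lie algebra over $\mathbb C$, let $\mathfrak l\subset\mathfrak g$ be a finite-dimensional Lie subalgebra with basis $x_1,\dots,x_n$, and let $x_1^*,\dots,x_n^*$ be the dual basis of $\mathfrak l^*$. For a complex vector space $V$, a function $D\to V$ on the formal neighbourhood $D$ of $0$ in $\mathfrak l^*$ means an element of $V[[x_1,\dots,x_n]]$, the $x_i$ being regarded as coordinates on $\mathfrak l^*$. A function $r:D\to\mathfrak g\otimes\mathfrak g$ is $\mathfrak l$-equivariant if it intertwines the coadjoint and the adjoint actions, i.e. $[y\otimes1+1\otimes y,\,r]+\sum_i[y,x_i]\,\frac{\partial r}{\partial x_i}=0$ for all $y\in\mathfrak l$, where $[y,x_i]\in\mathfrak l$ is regarded as a linear function on $\mathfrak l^*$. For $\Omega\in(S^2\mathfrak g)^{\mathfrak g}$, a *dynamical r-matrix* (with respect to $\Omega$) is an $\mathfrak l$-equivariant function $r:D\to\mathfrak g\otimes\mathfrak g$ such that $r+r^{21}=\Omega$ and $$\mathrm{Alt}\Big(\sum_i x_i\otimes\frac{\partial r}{\partial x_i}\Big)+CYB(r)=0,$$ where $CYB(r)=[r^{12},r^{13}]+[r^{12},r^{23}]+[r^{13},r^{23}]$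 and $\mathrm{Alt}(x)=x^{123}-x^{213}+x^{312}$, that is, $\mathrm{Alt}(a\otimes b\otimes c)=a\otimes b\otimes c-b\otimes a\otimes c+b\otimes c\otimes a$. Let $\Omega\in(S^2\mathfrak g)^{\mathfrak g}$ and assume: i) $\mathfrak l$ has an $\mathfrak l$-invariant complement $\mathfrak m$ in $\mathfrak g$; ii) $\Omega=\Omega_{\mathfrak l}+\Omega_{\mathfrak m}$ with $\Omega_{\mathfrak l}\in\mathfrak l\otimes\mathfrak l$ and $\Omega_{\mathfrak m}\in\mathfrak m\otimes\mathfrak m$. Let $f(s)=\frac1s-\frac12\coth\frac s2$, which is regular at $s=0$, and let $$r^{\mathfrak l}_{AM}=\frac{\Omega_{\mathfrak l}}2+\big(1\otimes f(\mathrm{ad}\,\mu)\big)\Omega_{\mathfrak l}:\ D\to\mathfrak l\otimes\mathfrak l,\qquad \mu=\sum_i x_i\,(x_i^*\otimes1)\Omega_{\mathfrak l},$$ be the Alekseev–Meinrenken r-matrix of $\mathfrak l$ for $\Omega_{\mathfrak l}$. Regard $\Lambda^2\mathfrak m$ as the space of skew-symmetric tensors in $\mathfrak m\otimes\mathfrak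 m$, and let $$\mathcal M_\Omega=\Big\{x\in\tfrac{\Omega}2+(\Lambda^2\mathfrak m)^{\mathfrak l}\ \Big|\ CYB(x)=0\ \text{ in }\ \Lambda^3(\mathfrak g/\mathfrak l)\Big\}.$$ Then for every $r_0\in\mathcal M_\Omega$ there is a unique dynamical r-matrix $r$ (with respect to $\Omega$) of the form $r=r^{\mathfrak l}_{AM}+\frac{\Omega_{\mathfrak m}}2+t$ with $t:D\to\Lambda^2\mathfrak m$ such that $r(0)=r_0$; moreover $t$ is $\mathfrak l$-equivariant. -/

import Mathlib

open scoped TensorProduct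

noncomputable section

namespace DynR

/-! ### Vector-valued formal power series: functions on the formal neighbourhood of zero -/

/-- The space `V[[x_1, ..., x_n]]` of formal power series with coefficients in `V`:
the value at `d` is the coefficient of the monomial `x^d`. -/
abbrev Series (n : ℕ) (V : Type*) : Type _ := (Fin n →₀ ℕ) → V

section Series

variable {n : ℕ} {V W Z : Type*} [AddCommGroup V] [Module ℂ V] [AddCommGroup W] [Module ℂ W]
  [AddCommGroup Z] [Module ℂ Z]

/-- The constant function with value `v`. -/
def const (n : ℕ) (v : V) : Series n V := fun d => if d = 0 then v else 0

/-- The value of a series at the origin. -/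
def valueAtZero (φ : Series n V) : V := φ 0

/-- The partial derivative `∂φ/∂x_i`. -/
def pderiv (i : Fin n) (φ : Series n V) : Series n V :=
  fun d => ((d i + 1 : ℕ) : ℂ) • φ (d + Finsupp.single i 1)

/-- Multiplication by the coordinate `x_i`. -/
def mulX (i : Fin n) (φ : Series n V) : Series n V :=
  fun d => if d i = 0 then 0 else φ (d - Finsupp.single i 1)

/-- Application of a linear map to the values of a series. -/
def mapValues (A : V →ₗ[ℂ] W) (φ : Series n V) : Series n W := fun d => A (φ d)

/-- The function `λ ↦ B(φ(λ), ψ(λ))` for a bilinear map `B`. -/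
def bilin (B : V →ₗ[ℂ] W →ₗ[ℂ] Z) (φ : Series n V) (ψ : Series n W) : Series n Z :=
  fun d => ∑ p ∈ Finset.HasAntidiagonal.antidiagonal d, B (φ p.1) (ψ p.2)

end Series

/-! ### Tensors over a Lie algebra -/

section Tensors

variable {g : Type*} [LieRing g] [LieAlgebra ℂ g]

/-- The bracket as a linear map on `g ⊗ g`. -/
def bracket (g : Type*) [LieRing g] [LieAlgebra ℂ g] : g ⊗[ℂ] g →ₗ[ℂ] g :=
  TensorProduct.lift (LieModule.toEnd ℂ g g : g →ₗ[ℂ] Module.End ℂ g)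

@[simp] theorem bracket_tmul (a b : g) : bracket g (a ⊗ₜ[ℂ] b) = ⁅a, b⁆ := rfl

/-- `(r, s) ↦ [r^{12}, s^{13}]`. -/
def br1213 (g : Type*) [LieRing g] [LieAlgebra ℂ g] :
    g ⊗[ℂ] g →ₗ[ℂ] g ⊗[ℂ] g →ₗ[ℂ] g ⊗[ℂ] (g ⊗[ℂ] g) :=
  TensorProduct.curry
    (TensorProduct.map (bracket g) LinearMap.id ∘ₗ
      (TensorProduct.tensorTensorTensorComm ℂ g g g g).toLinearMap)

/-- `(r, s) ↦ [r^{12}, s^{23}]`. -/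
def br1223 (g : Type*) [LieRing g] [LieAlgebra ℂ g] :
    g ⊗[ℂ] g →ₗ[ℂ] g ⊗[ℂ] g →ₗ[ℂ] g ⊗[ℂ] (g ⊗[ℂ] g) :=
  TensorProduct.curry
    (TensorProduct.map LinearMap.id
        (TensorProduct.map (bracket g) LinearMap.id ∘ₗ
          (TensorProduct.assoc ℂ g g g).symm.toLinearMap) ∘ₗ
      (TensorProduct.assoc ℂ g g (g ⊗[ℂ] g)).toLinearMap)

/-- `(r, s) ↦ [r^{13}, s^{23}]`. -/
def br1323 (g : Type*) [LieRing g] [LieAlgebra ℂ g] :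
    g ⊗[ℂ] g →ₗ[ℂ] g ⊗[ℂ] g →ₗ[ℂ] g ⊗[ℂ] (g ⊗[ℂ] g) :=
  TensorProduct.curry
    ((TensorProduct.assoc ℂ g g g).toLinearMap ∘ₗ
      TensorProduct.map LinearMap.id (bracket g) ∘ₗ
      (TensorProduct.tensorTensorTensorComm ℂ g g g g).toLinearMap)

@[simp] theorem br1213_tmul (a b c d : g) :
    br1213 g (a ⊗ₜ b) (c ⊗ₜ d) = ⁅a, c⁆ ⊗ₜ (b ⊗ₜ d) := rfl

@[simp] theorem br1223_tmul (a b c d : g) :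
    br1223 g (a ⊗ₜ b) (c ⊗ₜ d) = a ⊗ₜ (⁅b, c⁆ ⊗ₜ d) := rfl

@[simp] theorem br1323_tmul (a b c d : g) :
    br1323 g (a ⊗ₜ b) (c ⊗ₜ d) = a ⊗ₜ (c ⊗ₜ ⁅b, d⁆) := rfl

/-- The bilinear map `(r, s) ↦ [r^{12}, s^{13}] + [r^{12}, s^{23}] + [r^{13}, s^{23}]`. -/
def cybBilin (g : Type*) [LieRing g] [LieAlgebra ℂ g] :
    g ⊗[ℂ] g →ₗ[ℂ] g ⊗[ℂ] g →ₗ[ℂ] g ⊗[ℂ] (g ⊗[ℂ] g) :=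
  br1213 g + br1223 g + br1323 g

/-- The classical Yang-Baxter operator
`CYB(r) = [r^{12}, r^{13}] + [r^{12}, r^{23}] + [r^{13}, r^{23}]`. -/
def CYB (r : g ⊗[ℂ] g) : g ⊗[ℂ] (g ⊗[ℂ] g) := cybBilin g r r

/-- The flip `r ↦ r^{21}`. -/
def flip (r : g ⊗[ℂ] g) : g ⊗[ℂ] g := TensorProduct.comm ℂ g g r

/-- `x ↦ x^{213}`, that is `a ⊗ b ⊗ c ↦ b ⊗ a ⊗ c`. -/
def perm213 (g : Type*) [LieRing g] [LieAlgebra ℂ g] :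
    g ⊗[ℂ] (g ⊗[ℂ] g) →ₗ[ℂ] g ⊗[ℂ] (g ⊗[ℂ] g) :=
  (TensorProduct.leftComm ℂ g g g).toLinearMap

/-- `x ↦ x^{312}`: the first factor is put in the third place, the second factor in the first
place and the third factor in the second place, that is `a ⊗ b ⊗ c ↦ b ⊗ c ⊗ a`. -/
def perm312 (g : Type*) [LieRing g] [LieAlgebra ℂ g] :
    g ⊗[ℂ] (g ⊗[ℂ] g) →ₗ[ℂ] g ⊗[ℂ] (g ⊗[ℂ] g) :=
  (TensorProduct.assoc ℂ g g g).toLinearMap ∘ₗ (TensorProduct.comm ℂ g (g ⊗[ℂ] g)).toLinearMap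

@[simp] theorem perm213_tmul (a b c : g) :
    perm213 g (a ⊗ₜ (b ⊗ₜ c)) = b ⊗ₜ (a ⊗ₜ c) := rfl

@[simp] theorem perm312_tmul (a b c : g) :
    perm312 g (a ⊗ₜ (b ⊗ₜ c)) = b ⊗ₜ (c ⊗ₜ a) := rfl

/-- `Alt(x) = x^{123} - x^{213} + x^{312}`. -/
def alt (g : Type*) [LieRing g] [LieAlgebra ℂ g] :
    g ⊗[ℂ] (g ⊗[ℂ] g) →ₗ[ℂ] g ⊗[ℂ] (g ⊗[ℂ] g) :=
  LinearMap.id - perm213 g + perm312 g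

/-- `Ω` lies in `(S²g)^g`: it is a symmetric tensor, invariant under the adjoint action. -/
def IsInvariantSymmetric (Ω : g ⊗[ℂ] g) : Prop :=
  flip Ω = Ω ∧ ∀ y : g, ⁅y, Ω⁆ = 0

/-- The inclusion of `m ⊗ m` in `g ⊗ g`. -/
def tensorIncl (m : Submodule ℂ g) : (m ⊗[ℂ] m) →ₗ[ℂ] g ⊗[ℂ] g :=
  TensorProduct.map m.subtype m.subtype

/-- The inclusion of `l ⊗ l` in `g ⊗ g` for a Lie subalgebra `l`. -/
def tensorInclLie (l : LieSubalgebra ℂ g) : (l ⊗[ℂ] l) →ₗ[ℂ] g ⊗[ℂ] g :=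
  TensorProduct.map (l.incl : l →ₗ[ℂ] g) (l.incl : l →ₗ[ℂ] g)

/-- `Λ²m`, as the space of skew-symmetric tensors in `m ⊗ m ⊆ g ⊗ g`. -/
def wedgeSq (m : Submodule ℂ g) : Set (g ⊗[ℂ] g) :=
  {x | x ∈ LinearMap.range (tensorIncl m) ∧ flip x = -x}

/-- The map `g ⊗ g ⊗ g → (g/p) ⊗ (g/p) ⊗ (g/p)`. -/
def tripleMod (p : Submodule ℂ g) :
    g ⊗[ℂ] (g ⊗[ℂ] g) →ₗ[ℂ] (g ⧸ p) ⊗[ℂ] ((g ⧸ p) ⊗[ℂ] (g ⧸ p)) :=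
  TensorProduct.map p.mkQ (TensorProduct.map p.mkQ p.mkQ)

/-- The variety `M_Ω` of all `x ∈ Ω/2 + (Λ²m)^l` such that `CYB(x)` vanishes modulo `l`. -/
def modVariety (l : LieSubalgebra ℂ g) (m : Submodule ℂ g) (Ω : g ⊗[ℂ] g) : Set (g ⊗[ℂ] g) :=
  {x | (∃ u ∈ wedgeSq m, (∀ y : l, ⁅(y : g), u⁆ = 0) ∧ x = (1 / 2 : ℂ) • Ω + u) ∧
    tripleMod l.toSubmodule (CYB x) = 0}

end Tensors

/-! ### Dynamical r-matrices -/

section Dynamical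

variable {g : Type*} [LieRing g] [LieAlgebra ℂ g] {l : LieSubalgebra ℂ g} {n : ℕ}

/-- The infinitesimal action of `y ∈ l` on functions on the dual of `l`: the derivation
`φ ↦ ∑_i [y, x_i] ∂φ/∂x_i`, where `[y, x_i] ∈ l` is regarded as a linear function
on the dual of `l`. -/
def coadj {V : Type*} [AddCommGroup V] [Module ℂ V] (b : Module.Basis (Fin n) ℂ l) (y : l)
    (φ : Series n V) : Series n V :=
  ∑ i, ∑ k, b.repr ⁅y, b i⁆ k • mulX k (pderiv i φ)

/-- `l`-equivariance of a function `r` on the formal neighbourhood of zero in the dual of `l`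
(with the coadjoint action) with values in `g ⊗ g`, in infinitesimal form. -/
def IsEquivariant (b : Module.Basis (Fin n) ℂ l) (r : Series n (g ⊗[ℂ] g)) : Prop :=
  ∀ (y : l) (d : Fin n →₀ ℕ), ⁅(y : g), r d⁆ + coadj b y r d = 0

/-- The function `∑_i x_i ⊗ ∂r/∂x_i` associated with the one-form `dr`. -/
def dBar (b : Module.Basis (Fin n) ℂ l) (r : Series n (g ⊗[ℂ] g)) :
    Series n (g ⊗[ℂ] (g ⊗[ℂ] g)) :=
  fun d => ∑ i, (b i : g) ⊗ₜ[ℂ] pderiv i r d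

/-- The classical dynamical Yang-Baxter equation `Alt(dr) + CYB(r) = 0`. -/
def CDYBE (b : Module.Basis (Fin n) ℂ l) (r : Series n (g ⊗[ℂ] g)) : Prop :=
  mapValues (alt g) (dBar b r) + bilin (cybBilin g) r r = 0

/-- Dynamical r-matrices `r` with `r + r^{21} = Ω`: elements of `Dynr(g, l, Ω)`. -/
structure IsDynamicalRMatrix (b : Module.Basis (Fin n) ℂ l) (Ω : g ⊗[ℂ] g)
    (r : Series n (g ⊗[ℂ] g)) : Prop where
  equivariant : IsEquivariant b r
  cdybe : CDYBE b r
  quasiUnitary : (fun d => r d + flip (r d)) = const n Ω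

end Dynamical

/-! ### The Alekseev-Meinrenken r-matrix -/

section AM

/-- The Taylor series at zero of `f(s) = 1/s - (1/2) coth(s/2)`. -/
def fSeries : PowerSeries ℂ :=
  PowerSeries.mk fun k => if k = 0 then 0 else -((bernoulli (k + 1) : ℚ) : ℂ) / (k + 1).factorial

/-- `fSeries` is the Taylor series of `1/s - (1/2) (e^s + 1)/(e^s - 1)`: after multiplication by
`2 s (e^s - 1)` it becomes `2 (e^s - 1) - s (e^s + 1)`. -/
theorem fSeries_spec :
    2 * PowerSeries.X * (PowerSeries.exp ℂ - 1) * fSeries =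
      2 * (PowerSeries.exp ℂ - 1) - PowerSeries.X * (PowerSeries.exp ℂ + 1) := by
  have h1 := bernoulliPowerSeries_mul_exp_sub_one ℂ
  have h2 : PowerSeries.X * (2 * fSeries) =
      2 - PowerSeries.X - 2 * bernoulliPowerSeries ℂ := by
    ext k
    have e2 : (2 : PowerSeries ℂ) = PowerSeries.C (2 : ℂ) :=
      (map_ofNat (PowerSeries.C (R := ℂ)) 2).symm
    rw [e2]
    rcases k with _ | _ | k
    · rw [PowerSeries.coeff_zero_X_mul]
      simp only [map_sub, PowerSeries.coeff_C_mul]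
      simp [bernoulliPowerSeries]
    · rw [PowerSeries.coeff_succ_X_mul]
      simp only [map_sub, PowerSeries.coeff_C_mul, PowerSeries.coeff_C, PowerSeries.coeff_X]
      simp [fSeries, bernoulliPowerSeries, bernoulli_one]
      norm_num
    · rw [PowerSeries.coeff_succ_X_mul]
      simp only [map_sub, PowerSeries.coeff_C_mul, PowerSeries.coeff_C, PowerSeries.coeff_X]
      simp [fSeries, bernoulliPowerSeries]
      ring
  linear_combination (PowerSeries.exp ℂ - 1) * h2 - 2 * h1

variable {k : Type*} [LieRing k] [LieAlgebra ℂ k] {n : ℕ}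

/-- The map from the dual of `k` to `k` defined by `Ω`: it sends `ξ` to `(ξ ⊗ 1) Ω`. Its image is
the ideal spanned by the components of `Ω`, and it is the composition of the restriction of
functionals to this ideal with the identification of the dual of this ideal with this ideal
that a symmetric `Ω` defines. -/
def sharp (Ω : k ⊗[ℂ] k) (ξ : Module.Dual ℂ k) : k :=
  TensorProduct.lid ℂ k (TensorProduct.map ξ LinearMap.id Ω)

/-- The tensor `(1 ⊗ A) Ω` which the identification given by `Ω` attaches to an endomorphism `A`;
the identity corresponds to `Ω`. -/
def endTensor (Ω : k ⊗[ℂ] k) (A : Module.End ℂ k) : k ⊗[ℂ] k :=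
  TensorProduct.map LinearMap.id A Ω

theorem sharp_endTensor (Ω : k ⊗[ℂ] k) (A : Module.End ℂ k) (ξ : Module.Dual ℂ k) :
    sharp (endTensor Ω A) ξ = A (sharp Ω ξ) := by
  induction Ω using TensorProduct.induction_on with
  | zero => simp [sharp, endTensor]
  | tmul x y => simp [sharp, endTensor]
  | add x y hx hy => simp only [sharp, endTensor, map_add] at hx hy ⊢; rw [hx, hy]

/-- The power `(ad μ)^j`, as a series with values in endomorphisms of `k`, where
`μ = ∑_i x_i (x_i^* ⊗ 1) Ω` is the linear function `sharp Ω` on the dual of `k`. -/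
def adPow (b : Module.Basis (Fin n) ℂ k) (Ω : k ⊗[ℂ] k) : ℕ → Series n (Module.End ℂ k)
  | 0 => const n 1
  | j + 1 => ∑ i, mulX i (mapValues
      (LinearMap.mulLeft ℂ (LieModule.toEnd ℂ k k (sharp Ω (b.coord i)))) (adPow b Ω j))

/-- `(ad μ)^j` is homogeneous of degree `j`. -/
theorem adPow_eq_zero (b : Module.Basis (Fin n) ℂ k) (Ω : k ⊗[ℂ] k) (j : ℕ) (d : Fin n →₀ ℕ)
    (h : d.degree ≠ j) : adPow b Ω j d = 0 := by
  induction j generalizing d with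
  | zero =>
    have : d ≠ 0 := by rintro rfl; simp at h
    simp [adPow, const, this]
  | succ j ih =>
    simp only [adPow, Finset.sum_apply, mulX, mapValues]
    refine Finset.sum_eq_zero fun i _ => ?_
    split_ifs with hi
    · rfl
    · rw [ih, map_zero]
      intro hd
      apply h
      have hle : Finsupp.single i 1 ≤ d := by
        rw [Finsupp.single_le_iff]; omega
      have := congrArg Finsupp.degree (tsub_add_cancel_of_le hle)
      rw [map_add, hd] at this
      simpa using this.symm

/-- The formal function `f(ad μ)` with `f(s) = 1/s - (1/2) coth(s/2)`. As `(ad μ)^j` is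
homogeneous of degree `j`, only finitely many powers contribute to each coefficient. -/
def fAd (b : Module.Basis (Fin n) ℂ k) (Ω : k ⊗[ℂ] k) : Series n (Module.End ℂ k) :=
  fun d => ∑ j ∈ Finset.range (d.degree + 1), PowerSeries.coeff j fSeries • adPow b Ω j d

/-- The Alekseev-Meinrenken r-matrix of `k` for `Ω`. -/
def rAM (b : Module.Basis (Fin n) ℂ k) (Ω : k ⊗[ℂ] k) : Series n (k ⊗[ℂ] k) :=
  const n ((1 / 2 : ℂ) • Ω) + fun d => endTensor Ω (fAd b Ω d)

end AM

/-- The function `r_AM^l + Ω_m/2 + t` with values in `g ⊗ g`, where `r_AM^l` is the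
Alekseev-Meinrenken r-matrix of `l` for `Ωl`. -/
def amShift {g : Type*} [LieRing g] [LieAlgebra ℂ g] {l : LieSubalgebra ℂ g} {n : ℕ}
    (b : Module.Basis (Fin n) ℂ l) (m : Submodule ℂ g) (Ωl : l ⊗[ℂ] l) (Ωm : m ⊗[ℂ] m)
    (t : Series n (g ⊗[ℂ] g)) : Series n (g ⊗[ℂ] g) :=
  mapValues (tensorInclLie l) (rAM b Ωl) + const n ((1 / 2 : ℂ) • tensorIncl m Ωm) + t

end DynR

end

/-! Write `r = Ω/2 + R` with `R` skew-symmetric. Invariance of `Ω` kills the mixed terms, so the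
dynamical Yang-Baxter equation says that the curvature `Alt(dR) + CYB(R) + CYB(Ω/2)` is zero;
`triple_cdybe` expresses this by pairing with three functionals, tensors being read as operators
from functionals to vectors.

Let `ε` be the tautological linear function on the dual of `l`, its values extended by zero on `m`.
If `R ε = 0`, contracting the curvature with `ε` leaves the radial equation `IsRadial`: the Euler
operator plus the number of legs in `l`, applied to `R`, plus brackets paired with `ε`, is zero. As
`ε` vanishes at the origin, the brackets only see coefficients of lower degree, and the weights `k`,
`k + 1`, `k + 2` are nonzero for `k > 0`. Hence a solution is determined by its value at the origin
(`IsRadial.unique`).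

Uniqueness: the Alekseev-Meinrenken part kills `ε` because `f(0) = 0` and `[μ, μ] = 0`, and `t`
kills it because its legs are in `m`. So every candidate solves the radial equation
(`isRadial_of_curvF_eq_zero`), and all candidates have the same initial value.

Existence: since `[l, m] ⊆ m`, the radial equation can be solved separately on `l ⊗ l` and on `m ⊗
m`. On `l ⊗ l` the Alekseev-Meinrenken part solves it, by the differential equation of `f`
(`fSeries_ode`, `isRadial_rhoAM`); on `m ⊗ m` it is a recursion on the degree (`exists_isRadial`).
The sum is equivariant, because its equivariance defect solves the linearized radial equation and
vanishes at the origin (`IsRadial.equivDefect_eq_zero`). With equivariance available, a Bianchi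
identity (`bianchi`) shows that the curvature also satisfies a homogeneous linear radial equation,
of weight the degree plus the number of legs in `l`. This weight is zero only for the constant term
modulo `l`, which is `CYB(r₀)` and vanishes by the choice of `r₀` (`IsRadial.curvF_eq_zero`).
Projecting to `m ⊗ m` gives the equivariance of `t`. -/

noncomputable section

namespace DynR

/-! ### Calculus of vector-valued formal power series -/

section SeriesCalculus

set_option linter.unusedSectionVars false

variable {n : ℕ} {V W Z U X Y : Type*} [AddCommGroup V] [Module ℂ V] [AddCommGroup W] [Module ℂ W]
  [AddCommGroup Z] [Module ℂ Z] [AddCommGroup U] [Module ℂ U] [AddCommGroup X] [Module ℂ X]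
  [AddCommGroup Y] [Module ℂ Y]

theorem bilin_flip (B : V →ₗ[ℂ] W →ₗ[ℂ] Z) (φ : Series n V) (ψ : Series n W) :
    bilin B.flip ψ φ = bilin B φ ψ := by
  funext d
  simp only [bilin]
  conv_rhs => rw [← Finset.HasAntidiagonal.map_swap_antidiagonal, Finset.sum_map]
  rfl

/-- Both sides are sums over the ways to split an exponent into three. Four unrelated bilinear maps
are allowed so that scalar multiplication, the Jacobi identity and adjunctions of pairings are all
instances. -/
theorem bilin_assoc {B : X →ₗ[ℂ] Z →ₗ[ℂ] U} {C : V →ₗ[ℂ] W →ₗ[ℂ] X}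
    {B' : V →ₗ[ℂ] Y →ₗ[ℂ] U} {C' : W →ₗ[ℂ] Z →ₗ[ℂ] Y}
    (h : ∀ v w z, B (C v w) z = B' v (C' w z))
    (φ : Series n V) (ψ : Series n W) (χ : Series n Z) :
    bilin B (bilin C φ ψ) χ = bilin B' φ (bilin C' ψ χ) := by
  funext d
  simp only [bilin, map_sum, LinearMap.sum_apply, h, Finset.sum_sigma']
  refine Finset.sum_nbij' (fun ⟨⟨_i, j⟩, ⟨k, l⟩⟩ ↦ ⟨(k, l + j), (l, j)⟩)
    (fun ⟨⟨i, _j⟩, ⟨k, l⟩⟩ ↦ ⟨(i + k, l), (i, k)⟩) ?_ ?_ ?_ ?_ ?_ <;>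
  · rintro ⟨⟨a, b⟩, ⟨c, e⟩⟩ h
    simp only [Finset.mem_sigma, Finset.HasAntidiagonal.mem_antidiagonal] at h
    obtain ⟨rfl, rfl⟩ := h
    simp [add_assoc]

theorem bilin_left_comm {B : V →ₗ[ℂ] X →ₗ[ℂ] U} {C : W →ₗ[ℂ] Z →ₗ[ℂ] X}
    {B' : W →ₗ[ℂ] Y →ₗ[ℂ] U} {C' : V →ₗ[ℂ] Z →ₗ[ℂ] Y}
    (h : ∀ v w z, B v (C w z) = B' w (C' v z))
    (φ : Series n V) (ψ : Series n W) (χ : Series n Z) :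
    bilin B φ (bilin C ψ χ) = bilin B' ψ (bilin C' φ χ) := by
  -- With values in `Hom(Z, U)`, both sides reassociate to a product of `φ` and `ψ` applied to `χ`,
  -- and exchanging `φ` and `ψ` is flipping `T`.
  let T : V →ₗ[ℂ] W →ₗ[ℂ] (Z →ₗ[ℂ] U) := LinearMap.mk₂ ℂ (fun v w => B v ∘ₗ C w)
    (by intros; ext; simp) (by intros; ext; simp) (by intros; ext; simp) (by intros; ext; simp)
  have h1 := bilin_assoc (B := LinearMap.id) (C := T) (B' := B) (C' := C)
    (fun v w z => rfl) φ ψ χ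
  have h2 := bilin_assoc (B := LinearMap.id) (C := T.flip) (B' := B') (C' := C')
    (fun w v z => h v w z) ψ φ χ
  rw [← h1, ← h2, bilin_flip]

theorem bilin_add_right (B : V →ₗ[ℂ] W →ₗ[ℂ] Z) (φ : Series n V) (ψ ψ' : Series n W) :
    bilin B φ (ψ + ψ') = bilin B φ ψ + bilin B φ ψ' := by
  funext d; simp [bilin, Finset.sum_add_distrib]

theorem bilin_add_left (B : V →ₗ[ℂ] W →ₗ[ℂ] Z) (φ φ' : Series n V) (ψ : Series n W) :
    bilin B (φ + φ') ψ = bilin B φ ψ + bilin B φ' ψ := by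
  funext d; simp [bilin, Finset.sum_add_distrib]

theorem bilin_const_left (B : V →ₗ[ℂ] W →ₗ[ℂ] Z) (v : V) (ψ : Series n W) :
    bilin B (const n v) ψ = mapValues (B v) ψ := by
  funext d
  simp only [bilin, const, mapValues]
  rw [Finset.sum_eq_single (0, d)]
  · simp
  · rintro ⟨p, q⟩ hp hne
    have : p ≠ 0 := by
      rintro rfl
      simp at hp
      exact hne (by simp [hp])
    simp [this]
  · simp

theorem bilin_const_right (B : V →ₗ[ℂ] W →ₗ[ℂ] Z) (φ : Series n V) (w : W) :
    bilin B φ (const n w) = mapValues (B.flip w) φ := by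
  rw [← bilin_flip, bilin_const_left]

theorem mapValues_bilin (A : Z →ₗ[ℂ] U) (B : V →ₗ[ℂ] W →ₗ[ℂ] Z) (φ : Series n V) (ψ : Series n W) :
    mapValues A (bilin B φ ψ) = bilin (B.compr₂ A) φ ψ := by
  funext d; simp [mapValues, bilin]

/-- Scalar formal power series. -/
abbrev Scal (n : ℕ) : Type := MvPowerSeries (Fin n) ℂ

/-- The function `a φ` for a scalar series `a`. -/
def smulSeries (a : Scal n) (φ : Series n V) : Series n V :=
  bilin (LinearMap.lsmul ℂ V : ℂ →ₗ[ℂ] V →ₗ[ℂ] V) a φ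

theorem one_smulSeries (φ : Series n V) : smulSeries (1 : Scal n) φ = φ := by
  have h1 : (1 : Scal n) = const n (1 : ℂ) := by
    classical
    funext d
    exact MvPowerSeries.coeff_one (σ := Fin n) (R := ℂ) d
  refine (congrArg (fun a => smulSeries a φ) h1).trans
    ((bilin_const_left (LinearMap.lsmul ℂ V) (1 : ℂ) φ).trans ?_)
  funext d
  exact one_smul ℂ (φ d)

theorem Scal.mul_eq (a b : Scal n) : a * b = bilin (LinearMap.mul ℂ ℂ) a b := by
  classical
  funext d
  exact MvPowerSeries.coeff_mul d a b

theorem mul_smulSeries (a b : Scal n) (φ : Series n V) :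
    smulSeries (a * b) φ = smulSeries a (smulSeries b φ) := by
  rw [Scal.mul_eq]
  exact bilin_assoc (C := LinearMap.mul ℂ ℂ) (fun v w z => mul_smul v w z) a b φ

instance : Module (Scal n) (Series n V) where
  smul := smulSeries
  one_smul φ := one_smulSeries φ
  mul_smul a b φ := mul_smulSeries a b φ
  smul_zero a := by
    funext d
    exact Finset.sum_eq_zero fun p _ => smul_zero _
  smul_add a φ ψ := bilin_add_right _ _ _ _
  add_smul a b φ := bilin_add_left _ _ _ _
  zero_smul φ := by
    funext d
    exact Finset.sum_eq_zero fun p _ => zero_smul _ _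

theorem smulSeries_def (a : Scal n) (φ : Series n V) :
    a • φ = bilin (LinearMap.lsmul ℂ V : ℂ →ₗ[ℂ] V →ₗ[ℂ] V) a φ := rfl

/-- The bilinear extension of a bilinear map to formal functions. -/
def bil (B : V →ₗ[ℂ] W →ₗ[ℂ] Z) : Series n V →ₗ[Scal n] Series n W →ₗ[Scal n] Series n Z :=
  LinearMap.mk₂ (Scal n) (fun φ ψ => bilin B φ ψ)
    (fun _ _ _ => bilin_add_left _ _ _ _)
    (fun _ _ _ => bilin_assoc (fun _ _ _ => by simp) _ _ _)
    (fun _ _ _ => bilin_add_right _ _ _ _)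
    (fun _ _ _ => bilin_left_comm (fun _ _ _ => by simp) _ _ _)

/-- Scalar-valued formal functions are scalar series. -/
def toScal : Series n ℂ →ₗ[Scal n] Scal n where
  toFun φ := φ
  map_add' _ _ := rfl
  map_smul' a φ := by
    exact (Scal.mul_eq a φ).symm

/-- The extension of a bilinear form to formal functions. -/
def form (B : V →ₗ[ℂ] W →ₗ[ℂ] ℂ) : Series n V →ₗ[Scal n] Series n W →ₗ[Scal n] Scal n :=
  (bil B).compr₂ toScal

/-- Multiplication by a coordinate is the action of the corresponding scalar series. -/
theorem X_smul (i : Fin n) (φ : Series n V) :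
    (MvPowerSeries.X i : Scal n) • φ = mulX i φ := by
  classical
  funext d
  have hX : ∀ p, (MvPowerSeries.X i : Scal n) p = if p = Finsupp.single i 1 then 1 else 0 :=
    fun p => MvPowerSeries.coeff_X p i
  simp only [smulSeries_def, bilin, mulX, hX]
  split_ifs with h
  · refine Finset.sum_eq_zero fun p hp => ?_
    rw [if_neg]
    · simp
    · intro h1
      have := congrArg (fun q => q i) (Finset.HasAntidiagonal.mem_antidiagonal.mp hp)
      simp [h1, h] at this
  · rw [Finset.sum_eq_single (Finsupp.single i 1, d - Finsupp.single i 1)]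
    · simp
    · rintro ⟨p, q⟩ hp hne
      rw [if_neg]
      · simp
      · intro h1
        simp only at h1
        subst h1
        have := Finset.HasAntidiagonal.mem_antidiagonal.mp hp
        apply hne
        simp [← this]
    · intro hn
      exfalso
      apply hn
      rw [Finset.HasAntidiagonal.mem_antidiagonal]
      apply add_tsub_cancel_of_le
      rw [Finsupp.single_le_iff]
      omega

/-- Terms with `p.1 i = 0` have weight zero, and the others are shifts by one in the first exponent.
This is one half of the Leibniz rule. -/
theorem sum_antidiagonal_add_single (i : Fin n) (B : V →ₗ[ℂ] W →ₗ[ℂ] Z) (φ : Series n V)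
    (ψ : Series n W) (d : Fin n →₀ ℕ) :
    ∑ p ∈ (Finset.HasAntidiagonal.antidiagonal (d + Finsupp.single i 1) :
        Finset ((Fin n →₀ ℕ) × (Fin n →₀ ℕ))), ((p.1 i : ℕ) : ℂ) • B (φ p.1) (ψ p.2) = bilin B (pderiv i φ) ψ d := by
  simp only [bilin, pderiv, map_smul, LinearMap.smul_apply]
  symm
  apply Finset.sum_of_injOn (fun p => (p.1 + Finsupp.single i 1, p.2))
  · rintro ⟨a, b⟩ _ ⟨a', b'⟩ _ h
    simpa using h
  · rintro ⟨a, b⟩ h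
    simp only [Finset.mem_coe, Finset.HasAntidiagonal.mem_antidiagonal] at h ⊢
    rw [← h]; abel
  · rintro ⟨a, b⟩ h hn
    have ha : a i = 0 := by
      by_contra h0
      apply hn
      refine ⟨(a - Finsupp.single i 1, b), ?_, ?_⟩
      · have hle : Finsupp.single i 1 ≤ a := by
          rw [Finsupp.single_le_iff]; omega
        simp only [Finset.mem_coe, Finset.HasAntidiagonal.mem_antidiagonal] at h ⊢
        have := tsub_add_cancel_of_le hle
        apply add_right_cancel (b := Finsupp.single i 1)
        rw [← h, add_right_comm, this]
      · have hle : Finsupp.single i 1 ≤ a := by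
          rw [Finsupp.single_le_iff]; omega
        simp [tsub_add_cancel_of_le hle]
    simp [ha]
  · rintro ⟨a, b⟩ h
    simp

/-- Leibniz rule for partial derivatives. -/
theorem pderiv_bilin (i : Fin n) (B : V →ₗ[ℂ] W →ₗ[ℂ] Z) (φ : Series n V) (ψ : Series n W) :
    pderiv i (bilin B φ ψ) = bilin B (pderiv i φ) ψ + bilin B φ (pderiv i ψ) := by
  funext d
  have h2 := sum_antidiagonal_add_single i B.flip ψ φ d
  rw [bilin_flip, ← Finset.HasAntidiagonal.map_swap_antidiagonal, Finset.sum_map] at h2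
  rw [Pi.add_apply, ← sum_antidiagonal_add_single, ← h2, ← Finset.sum_add_distrib]
  simp only [pderiv, bilin, Finset.smul_sum]
  refine Finset.sum_congr rfl fun p hp => ?_
  -- The weight `d i + 1` splits as `p.1 i + p.2 i`, one summand for each factor.
  have := congrArg (fun q => q i) (Finset.HasAntidiagonal.mem_antidiagonal.mp hp)
  simp only [Finsupp.add_apply, Finsupp.single_eq_same] at this
  simp only [Function.Embedding.coeFn_mk, Prod.fst_swap, Prod.snd_swap, LinearMap.flip_apply,
    ← add_smul, ← this]
  push_cast
  rfl

/-- The Euler operator `∑ x_i ∂/∂x_i`. -/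
def euler (φ : Series n V) : Series n V := fun d => (d.degree : ℂ) • φ d

theorem euler_bilin (B : V →ₗ[ℂ] W →ₗ[ℂ] Z) (φ : Series n V) (ψ : Series n W) :
    euler (bilin B φ ψ) = bilin B (euler φ) ψ + bilin B φ (euler ψ) := by
  funext d
  simp only [euler, bilin, Pi.add_apply, Finset.smul_sum, ← Finset.sum_add_distrib]
  refine Finset.sum_congr rfl fun p hp => ?_
  rw [← Finset.HasAntidiagonal.mem_antidiagonal.mp hp]
  simp [add_smul]

theorem mulX_pderiv_apply (i : Fin n) (φ : Series n V) (d : Fin n →₀ ℕ) :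
    mulX i (pderiv i φ) d = (d i : ℂ) • φ d := by
  simp only [mulX, pderiv]
  split_ifs with h
  · simp [h]
  · have hle : Finsupp.single i 1 ≤ d := by
      rw [Finsupp.single_le_iff]; omega
    rw [tsub_add_cancel_of_le hle]
    congr 2
    simp
    omega

theorem euler_eq_sum (φ : Series n V) : euler φ = ∑ i, mulX i (pderiv i φ) := by
  funext d
  rw [Finset.sum_apply]
  simp only [mulX_pderiv_apply, ← Finset.sum_smul, euler]
  congr 1
  rw [Finsupp.degree_eq_sum]
  push_cast
  rfl

theorem euler_pderiv (i : Fin n) (φ : Series n V) :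
    pderiv i (euler φ) = euler (pderiv i φ) + pderiv i φ := by
  funext d
  simp only [euler, pderiv, Pi.add_apply, map_add, Finsupp.degree_single]
  push_cast
  module

end SeriesCalculus

/-! ### The Bianchi identity for the curvature of a skew-symmetric function -/

section Bianchi

set_option linter.unusedSectionVars false

variable {A G M ι : Type*} [CommRing A] [AddCommGroup G] [Module A G] [AddCommGroup M] [Module A M]
  [Fintype ι] [DecidableEq ι]

/-- The setting for dynamical Yang-Baxter equations: a Lie algebra `G` over `A` with bracket `br`,
a space `M` of functionals with pairing `p` and coadjoint action `co`, a symmetric invariant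
operator `S`, and elements `x i`, `e i` dual to each other with a linear function `eps` spanned by
the `e i`. -/
structure Frame (p : M →ₗ[A] G →ₗ[A] A) (br : G →ₗ[A] G →ₗ[A] G) (co : G →ₗ[A] M →ₗ[A] M)
    (S : M →ₗ[A] G) (x : ι → G) (e : ι → M) (eps : M) : Prop where
  skew : ∀ y z, br y z = -br z y
  jacobi : ∀ y z w, br y (br z w) = br (br y z) w + br z (br y w)
  co_apply : ∀ y α z, p (co y α) z = -p α (br y z)
  symm : ∀ α β, p β (S α) = p α (S β)
  inv : ∀ y α, S (co y α) = br y (S α)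
  dual : ∀ i j, p (e i) (x j) = if i = j then 1 else 0
  proj : ∀ j y, p eps (br (x j) y) = ∑ i, p (e i) y * p eps (br (x j) (x i))

/-- The projection to the span of the `x i`. -/
def projG (p : M →ₗ[A] G →ₗ[A] A) (x : ι → G) (e : ι → M) : G →ₗ[A] G :=
  ∑ i, (p (e i)).smulRight (x i)

/-- The transpose of `projG`. -/
def projM (p : M →ₗ[A] G →ₗ[A] A) (x : ι → G) (e : ι → M) : M →ₗ[A] M :=
  ∑ i, (p.flip (x i)).smulRight (e i)

theorem projG_apply (p : M →ₗ[A] G →ₗ[A] A) (x : ι → G) (e : ι → M) (y : G) :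
    projG p x e y = ∑ i, p (e i) y • x i := by simp [projG]

theorem projM_apply (p : M →ₗ[A] G →ₗ[A] A) (x : ι → G) (e : ι → M) (α : M) :
    projM p x e α = ∑ i, p α (x i) • e i := by simp [projM]

/-- The form `Alt(dR) + CYB(R) + CYB(S)` on functionals. -/
def curvForm (p : M →ₗ[A] G →ₗ[A] A) (br : G →ₗ[A] G →ₗ[A] G)
    (S : M →ₗ[A] G) (x : ι → G) (R : M →ₗ[A] G) (D : ι → M →ₗ[A] G) (α β γ : M) : A :=
  ∑ i, (p α (x i) * p γ (D i β) + p β (x i) * p α (D i γ) + p γ (x i) * p β (D i α)) +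
    p α (br (R β) (R γ)) + p β (br (R γ) (R α)) + p γ (br (R α) (R β)) + p α (br (S β) (S γ))

variable {p : M →ₗ[A] G →ₗ[A] A} {br : G →ₗ[A] G →ₗ[A] G} {co : G →ₗ[A] M →ₗ[A] M}
    {S : M →ₗ[A] G} {x : ι → G} {e : ι → M} {eps : M}

namespace Frame

theorem pair_projM (α : M) (y : G) : p (projM p x e α) y = ∑ i, p α (x i) * p (e i) y := by
  simp [projM_apply]

theorem pair_projG (α : M) (y : G) : p α (projG p x e y) = ∑ i, p α (x i) * p (e i) y := by
  simp [projG_apply, mul_comm]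

theorem projM_x (h : Frame p br co S x e eps) (α : M) (i : ι) :
    p (projM p x e α) (x i) = p α (x i) := by
  simp [pair_projM, h.dual]

/-- The cubic form of `S` is cyclic. -/
theorem cubic_swap (h : Frame p br co S x e eps) (α β : M) (y : G) :
    p α (br (S β) y) = -p β (br (S α) y) := by
  rw [h.skew, map_neg, ← h.co_apply, ← h.symm, h.inv, h.skew, map_neg, h.skew, ← map_neg, neg_neg,
    h.skew, map_neg]

theorem cubic_cycle (h : Frame p br co S x e eps) (α β γ : M) :
    p α (br (S β) (S γ)) = p β (br (S γ) (S α)) := by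
  rw [h.cubic_swap, h.skew, map_neg, neg_neg]

/-- `S` intertwines the coadjoint and adjoint actions, and `y` acts on the bracket as a derivation.
-/
theorem cubic_inv (h : Frame p br co S x e eps) (y : G) (α β γ : M) :
    p (co y α) (br (S β) (S γ)) + p α (br (S (co y β)) (S γ)) +
      p α (br (S β) (S (co y γ))) = 0 := by
  rw [h.co_apply, h.inv, h.inv, h.jacobi, map_add]
  ring

variable {R : M →ₗ[A] G} {D : ι → M →ₗ[A] G}

/-- This is how equivariance enters the Bianchi identity: its instances at the `x j` are weighted by
`e j (R β)` and summed, and `Frame.proj` identifies the resulting coefficients with `-(co (R β) eps)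
(x i)`. -/
theorem pair_projG_bracket (h : Frame p br co S x e eps)
    (hR : ∀ α β, p β (R α) = -p α (R β))
    (hequiv : ∀ j α, br (x j) (R α) - R (co (x j) α) +
      ∑ i, p eps (br (x j) (x i)) • D i α = 0) (α β γ : M) :
    p α (br (projG p x e (R β)) (R γ)) - p γ (br (projG p x e (R β)) (R α)) =
      ∑ i, p (co (R β) eps) (x i) * p α (D i γ) := by
  have h1 : ∀ j, p α (br (x j) (R γ)) - p γ (br (x j) (R α)) =
      -∑ i, p eps (br (x j) (x i)) * p α (D i γ) := by
    intro j
    have := congrArg (p α) (hequiv j γ)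
    simp only [map_add, map_sub, map_sum, map_smul, smul_eq_mul, map_zero] at this
    rw [hR, h.co_apply] at this
    linear_combination this
  have h2 : ∀ i, p (co (R β) eps) (x i) = -∑ j, p (e j) (R β) * p eps (br (x j) (x i)) := by
    intro i
    rw [h.co_apply, h.skew, map_neg, h.proj]
    simp only [neg_neg, ← Finset.sum_neg_distrib]
    refine Finset.sum_congr rfl fun j _ => ?_
    rw [h.skew (x i), map_neg]
    ring
  simp only [projG_apply, map_sum, map_smul, LinearMap.sum_apply, LinearMap.smul_apply,
    smul_eq_mul, ← Finset.sum_sub_distrib, ← mul_sub, h1, h2, Finset.mul_sum, neg_mul, mul_neg,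
    Finset.sum_mul, Finset.sum_neg_distrib]
  rw [Finset.sum_comm]
  simp only [mul_assoc]

end Frame

/-- The Bianchi identity: if `R` satisfies the radial part of the dynamical Yang-Baxter equation,
then the curvature form satisfies a homogeneous linear radial equation. Here `Zα`, `Zβ`, `Zγ` are
the radial derivatives of `R` at `α`, `β`, `γ`, and `X i` the ones of the matrix elements of
the partial derivatives of `R`. -/
theorem bianchi (h : Frame p br co S x e eps) {R : M →ₗ[A] G} {D : ι → M →ₗ[A] G}
    (hR : ∀ α β, p β (R α) = -p α (R β)) (hD : ∀ i α β, p β (D i α) = -p α (D i β))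
    (hequiv : ∀ j α, br (x j) (R α) - R (co (x j) α) +
      ∑ i, p eps (br (x j) (x i)) • D i α = 0)
    {α β γ : M} {Zα Zβ Zγ : G} {Xα Xβ Xγ : ι → A}
    (hZα : Zα + R (projM p x e α) + projG p x e (R α) + R (co (R α) eps) - br (S α) (S eps) = 0)
    (hZβ : Zβ + R (projM p x e β) + projG p x e (R β) + R (co (R β) eps) - br (S β) (S eps) = 0)
    (hZγ : Zγ + R (projM p x e γ) + projG p x e (R γ) + R (co (R γ) eps) - br (S γ) (S eps) = 0)
    (hXα : ∀ i, Xα i + p γ (D i β) + p γ (D i (projM p x e β)) + p (projM p x e γ) (D i β) +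
      p (e i) (br (R β) (R γ)) + p eps (br (D i β) (R γ)) + p eps (br (R β) (D i γ)) +
      p (e i) (br (S β) (S γ)) = 0)
    (hXβ : ∀ i, Xβ i + p α (D i γ) + p α (D i (projM p x e γ)) + p (projM p x e α) (D i γ) +
      p (e i) (br (R γ) (R α)) + p eps (br (D i γ) (R α)) + p eps (br (R γ) (D i α)) +
      p (e i) (br (S γ) (S α)) = 0)
    (hXγ : ∀ i, Xγ i + p β (D i α) + p β (D i (projM p x e α)) + p (projM p x e β) (D i α) +
      p (e i) (br (R α) (R β)) + p eps (br (D i α) (R β)) + p eps (br (R α) (D i β)) +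
      p (e i) (br (S α) (S β)) = 0) :
    (∑ i, (p α (x i) * Xα i + p β (x i) * Xβ i + p γ (x i) * Xγ i) +
      p α (br Zβ (R γ)) + p α (br (R β) Zγ) + p β (br Zγ (R α)) + p β (br (R γ) Zα) +
      p γ (br Zα (R β)) + p γ (br (R α) Zβ)) +
    curvForm p br S x R D (projM p x e α) β γ + curvForm p br S x R D α (projM p x e β) γ +
    curvForm p br S x R D α β (projM p x e γ) +
    curvForm p br S x R D (co (R α) eps) β γ + curvForm p br S x R D α (co (R β) eps) γ +
    curvForm p br S x R D α β (co (R γ) eps) = 0 := by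
  set a := projM p x e α with ha
  set b := projM p x e β with hb
  set c := projM p x e γ with hc
  have ha1 := h.projM_x α; have hb1 := h.projM_x β; have hc1 := h.projM_x γ
  rw [← ha] at ha1; rw [← hb] at hb1; rw [← hc] at hc1
  have hsum : ∀ (α : M) (y : G), ∑ i, p α (x i) * p (e i) y = p (projM p x e α) y :=
    fun α y => (Frame.pair_projM α y).symm
  -- the part with partial derivatives
  have hX : ∑ i, (p α (x i) * Xα i + p β (x i) * Xβ i + p γ (x i) * Xγ i) =
      -(∑ i, (p α (x i) * (p γ (D i β) + p γ (D i b) + p c (D i β) +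
        p eps (br (D i β) (R γ)) + p eps (br (R β) (D i γ))) +
        p β (x i) * (p α (D i γ) + p α (D i c) + p a (D i γ) +
        p eps (br (D i γ) (R α)) + p eps (br (R γ) (D i α))) +
        p γ (x i) * (p β (D i α) + p β (D i a) + p b (D i α) +
        p eps (br (D i α) (R β)) + p eps (br (R α) (D i β))))) -
      (p a (br (R β) (R γ)) + p a (br (S β) (S γ)) + p b (br (R γ) (R α)) +
        p b (br (S γ) (S α)) + p c (br (R α) (R β)) + p c (br (S α) (S β))) := by
    rw [ha, hb, hc]
    simp only [← hsum _ (br _ _), ← Finset.sum_add_distrib, ← Finset.sum_neg_distrib,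
      ← Finset.sum_sub_distrib]
    refine Finset.sum_congr rfl fun i _ => ?_
    linear_combination p α (x i) * hXα i + p β (x i) * hXβ i + p γ (x i) * hXγ i
  have E1 := h.pair_projG_bracket hR hequiv α β γ
  have E2 := h.pair_projG_bracket hR hequiv β γ α
  have E3 := h.pair_projG_bracket hR hequiv γ α β
  have eZα : Zα = -R a - projG p x e (R α) - R (co (R α) eps) + br (S α) (S eps) := by
    rw [← sub_eq_zero, ← hZα]; abel
  have eZβ : Zβ = -R b - projG p x e (R β) - R (co (R β) eps) + br (S β) (S eps) := by
    rw [← sub_eq_zero, ← hZβ]; abel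
  have eZγ : Zγ = -R c - projG p x e (R γ) - R (co (R γ) eps) + br (S γ) (S eps) := by
    rw [← sub_eq_zero, ← hZγ]; abel
  have hco : ∀ y z, p (co y eps) z = -p eps (br y z) := fun y z => h.co_apply y eps z
  -- terms containing derivatives
  have hsums : ∑ i, (p α (x i) * Xα i + p β (x i) * Xβ i + p γ (x i) * Xγ i) +
      ∑ i, (p a (x i) * p γ (D i β) + p β (x i) * p a (D i γ) + p γ (x i) * p β (D i a)) +
      ∑ i, (p α (x i) * p γ (D i b) + p b (x i) * p α (D i γ) + p γ (x i) * p b (D i α)) +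
      ∑ i, (p α (x i) * p c (D i β) + p β (x i) * p α (D i c) + p c (x i) * p β (D i α)) +
      ∑ i, (p (co (R α) eps) (x i) * p γ (D i β) + p β (x i) * p (co (R α) eps) (D i γ) +
        p γ (x i) * p β (D i (co (R α) eps))) +
      ∑ i, (p α (x i) * p γ (D i (co (R β) eps)) + p (co (R β) eps) (x i) * p α (D i γ) +
        p γ (x i) * p (co (R β) eps) (D i α)) +
      ∑ i, (p α (x i) * p (co (R γ) eps) (D i β) + p β (x i) * p α (D i (co (R γ) eps)) +
        p (co (R γ) eps) (x i) * p β (D i α)) =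
      ∑ i, p (co (R β) eps) (x i) * p α (D i γ) + ∑ i, p (co (R γ) eps) (x i) * p β (D i α) +
      ∑ i, p (co (R α) eps) (x i) * p γ (D i β) -
      (p a (br (R β) (R γ)) + p a (br (S β) (S γ)) + p b (br (R γ) (R α)) +
        p b (br (S γ) (S α)) + p c (br (R α) (R β)) + p c (br (S α) (S β))) := by
    -- The part without derivatives is moved to the end and stripped off, so that the rest can be
    -- compared index by index.
    rw [hX, sub_eq_add_neg, sub_eq_add_neg _ (p a (br (R β) (R γ)) + _ + _ + _ + _ + _)]
    simp only [add_right_comm _ (-(p a (br (R β) (R γ)) + _ + _ + _ + _ + _)) _]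
    congr 1
    simp only [← Finset.sum_add_distrib, ← Finset.sum_neg_distrib]
    refine Finset.sum_congr rfl fun i _ => ?_
    have d1 := hD i (co (R α) eps) β
    have d2 := hD i (co (R β) eps) γ
    have d3 := hD i (co (R γ) eps) α
    have s1 := h.skew (D i α) (R β)
    have s2 := h.skew (D i β) (R γ)
    have s3 := h.skew (D i γ) (R α)
    rw [d1, d2, d3, s1, s2, s3]
    simp only [hco, map_neg, ha1, hb1, hc1]
    ring
  -- terms with `S`
  have hS : ∀ α β γ : M, p α (br (br (S β) (S eps)) (R γ)) + p β (br (R γ) (br (S α) (S eps))) +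
      p (α) (br (S β) (S (co (R γ) eps))) = 0 := by
    intro α β γ
    -- The identity is the invariance of the cubic form under `R γ`, with the action on `α` and `β`
    -- moved into the brackets.
    have h1 := h.cubic_inv (R γ) α β eps
    have h2 := h.cubic_swap β α (S eps)
    have h3 := h.cubic_swap (co (R γ) β) α (S eps)
    rw [h.skew (br _ _) (R γ), map_neg, ← h.co_apply, ← neg_neg (p β _), ← h.co_apply, h3]
    linear_combination h1
  have T1 := hS α β γ
  have T2 := hS β γ α
  have T3 := hS γ α β
  have C1 := h.cubic_cycle (co (R α) eps) β γ
  have C2 := h.cubic_cycle α (co (R β) eps) γ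
  have C3 := h.cubic_cycle (co (R β) eps) γ α
  have C7 := h.cubic_cycle α b γ
  have C8 := h.cubic_cycle c α β
  -- Jacobi identity
  have J := congrArg (p eps) (h.jacobi (R α) (R β) (R γ))
  rw [map_add, h.skew (br (R α) (R β)), h.skew (R α) (R γ), map_neg, map_neg, map_neg] at J
  have s1 := h.skew (R α) (projG p x e (R β))
  have s2 := h.skew (R β) (projG p x e (R γ))
  have s3 := h.skew (R γ) (projG p x e (R α))
  simp only [curvForm, eZα, eZβ, eZγ, map_add, map_sub, map_neg, LinearMap.add_apply,
    LinearMap.sub_apply, LinearMap.neg_apply, s1, s2, s3, hco] at *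
  linear_combination hsums - E1 - E2 - E3 + T1 + T2 + T3 - J + C1 + C2 + C3 + C7 - C8

end Bianchi

/-! ### Linear maps on values, and constant series -/

section MapValues

set_option linter.unusedSectionVars false

variable {n : ℕ} {V W Z U : Type*} [AddCommGroup V] [Module ℂ V] [AddCommGroup W] [Module ℂ W]
  [AddCommGroup Z] [Module ℂ Z] [AddCommGroup U] [Module ℂ U]

theorem bilin_mapValues_left (B : Z →ₗ[ℂ] W →ₗ[ℂ] U) (A : V →ₗ[ℂ] Z) (φ : Series n V)
    (ψ : Series n W) : bilin B (mapValues A φ) ψ = bilin (B ∘ₗ A) φ ψ := rfl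

theorem bilin_mapValues_right (B : V →ₗ[ℂ] Z →ₗ[ℂ] U) (A : W →ₗ[ℂ] Z) (φ : Series n V)
    (ψ : Series n W) : bilin B φ (mapValues A ψ) = bilin (B.compl₂ A) φ ψ := rfl

theorem bilin_add_map (B B' : V →ₗ[ℂ] W →ₗ[ℂ] Z) (φ : Series n V) (ψ : Series n W) :
    bilin (B + B') φ ψ = bilin B φ ψ + bilin B' φ ψ := by
  funext d; simp [bilin, Finset.sum_add_distrib]

theorem bilin_neg_map (B : V →ₗ[ℂ] W →ₗ[ℂ] Z) (φ : Series n V) (ψ : Series n W) :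
    bilin (-B) φ ψ = -bilin B φ ψ := by
  funext d; simp [bilin]

theorem mapValues_const (A : V →ₗ[ℂ] W) (v : V) : mapValues A (const n v) = const n (A v) := by
  funext d
  simp only [mapValues, const]
  split_ifs <;> simp

theorem pderiv_mapValues (i : Fin n) (A : V →ₗ[ℂ] W) (φ : Series n V) :
    pderiv i (mapValues A φ) = mapValues A (pderiv i φ) := by
  funext d; simp [pderiv, mapValues]

theorem euler_mapValues (A : V →ₗ[ℂ] W) (φ : Series n V) :
    euler (mapValues A φ) = mapValues A (euler φ) := by
  funext d; simp [euler, mapValues]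

theorem Scal.const_one : const n (1 : ℂ) = (1 : Scal n) := by
  classical
  funext d
  exact (MvPowerSeries.coeff_one (σ := Fin n) (R := ℂ) d).symm

/-- Constant scalar series. -/
def Scal.const (n : ℕ) (c : ℂ) : Scal n := DynR.const n c

theorem Scal.mul_const (a : Scal n) (c : ℂ) (d : Fin n →₀ ℕ) :
    (a * Scal.const n c) d = a d * c := by
  rw [Scal.mul_eq]
  exact congrFun (bilin_const_right (LinearMap.mul ℂ ℂ) a c) d

end MapValues

/-! ### Operators attached to formal functions with values in tensors -/

section Operators

variable (n : ℕ) (g : Type*) [LieRing g] [LieAlgebra ℂ g]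

/-- The bracket of `g` as a bilinear map. -/
def lieMap : g →ₗ[ℂ] g →ₗ[ℂ] g := (LieModule.toEnd ℂ g g : g →ₗ[ℂ] Module.End ℂ g)

@[simp] theorem lieMap_apply (y z : g) : lieMap g y z = ⁅y, z⁆ := rfl

/-- The bilinear map `(y, α) ↦ α ∘ ad y`. -/
def compAd : g →ₗ[ℂ] Module.Dual ℂ g →ₗ[ℂ] Module.Dual ℂ g :=
  (LinearMap.llcomp ℂ g g ℂ).flip ∘ₗ lieMap g

@[simp] theorem compAd_apply (y z : g) (α : Module.Dual ℂ g) : compAd g y α z = α ⁅y, z⁆ := rfl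

/-- `sharp` as a bilinear map. -/
def sharpMap : g ⊗[ℂ] g →ₗ[ℂ] Module.Dual ℂ g →ₗ[ℂ] g :=
  TensorProduct.lift (LinearMap.mk₂ ℂ
    (fun a c => ((LinearMap.id : Module.Dual ℂ g →ₗ[ℂ] (g →ₗ[ℂ] ℂ)).flip a).smulRight c)
    (by intros; ext; simp [add_smul]) (by intros; ext; simp [mul_smul])
    (by intros; ext; simp) (by intros c a v; exact LinearMap.ext fun α => smul_comm _ _ _))

@[simp] theorem sharpMap_tmul (a c : g) (α : Module.Dual ℂ g) :
    sharpMap g (a ⊗ₜ c) α = α a • c := rfl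

variable {g} in
theorem sharpMap_eq (r : g ⊗[ℂ] g) (α : Module.Dual ℂ g) : sharpMap g r α = sharp r α := by
  induction r using TensorProduct.induction_on with
  | zero => simp [sharp]
  | tmul a c => simp [sharp]
  | add r s hr hs => simp only [sharp, map_add, LinearMap.add_apply] at hr hs ⊢; rw [hr, hs]

/-- The pairing of functionals with vectors, on formal functions. -/
def pairF : Series n (Module.Dual ℂ g) →ₗ[Scal n] Series n g →ₗ[Scal n] Scal n :=
  form (LinearMap.id : Module.Dual ℂ g →ₗ[ℂ] (g →ₗ[ℂ] ℂ))

/-- The bracket on formal functions. -/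
def lieF : Series n g →ₗ[Scal n] Series n g →ₗ[Scal n] Series n g := bil (lieMap g)

/-- The coadjoint action on formal functions. -/
def coF : Series n g →ₗ[Scal n] Series n (Module.Dual ℂ g) →ₗ[Scal n] Series n (Module.Dual ℂ g) :=
  -bil (compAd g)

variable {n} {g}

/-- The operator from functionals to vectors defined by a function with values in tensors. -/
def opF (r : Series n (g ⊗[ℂ] g)) : Series n (Module.Dual ℂ g) →ₗ[Scal n] Series n g :=
  bil (sharpMap g) r

/-- Constant formal functions. -/
def cst {V : Type*} [AddCommGroup V] [Module ℂ V] (v : V) : Series n V := const n v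

theorem cst_apply {V : Type*} [AddCommGroup V] [Module ℂ V] (v : V) (d : Fin n →₀ ℕ) :
    (cst v : Series n V) d = if d = 0 then v else 0 := rfl

theorem pairF_cst (α : Module.Dual ℂ g) (φ : Series n g) : pairF n g (cst α) φ = mapValues α φ :=
  bilin_const_left _ _ _

theorem pairF_cst_coeff (α : Module.Dual ℂ g) (φ : Series n g) (d : Fin n →₀ ℕ) :
    pairF n g (cst α) φ d = α (φ d) := by rw [pairF_cst]; rfl

theorem opF_cst_right (r : Series n (g ⊗[ℂ] g)) (α : Module.Dual ℂ g) :
    opF r (cst α) = mapValues ((sharpMap g).flip α) r :=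
  bilin_const_right _ _ _

theorem opF_cst_left (Ω : g ⊗[ℂ] g) (α : Series n (Module.Dual ℂ g)) :
    opF (cst Ω) α = mapValues (sharpMap g Ω) α :=
  bilin_const_left _ _ _

theorem lieF_cst_left (y : g) (φ : Series n g) : lieF n g (cst y) φ = mapValues (lieMap g y) φ :=
  bilin_const_left _ _ _

theorem lieF_skew (y z : Series n g) : lieF n g y z = -lieF n g z y := by
  change bilin (lieMap g) y z = -bilin (lieMap g) z y
  rw [← bilin_flip (lieMap g) z y, ← bilin_neg_map]
  congr 1
  ext a c
  simp

theorem lieF_jacobi (y z w : Series n g) :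
    lieF n g y (lieF n g z w) = lieF n g (lieF n g y z) w + lieF n g z (lieF n g y w) := by
  let T : g →ₗ[ℂ] g →ₗ[ℂ] (g →ₗ[ℂ] g) := LinearMap.mk₂ ℂ (fun a c => lieMap g a ∘ₗ lieMap g c)
    (by intros; ext; simp) (by intros; ext; simp) (by intros; ext; simp) (by intros; ext; simp)
  have hT : ∀ a c v, (LinearMap.id : (g →ₗ[ℂ] g) →ₗ[ℂ] (g →ₗ[ℂ] g)) (T a c) v =
    lieMap g a (lieMap g c v) := fun _ _ _ => rfl
  have h1 := bilin_assoc hT y z w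
  have h2 := bilin_assoc hT z y w
  change bilin (lieMap g) y (bilin (lieMap g) z w) =
    bilin (lieMap g) (bilin (lieMap g) y z) w + bilin (lieMap g) z (bilin (lieMap g) y w)
  rw [← h1, ← h2, ← bilin_flip T z y, ← sub_eq_iff_eq_add, sub_eq_add_neg]
  -- The Jacobi identity of `g`, as an identity of bilinear maps with values in `End g`;
  -- reassociation then extends it to series.
  have h3 : T = (lieMap g).compr₂ (lieMap g) + T.flip := by
    ext a c v
    simp [T]
  have h4 : bilin T y z = mapValues (lieMap g) (bilin (lieMap g) y z) + bilin T.flip y z := by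
    rw [mapValues_bilin, ← bilin_add_map, ← h3]
  rw [h4, bilin_add_left, add_neg_cancel_right]
  rfl

theorem pairF_coF (y : Series n g) (α : Series n (Module.Dual ℂ g)) (z : Series n g) :
    pairF n g (coF n g y α) z = -pairF n g α (lieF n g y z) := by
  simp only [coF, LinearMap.neg_apply, map_neg]
  congr 1
  let C' : Module.Dual ℂ g →ₗ[ℂ] g →ₗ[ℂ] Module.Dual ℂ g :=
    LinearMap.mk₂ ℂ (fun α z => α ∘ₗ (lieMap g).flip z)
    (by intros; ext; simp) (by intros; ext; simp) (by intros; ext; simp) (by intros; ext; simp)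
  let B' : g →ₗ[ℂ] Module.Dual ℂ g →ₗ[ℂ] ℂ :=
    (LinearMap.id : Module.Dual ℂ g →ₗ[ℂ] (g →ₗ[ℂ] ℂ)).flip
  have h1 := bilin_assoc (B := (LinearMap.id : Module.Dual ℂ g →ₗ[ℂ] (g →ₗ[ℂ] ℂ)))
    (C := compAd g) (B' := B') (C' := C') (fun _ _ _ => rfl) y α z
  have h2 := bilin_left_comm (B := (LinearMap.id : Module.Dual ℂ g →ₗ[ℂ] (g →ₗ[ℂ] ℂ)))
    (C := lieMap g) (B' := B') (C' := C') (fun _ _ _ => rfl) α y z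
  exact h1.trans h2.symm

/-- The action of `y` on the first leg becomes precomposition of `α` with `ad y`, and on the second
leg it is the bracket; invariance says that the two cancel. -/
theorem sharpMap_compAd {Ω : g ⊗[ℂ] g} {y : g} (hΩ : ⁅y, Ω⁆ = 0) (α : Module.Dual ℂ g) :
    sharpMap g Ω (compAd g y α) = -⁅y, sharpMap g Ω α⁆ := by
  have key : ∀ r : g ⊗[ℂ] g, sharpMap g ⁅y, r⁆ α =
      sharpMap g r (compAd g y α) + ⁅y, sharpMap g r α⁆ := by
    intro r
    induction r using TensorProduct.induction_on with
    | zero => simp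
    | tmul a c => simp
    | add r s hr hs =>
      simp only [lie_add, map_add, LinearMap.add_apply] at hr hs ⊢; rw [hr, hs]; abel
  have := key Ω
  rw [hΩ, map_zero, LinearMap.zero_apply] at this
  exact eq_neg_of_add_eq_zero_left this.symm

theorem pair_sharpMap_flip (r : g ⊗[ℂ] g) (α β : Module.Dual ℂ g) :
    β (sharpMap g (flip r) α) = α (sharpMap g r β) := by
  induction r using TensorProduct.induction_on with
  | zero => simp [flip]
  | tmul a c => simp [flip, mul_comm]
  | add r s hr hs =>
    simp only [flip, map_add, LinearMap.add_apply] at hr hs ⊢; rw [hr, hs]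

/-- The operators of `r` and of its flip are transposes of each other. -/
theorem pairF_opF_flip (r : Series n (g ⊗[ℂ] g)) (α β : Series n (Module.Dual ℂ g)) :
    pairF n g β (opF (fun d => flip (r d)) α) = pairF n g α (opF r β) := by
  let C' : Module.Dual ℂ g →ₗ[ℂ] Module.Dual ℂ g →ₗ[ℂ] Module.Dual ℂ (g ⊗[ℂ] g) :=
    LinearMap.mk₂ ℂ (fun α β => α ∘ₗ (sharpMap g).flip β)
    (by intros; rfl) (by intros; rfl)
    (by intros; exact LinearMap.ext fun _ => by simp) (by intros; exact LinearMap.ext fun _ => by simp)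
  let ev : (g ⊗[ℂ] g) →ₗ[ℂ] Module.Dual ℂ (g ⊗[ℂ] g) →ₗ[ℂ] ℂ :=
    (LinearMap.id : Module.Dual ℂ (g ⊗[ℂ] g) →ₗ[ℂ] (g ⊗[ℂ] g →ₗ[ℂ] ℂ)).flip
  have h1 := bilin_left_comm (B := (LinearMap.id : Module.Dual ℂ g →ₗ[ℂ] (g →ₗ[ℂ] ℂ)))
    (C := sharpMap g) (B' := ev) (C' := C') (fun _ _ _ => rfl) α r β
  have h2 := bilin_left_comm (B := (LinearMap.id : Module.Dual ℂ g →ₗ[ℂ] (g →ₗ[ℂ] ℂ)))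
    (C := (sharpMap g) ∘ₗ (TensorProduct.comm ℂ g g).toLinearMap) (B' := ev) (C' := C'.flip)
    (fun β r α => pair_sharpMap_flip r α β) β r α
  rw [bilin_flip C' α β] at h2
  exact h2.trans h1.symm

theorem opF_neg (r : Series n (g ⊗[ℂ] g)) : opF (-r) = -opF r := by
  simp [opF]

theorem opF_add (r s : Series n (g ⊗[ℂ] g)) : opF (r + s) = opF r + opF s := by
  simp [opF]

theorem pairF_opF_skew {r : Series n (g ⊗[ℂ] g)} (hr : ∀ d, flip (r d) = -r d)
    (α β : Series n (Module.Dual ℂ g)) : pairF n g β (opF r α) = -pairF n g α (opF r β) := by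
  rw [← pairF_opF_flip r α β]
  have : (fun d => flip (r d) : Series n (g ⊗[ℂ] g)) = -r := funext hr
  rw [this, opF_neg]
  simp

/-- The formal linear function on the dual space given by functionals `e i`. -/
def epsF (e : Fin n → Module.Dual ℂ g) : Series n (Module.Dual ℂ g) :=
  ∑ i, (MvPowerSeries.X i : Scal n) • cst (e i)

theorem pairF_epsF (e : Fin n → Module.Dual ℂ g) (φ : Series n g) :
    pairF n g (epsF e) φ = ∑ i, (MvPowerSeries.X i : Scal n) * pairF n g (cst (e i)) φ := by
  simp [epsF]

/-- Everything here except `epsF e` is constant or a bilinear extension, so the axioms reduce to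
identities in `g`. The condition `hproj` expresses that brackets with `x j` preserve the common
kernel of the `e i`, which will be `m`. The tensor will be half of the given invariant. -/
theorem frame {Ω : g ⊗[ℂ] g} (hsym : flip Ω = Ω) (hinv : ∀ y : g, ⁅y, Ω⁆ = 0)
    {x : Fin n → g} {e : Fin n → Module.Dual ℂ g} (hdual : ∀ i j, e i (x j) = if i = j then 1 else 0)
    (hproj : ∀ k j y, e k ⁅x j, y⁆ = ∑ i, e i y * e k ⁅x j, x i⁆) :
    Frame (pairF n g) (lieF n g) (coF n g) (opF (cst Ω)) (fun i => cst (x i)) (fun i => cst (e i))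
      (epsF e) where
  skew := lieF_skew
  jacobi := lieF_jacobi
  co_apply := pairF_coF
  symm α β := by
    rw [← pairF_opF_flip]
    have : (fun d => flip (cst Ω d) : Series n (g ⊗[ℂ] g)) = cst Ω := by
      funext d
      simp only [cst_apply]
      split_ifs
      · exact hsym
      · simp [flip]
    rw [this]
  inv y α := by
    rw [opF_cst_left, opF_cst_left]
    change mapValues _ (-bilin (compAd g) y α) = bilin (lieMap g) y (mapValues _ α)
    rw [← bilin_neg_map, mapValues_bilin, bilin_mapValues_right]
    congr 1
    ext y α : 2
    simp [sharpMap_compAd (hinv y)]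
  dual i j := by
    rw [pairF_cst, cst, mapValues_const, hdual]
    split_ifs
    · exact Scal.const_one
    · funext d
      exact ite_self _
  proj j y := by
    simp only [pairF_epsF, Finset.mul_sum]
    rw [Finset.sum_comm]
    refine Finset.sum_congr rfl fun k _ => ?_
    simp only [mul_left_comm _ (MvPowerSeries.X k : Scal n), ← Finset.mul_sum]
    congr 1
    funext d
    have h1 : ∀ i, pairF n g (cst (e k)) (lieF n g (cst (x j)) (cst (x i))) =
        Scal.const n (e k ⁅x j, x i⁆) := by
      intro i
      rw [pairF_cst, lieF_cst_left, cst, mapValues_const, mapValues_const]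
      rfl
    simp only [h1]
    refine Eq.trans ?_ (Finset.sum_apply (M := fun _ => ℂ) d _ _).symm
    simp only [Scal.mul_const, pairF_cst_coeff]
    rw [lieF_cst_left]
    exact hproj k j (y d)

end Operators

/-! ### Derivations of formal functions -/

section Derivations

set_option linter.unusedSectionVars false

variable {n : ℕ} {V W Z : Type*} [AddCommGroup V] [Module ℂ V] [AddCommGroup W] [Module ℂ W]
  [AddCommGroup Z] [Module ℂ Z]

/-- The Euler operator on scalar series. -/
def Scal.euler : Scal n →+ Scal n where
  toFun a := DynR.euler (V := ℂ) a
  map_zero' := funext fun _ => smul_zero _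
  map_add' _ _ := funext fun _ => smul_add _ _ _

/-- Partial derivatives of scalar series. -/
def Scal.pderiv (i : Fin n) : Scal n →+ Scal n where
  toFun a := DynR.pderiv (V := ℂ) i a
  map_zero' := funext fun _ => smul_zero _
  map_add' _ _ := funext fun _ => smul_add _ _ _

theorem Scal.euler_coeff (a : Scal n) (d : Fin n →₀ ℕ) :
    Scal.euler a d = (d.degree : ℂ) * a d := rfl

theorem Scal.euler_mul (a b : Scal n) :
    Scal.euler (a * b) = Scal.euler a * b + a * Scal.euler b := by
  simp only [Scal.mul_eq]
  exact euler_bilin (LinearMap.mul ℂ ℂ) a b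

theorem Scal.pderiv_euler (i : Fin n) (a : Scal n) :
    Scal.pderiv i (Scal.euler a) = Scal.euler (Scal.pderiv i a) + Scal.pderiv i a :=
  euler_pderiv (V := ℂ) i a

theorem pderiv_add (i : Fin n) (φ ψ : Series n V) :
    pderiv i (φ + ψ) = pderiv i φ + pderiv i ψ := funext fun _ => smul_add _ _ _

theorem pderiv_cst (i : Fin n) (v : V) : pderiv i (cst v : Series n V) = 0 := by
  funext d
  have : d + Finsupp.single i 1 ≠ 0 := by
    intro h
    have := congrArg (fun q => q i) h
    simp at this
  simp [pderiv, cst_apply, this]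

theorem euler_cst (v : V) : euler (cst v : Series n V) = 0 := by
  funext d
  simp only [euler, cst_apply, Pi.zero_apply]
  split_ifs with h
  · simp [h]
  · simp

variable {g : Type*} [LieRing g] [LieAlgebra ℂ g]

theorem Scal.pderiv_pairF (i : Fin n) (α : Series n (Module.Dual ℂ g)) (y : Series n g) :
    Scal.pderiv i (pairF n g α y) = pairF n g (DynR.pderiv i α) y + pairF n g α (DynR.pderiv i y) :=
  pderiv_bilin i (LinearMap.id : Module.Dual ℂ g →ₗ[ℂ] (g →ₗ[ℂ] ℂ)) α y

theorem Scal.euler_pairF (α : Series n (Module.Dual ℂ g)) (y : Series n g) :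
    Scal.euler (pairF n g α y) = pairF n g (DynR.euler α) y + pairF n g α (DynR.euler y) :=
  euler_bilin (LinearMap.id : Module.Dual ℂ g →ₗ[ℂ] (g →ₗ[ℂ] ℂ)) α y

theorem Scal.pderiv_pairF_cst (i : Fin n) (α : Module.Dual ℂ g) (y : Series n g) :
    Scal.pderiv i (pairF n g (cst α) y) = pairF n g (cst α) (DynR.pderiv i y) := by
  rw [Scal.pderiv_pairF, pderiv_cst]; simp

theorem Scal.euler_pairF_cst (α : Module.Dual ℂ g) (y : Series n g) :
    Scal.euler (pairF n g (cst α) y) = pairF n g (cst α) (DynR.euler y) := by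
  rw [Scal.euler_pairF, euler_cst]; simp

theorem pderiv_lieF (i : Fin n) (y z : Series n g) :
    pderiv i (lieF n g y z) = lieF n g (pderiv i y) z + lieF n g y (pderiv i z) :=
  pderiv_bilin i (lieMap g) y z

theorem euler_lieF (y z : Series n g) :
    euler (lieF n g y z) = lieF n g (euler y) z + lieF n g y (euler z) :=
  euler_bilin (lieMap g) y z

theorem pderiv_opF_cst (i : Fin n) (r : Series n (g ⊗[ℂ] g)) (β : Module.Dual ℂ g) :
    pderiv i (opF r (cst β)) = opF (pderiv i r) (cst β) := by
  rw [opF_cst_right, opF_cst_right, pderiv_mapValues]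

theorem euler_opF_cst (r : Series n (g ⊗[ℂ] g)) (β : Module.Dual ℂ g) :
    euler (opF r (cst β)) = opF (euler r) (cst β) := by
  rw [opF_cst_right, opF_cst_right, euler_mapValues]

theorem X_smul_cst_apply (i : Fin n) (v : V) (d : Fin n →₀ ℕ) :
    ((MvPowerSeries.X i : Scal n) • (cst v : Series n V)) d =
      if d = Finsupp.single i 1 then v else 0 := by
  rw [X_smul]
  simp only [mulX, cst_apply]
  by_cases h : d = Finsupp.single i 1
  · subst h; simp
  · rw [if_neg h]
    split_ifs with h0 h1
    · rfl
    · exfalso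
      apply h
      have hle : Finsupp.single i 1 ≤ d := by
        rw [Finsupp.single_le_iff]; omega
      rw [← tsub_add_cancel_of_le hle, h1, zero_add]
    · rfl

theorem epsF_apply (e : Fin n → Module.Dual ℂ g) (d : Fin n →₀ ℕ) :
    epsF e d = ∑ i, if d = Finsupp.single i 1 then e i else 0 := by
  simp only [epsF, Finset.sum_apply, X_smul_cst_apply]

theorem epsF_apply_zero (e : Fin n → Module.Dual ℂ g) : epsF e 0 = 0 := by
  rw [epsF_apply]
  refine Finset.sum_eq_zero fun i _ => ?_
  rw [if_neg]
  intro h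
  have := congrArg (fun q => q i) h
  simp at this

theorem euler_epsF (e : Fin n → Module.Dual ℂ g) : euler (epsF e) = epsF e := by
  funext d
  simp only [euler, epsF_apply, Finset.smul_sum]
  refine Finset.sum_congr rfl fun i _ => ?_
  split_ifs with h
  · simp [h]
  · simp

theorem pderiv_epsF (i : Fin n) (e : Fin n → Module.Dual ℂ g) : pderiv i (epsF e) = cst (e i) := by
  funext d
  simp only [pderiv, epsF_apply, Finset.smul_sum, cst_apply]
  rw [Finset.sum_eq_single i]
  · by_cases h : d = 0
    · simp [h]
    · simp [h]
  · intro j _ hj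
    rw [if_neg, smul_zero]
    intro h
    have := congrArg (fun q => q i) h
    simp [hj] at this
  · simp

/-- Formal functions with values in `g` are separated by functionals. -/
theorem eq_zero_of_pairF {φ : Series n g} (h : ∀ γ : Module.Dual ℂ g, pairF n g (cst γ) φ = 0) :
    φ = 0 := by
  funext d
  rw [Pi.zero_apply, ← Module.forall_dual_apply_eq_zero_iff ℂ]
  intro γ
  rw [← pairF_cst_coeff, h]
  rfl

/-- Tensors are separated by pairs of functionals. -/
theorem eq_zero_of_sharpMap {r : g ⊗[ℂ] g}
    (h : ∀ β γ : Module.Dual ℂ g, γ (sharpMap g r β) = 0) : r = 0 := by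
  let c := Module.Free.chooseBasis ℂ g
  apply (c.tensorProduct c).ext_elem
  rintro ⟨i, j⟩
  have key : ∀ r : g ⊗[ℂ] g, (c.tensorProduct c).repr r (i, j) =
      c.coord j (sharpMap g r (c.coord i)) := by
    intro r
    induction r using TensorProduct.induction_on with
    | zero => simp
    | tmul a b => simp [mul_comm]
    | add r s hr hs => simp only [map_add, LinearMap.add_apply, Finsupp.add_apply, hr, hs]
  rw [key, h]
  simp

end Derivations

/-! ### The radial equation -/

section Radial

set_option linter.unusedSectionVars false

variable {n : ℕ} {g : Type*} [LieRing g] [LieAlgebra ℂ g]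

/-- The transpose on functionals of the projection `y ↦ ∑ e_i(y) x_i`. -/
def projDual (x : Fin n → g) (e : Fin n → Module.Dual ℂ g) :
    Module.Dual ℂ g →ₗ[ℂ] Module.Dual ℂ g :=
  ∑ i, ((LinearMap.id : Module.Dual ℂ g →ₗ[ℂ] (g →ₗ[ℂ] ℂ)).flip (x i)).smulRight (e i)

theorem projDual_apply (x : Fin n → g) (e : Fin n → Module.Dual ℂ g) (β : Module.Dual ℂ g) :
    projDual x e β = ∑ i, β (x i) • e i := by simp [projDual]

theorem projDual_apply_apply (x : Fin n → g) (e : Fin n → Module.Dual ℂ g) (β : Module.Dual ℂ g)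
    (y : g) : projDual x e β y = ∑ i, β (x i) * e i y := by simp [projDual_apply]

theorem projDual_idem {x : Fin n → g} {e : Fin n → Module.Dual ℂ g}
    (hdual : ∀ i j, e i (x j) = if i = j then 1 else 0) (β : Module.Dual ℂ g) :
    projDual x e (projDual x e β) = projDual x e β := by
  rw [projDual_apply, projDual_apply]
  simp [hdual]

theorem pairF_cst_cst (β : Module.Dual ℂ g) (y : g) :
    pairF n g (cst β) (cst y) = Scal.const n (β y) := by
  rw [pairF_cst, cst, mapValues_const]
  rfl

theorem const_smul_cst {V : Type*} [AddCommGroup V] [Module ℂ V] (c : ℂ) (v : V) :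
    Scal.const n c • (cst v : Series n V) = cst (c • v) := by
  refine (bilin_const_left (LinearMap.lsmul ℂ V) c (cst v)).trans ?_
  rw [cst, mapValues_const]
  rfl

theorem cst_add {V : Type*} [AddCommGroup V] [Module ℂ V] (v w : V) :
    (cst (v + w) : Series n V) = cst v + cst w := by
  funext d
  simp only [cst_apply, Pi.add_apply]
  split_ifs <;> simp

theorem cst_sub {V : Type*} [AddCommGroup V] [Module ℂ V] (v w : V) :
    (cst (v - w) : Series n V) = cst v - cst w := by
  funext d
  simp only [cst_apply, Pi.sub_apply]
  split_ifs <;> simp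

theorem cst_sum {V ι : Type*} [AddCommGroup V] [Module ℂ V] (s : Finset ι) (f : ι → V) :
    (cst (∑ i ∈ s, f i) : Series n V) = ∑ i ∈ s, cst (f i) := by
  funext d
  simp only [cst_apply, Finset.sum_apply]
  split_ifs <;> simp

theorem projM_cst (x : Fin n → g) (e : Fin n → Module.Dual ℂ g) (β : Module.Dual ℂ g) :
    projM (pairF n g) (fun i => cst (x i)) (fun i => cst (e i)) (cst β) = cst (projDual x e β) := by
  rw [projM_apply, projDual_apply, cst_sum]
  refine Finset.sum_congr rfl fun i _ => ?_
  rw [pairF_cst_cst, const_smul_cst]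

/-- The radial part of the dynamical Yang-Baxter equation for a skew-symmetric function `r`, where
the constant term is given by the tensor `Ω`. -/
def IsRadial (x : Fin n → g) (e : Fin n → Module.Dual ℂ g) (Ω : g ⊗[ℂ] g)
    (r : Series n (g ⊗[ℂ] g)) : Prop :=
  ∀ β γ : Module.Dual ℂ g,
    Scal.euler (pairF n g (cst γ) (opF r (cst β))) +
      pairF n g (cst γ) (opF r (cst (projDual x e β))) +
      pairF n g (cst (projDual x e γ)) (opF r (cst β)) +
      pairF n g (epsF e) (lieF n g (opF r (cst β)) (opF r (cst γ))) +
      pairF n g (epsF e) (lieF n g (opF (cst Ω) (cst β)) (opF (cst Ω) (cst γ))) = 0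

/-- A coefficient of the bracket depends on coefficients of at most the same degree. -/
theorem bil_coeff_eq_zero {V W Z : Type*} [AddCommGroup V] [Module ℂ V] [AddCommGroup W]
    [Module ℂ W] [AddCommGroup Z] [Module ℂ Z] (B : V →ₗ[ℂ] W →ₗ[ℂ] Z) {φ : Series n V} {k : ℕ}
    (h : ∀ q : Fin n →₀ ℕ, q.degree < k → φ q = 0) (ψ : Series n W) {d : Fin n →₀ ℕ}
    (hd : d.degree < k) : bilin B φ ψ d = 0 := by
  refine Finset.sum_eq_zero fun p hp => ?_
  have := congrArg Finsupp.degree (Finset.HasAntidiagonal.mem_antidiagonal.mp hp)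
  rw [map_add] at this
  rw [h p.1 (by omega), map_zero, LinearMap.zero_apply]

/-- Since `η` starts in degree one, degree `k` of the pairing only meets coefficients of `φ` below
`k`. Hence every term containing `ε` is of lower order in the recursions on the degree. -/
theorem pairF_coeff_eq_zero {η : Series n (Module.Dual ℂ g)} (hη : η 0 = 0) {φ : Series n g} {k : ℕ}
    (h : ∀ q : Fin n →₀ ℕ, q.degree < k → φ q = 0) {d : Fin n →₀ ℕ}
    (hd : d.degree = k) : pairF n g η φ d = 0 := by
  refine Finset.sum_eq_zero fun p hp => ?_
  have := congrArg Finsupp.degree (Finset.HasAntidiagonal.mem_antidiagonal.mp hp)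
  rw [map_add] at this
  by_cases h0 : p.1 = 0
  · rw [h0, hη]; simp
  · have h1 : p.1.degree ≠ 0 := by rwa [Ne, Finsupp.degree_eq_zero_iff]
    rw [h p.2 (by omega), map_zero]

/-- The linearized radial equation has no nonzero solutions which vanish at the origin. -/
theorem eq_zero_of_linear_radial {x : Fin n → g} {e : Fin n → Module.Dual ℂ g}
    (hdual : ∀ i j, e i (x j) = if i = j then 1 else 0) {κ r s : Series n (g ⊗[ℂ] g)} (h0 : κ 0 = 0)
    (h : ∀ β γ : Module.Dual ℂ g,
      Scal.euler (pairF n g (cst γ) (opF κ (cst β))) +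
      pairF n g (cst γ) (opF κ (cst (projDual x e β))) +
      pairF n g (cst (projDual x e γ)) (opF κ (cst β)) +
      pairF n g (epsF e) (lieF n g (opF κ (cst β)) (opF r (cst γ))) +
      pairF n g (epsF e) (lieF n g (opF s (cst β)) (opF κ (cst γ))) = 0) : κ = 0 := by
  have main : ∀ (k : ℕ) (d : Fin n →₀ ℕ), d.degree = k → κ d = 0 := by
    intro k
    induction k using Nat.strong_induction_on with
    | _ k ih =>
    intro d hd
    rcases Nat.eq_zero_or_pos k with rfl | hk
    · rw [Finsupp.degree_eq_zero_iff] at hd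
      rw [hd, h0]
    have hκ : ∀ (β : Module.Dual ℂ g) (q : Fin n →₀ ℕ), q.degree < k → opF κ (cst β) q = 0 := by
      intro β q hq
      rw [opF_cst_right]
      change sharpMap g (κ q) β = 0
      rw [ih _ hq q rfl]
      simp
    set w : Module.Dual ℂ g → Module.Dual ℂ g → ℂ := fun β γ => γ (sharpMap g (κ d) β) with hw
    have hw' : ∀ β γ, pairF n g (cst γ) (opF κ (cst β)) d = w β γ := by
      intro β γ
      rw [pairF_cst_coeff, opF_cst_right]
      rfl
    have hk' : (k : ℂ) ≠ 0 := by exact_mod_cast hk.ne'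
    -- The bracket terms only involve coefficients of `κ` of degree below `k`, which vanish by
    -- induction.
    have heq : ∀ β γ, (k : ℂ) * w β γ + w (projDual x e β) γ + w β (projDual x e γ) = 0 := by
      intro β γ
      have h1 := congrFun (h β γ) d
      have e1 : pairF n g (epsF e) (lieF n g (opF κ (cst β)) (opF r (cst γ))) d = 0 :=
        pairF_coeff_eq_zero (epsF_apply_zero e)
          (fun q hq => bil_coeff_eq_zero (lieMap g) (hκ β) _ hq) hd
      have e2 : pairF n g (epsF e) (lieF n g (opF s (cst β)) (opF κ (cst γ))) d = 0 := by
        rw [lieF_skew, map_neg]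
        exact neg_eq_zero.mpr (pairF_coeff_eq_zero (epsF_apply_zero e)
          (fun q hq => bil_coeff_eq_zero (lieMap g) (hκ γ) _ hq) hd)
      have h2 : (d.degree : ℂ) * w β γ + w (projDual x e β) γ + w β (projDual x e γ) +
          pairF n g (epsF e) (lieF n g (opF κ (cst β)) (opF r (cst γ))) d +
          pairF n g (epsF e) (lieF n g (opF s (cst β)) (opF κ (cst γ))) d = 0 := by
        rw [← hw', ← hw', ← hw']
        exact h1
      rw [e1, e2, hd, add_zero, add_zero] at h2
      exact h2
    apply eq_zero_of_sharpMap
    intro β γ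
    change w β γ = 0
    -- As `projDual` is idempotent, the operator on `w` has eigenvalues among `k`, `k + 1`, `k + 2`.
    -- The components are killed starting from the one with both functionals projected.
    have i1 := heq β γ
    have i2 := heq (projDual x e β) γ
    have i3 := heq β (projDual x e γ)
    have i4 := heq (projDual x e β) (projDual x e γ)
    simp only [projDual_idem hdual] at i2 i3 i4
    have k1 : (k : ℂ) + 1 ≠ 0 := by exact_mod_cast (Nat.succ_ne_zero k)
    have k2 : (k : ℂ) + 2 ≠ 0 := by exact_mod_cast (by omega : k + 2 ≠ 0)
    have j4 : w (projDual x e β) (projDual x e γ) = 0 := by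
      apply mul_left_cancel₀ k2; linear_combination i4
    have j2 : w (projDual x e β) γ = 0 := by
      apply mul_left_cancel₀ k1; linear_combination i2 - j4
    have j3 : w β (projDual x e γ) = 0 := by
      apply mul_left_cancel₀ k1; linear_combination i3 - j4
    apply mul_left_cancel₀ hk'; linear_combination i1 - j2 - j3
  funext d
  exact main _ d rfl

/-- Solutions of the radial equation are determined by their value at the origin. -/
theorem IsRadial.unique {x : Fin n → g} {e : Fin n → Module.Dual ℂ g}
    (hdual : ∀ i j, e i (x j) = if i = j then 1 else 0) {Ω : g ⊗[ℂ] g} {r s : Series n (g ⊗[ℂ] g)}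
    (hr : IsRadial x e Ω r) (hs : IsRadial x e Ω s) (h0 : r 0 = s 0) : r = s := by
  rw [← sub_eq_zero]
  -- For `κ = r - s`, the difference of the quadratic terms is `[κ β, r γ] + [s β, κ γ]`, so the
  -- linearized equation has to allow two different functions.
  apply eq_zero_of_linear_radial (x := x) (e := e) hdual (r := r) (s := s)
  · simp [h0]
  · intro β γ
    have h1 := hr β γ
    have h2 := hs β γ
    have e1 : opF (r - s) = opF r - opF s := by simp [opF]
    simp only [e1, LinearMap.sub_apply, map_sub]
    linear_combination h1 - h2

end Radial

/-! ### Equivariance of solutions of the radial equation -/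

section Equivariance

set_option linter.unusedSectionVars false

variable {n : ℕ} {g : Type*} [LieRing g] [LieAlgebra ℂ g]

theorem smulSeries_zero {V : Type*} [AddCommGroup V] [Module ℂ V] (a : Scal n) (φ : Series n V) :
    (a • φ) 0 = a 0 • φ 0 := by
  rw [smulSeries_def]
  simp [bilin]

/-- The action of `y` on functions with values in `g ⊗ g`. -/
def equivDefect (x : Fin n → g) (e : Fin n → Module.Dual ℂ g) (y : g)
    (r : Series n (g ⊗[ℂ] g)) : Series n (g ⊗[ℂ] g) :=
  mapValues (LieModule.toEnd ℂ g (g ⊗[ℂ] g) y) r +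
    ∑ i, pairF n g (epsF e) (lieF n g (cst y) (cst (x i))) • pderiv i r

theorem opF_toEnd (y : g) (r : Series n (g ⊗[ℂ] g)) (α : Series n (Module.Dual ℂ g)) :
    opF (mapValues (LieModule.toEnd ℂ g (g ⊗[ℂ] g) y) r) α =
      lieF n g (cst y) (opF r α) - opF r (coF n g (cst y) α) := by
  have h1 : coF n g (cst y) α = -mapValues (compAd g y) α := by
    rw [← bilin_const_left]; rfl
  rw [h1, lieF_cst_left, map_neg, sub_neg_eq_add]
  change bilin (sharpMap g) _ α = mapValues (lieMap g y) (bilin (sharpMap g) r α) +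
    bilin (sharpMap g) r (mapValues (compAd g y) α)
  rw [bilin_mapValues_left, mapValues_bilin, bilin_mapValues_right, ← bilin_add_map]
  congr 1
  apply TensorProduct.ext'
  intro a c
  ext α
  simp
  abel

theorem opF_equivDefect (x : Fin n → g) (e : Fin n → Module.Dual ℂ g) (y : g)
    (r : Series n (g ⊗[ℂ] g)) (α : Series n (Module.Dual ℂ g)) :
    opF (equivDefect x e y r) α = lieF n g (cst y) (opF r α) - opF r (coF n g (cst y) α) +
      ∑ i, pairF n g (epsF e) (lieF n g (cst y) (cst (x i))) • opF (pderiv i r) α := by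
  rw [equivDefect, opF_add, LinearMap.add_apply, opF_toEnd]
  simp [opF]

theorem coF_cst (y : g) (α : Module.Dual ℂ g) :
    coF n g (cst y) (cst α) = cst (-compAd g y α) := by
  have : coF n g (cst y) (cst α) = -mapValues (compAd g y) (cst α) := by
    rw [← bilin_const_left]; rfl
  rw [this, cst, mapValues_const]
  funext d
  simp only [Pi.neg_apply, const, cst]
  split_ifs <;> simp

variable {x : Fin n → g} {e : Fin n → Module.Dual ℂ g}

/-- The span of the `x i` is invariant by `hsub`, and the kernel of the projection is invariant by
`hproj`, so the projection commutes with `ad (x j)`. -/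
theorem projDual_compAd (hproj : ∀ k j y, e k ⁅x j, y⁆ = ∑ i, e i y * e k ⁅x j, x i⁆)
    (hsub : ∀ j i, ∑ k, e k ⁅x j, x i⁆ • x k = ⁅x j, x i⁆) (j : Fin n) (β : Module.Dual ℂ g) :
    compAd g (x j) (projDual x e β) = projDual x e (compAd g (x j) β) := by
  ext y
  simp only [compAd_apply, projDual_apply_apply]
  simp only [hproj _ j y, Finset.mul_sum]
  rw [Finset.sum_comm]
  refine Finset.sum_congr rfl fun i _ => ?_
  conv_rhs => rw [← hsub]
  rw [map_sum, Finset.sum_mul]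
  refine Finset.sum_congr rfl fun k _ => ?_
  rw [map_smul, smul_eq_mul]
  ring

/-- The derivation of scalar series by which `y` acts. -/
def coadjDer (x : Fin n → g) (e : Fin n → Module.Dual ℂ g) (y : g) (a : Scal n) : Scal n :=
  ∑ i, pairF n g (epsF e) (lieF n g (cst y) (cst (x i))) * Scal.pderiv i a

/-- The derivation of vector-valued series by which `y` acts. -/
def coadjDerV {V : Type*} [AddCommGroup V] [Module ℂ V] (x : Fin n → g)
    (e : Fin n → Module.Dual ℂ g) (y : g) (φ : Series n V) : Series n V :=
  ∑ i, pairF n g (epsF e) (lieF n g (cst y) (cst (x i))) • pderiv i φ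

theorem coadjDer_add (y : g) (a b : Scal n) :
    coadjDer x e y (a + b) = coadjDer x e y a + coadjDer x e y b := by
  simp [coadjDer, mul_add, Finset.sum_add_distrib]

theorem coadjDer_pairF (y : g) (α : Series n (Module.Dual ℂ g)) (z : Series n g) :
    coadjDer x e y (pairF n g α z) =
      pairF n g (coadjDerV x e y α) z + pairF n g α (coadjDerV x e y z) := by
  simp [coadjDer, coadjDerV, Scal.pderiv_pairF, mul_add, Finset.sum_add_distrib]

theorem coadjDerV_cst {V : Type*} [AddCommGroup V] [Module ℂ V] (y : g) (v : V) :
    coadjDerV x e y (cst v : Series n V) = 0 := by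
  simp [coadjDerV, pderiv_cst]

theorem coadjDerV_lieF (y : g) (z w : Series n g) :
    coadjDerV x e y (lieF n g z w) =
      lieF n g (coadjDerV x e y z) w + lieF n g z (coadjDerV x e y w) := by
  simp [coadjDerV, pderiv_lieF, smul_add, Finset.sum_add_distrib]

theorem euler_pairF_epsF_cst (y : g) :
    Scal.euler (pairF n g (epsF e) (cst y)) = pairF n g (epsF e) (cst y) := by
  rw [Scal.euler_pairF, euler_epsF, euler_cst, map_zero, add_zero]

theorem lieF_cst_cst (y z : g) : lieF n g (cst y) (cst z) = cst ⁅y, z⁆ := by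
  rw [lieF_cst_left, cst, mapValues_const]
  rfl

/-- The coefficients of this vector field are linear, so it preserves degrees: the factor of degree
one makes up for the degree lost by the partial derivative. -/
theorem coadjDer_euler (y : g) (a : Scal n) :
    coadjDer x e y (Scal.euler a) = Scal.euler (coadjDer x e y a) := by
  simp only [coadjDer, map_sum, Scal.euler_mul, lieF_cst_cst, euler_pairF_epsF_cst,
    Scal.pderiv_euler]
  refine Finset.sum_congr rfl fun i _ => ?_
  ring

/-- Solutions of the radial equation with invariant value at the origin are equivariant. -/
theorem IsRadial.equivDefect_eq_zero {Ω : g ⊗[ℂ] g} (hsym : flip Ω = Ω)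
    (hinv : ∀ y : g, ⁅y, Ω⁆ = 0) (hdual : ∀ i j, e i (x j) = if i = j then 1 else 0)
    (hproj : ∀ k j y, e k ⁅x j, y⁆ = ∑ i, e i y * e k ⁅x j, x i⁆)
    (hsub : ∀ j i, ∑ k, e k ⁅x j, x i⁆ • x k = ⁅x j, x i⁆)
    {r : Series n (g ⊗[ℂ] g)} (hr : IsRadial x e Ω r) (j : Fin n) (h0 : ⁅x j, r 0⁆ = 0) :
    equivDefect x e (x j) r = 0 := by
  have F := frame hsym hinv hdual hproj
  apply eq_zero_of_linear_radial (x := x) (e := e) hdual (r := r) (s := r)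
  -- At the origin the vector field vanishes, and only the action on the value of `r` remains.
  · have hz : ∀ y, pairF n g (epsF e) (cst y) 0 = 0 := fun y =>
      pairF_coeff_eq_zero (k := 0) (epsF_apply_zero e) (fun q hq => absurd hq (by omega))
        (map_zero _)
    simp only [equivDefect, Pi.add_apply, Finset.sum_apply, smulSeries_zero, lieF_cst_cst, hz,
      zero_smul, Finset.sum_const_zero, add_zero]
    exact h0
  intro β γ
  set y := x j with hy
  have hK : ∀ β : Module.Dual ℂ g, coadjDerV x e y (opF r (cst β)) =
      opF (equivDefect x e y r) (cst β) - lieF n g (cst y) (opF r (cst β)) +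
        opF r (cst (-compAd g y β)) := by
    intro β
    rw [opF_equivDefect, coF_cst]
    simp only [coadjDerV, pderiv_opF_cst]
    abel
  have hpair : ∀ (γ : Module.Dual ℂ g) (z : Series n g),
      pairF n g (cst γ) (lieF n g (cst y) z) = -pairF n g (cst (-compAd g y γ)) z := by
    intro γ z
    rw [← coF_cst, pairF_coF, neg_neg]
  have hN : ∀ β : Module.Dual ℂ g,
      projDual x e (-compAd g y β) = -compAd g y (projDual x e β) := by
    intro β
    rw [map_neg, projDual_compAd hproj hsub]
  -- The function `ε` is itself equivariant; by the frame axiom `proj` this holds on all of `g`.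
  have heps : ∀ z : Series n g, pairF n g (coadjDerV x e y (epsF e)) z =
      pairF n g (epsF e) (lieF n g (cst y) z) := by
    intro z
    rw [hy, F.proj]
    simp [coadjDerV, pderiv_epsF, mul_comm]
  have hSy : ∀ β : Module.Dual ℂ g, lieF n g (cst y) (opF (cst Ω) (cst β)) =
      opF (cst Ω) (cst (-compAd g y β)) := by
    intro β
    rw [← coF_cst, F.inv]
  have hS0 : ∀ β : Module.Dual ℂ g, coadjDerV x e y (opF (cst Ω) (cst β)) = 0 := by
    intro β
    rw [opF_cst_left, cst, mapValues_const]
    exact coadjDerV_cst y _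
  -- The radial equation is differentiated along the vector field of `y`. Subtracting its instances
  -- with `y` acting on `β` and on `γ` leaves exactly the terms linear in the defect.
  have main := congrArg (coadjDer x e y) (hr β γ)
  have z0 : coadjDer x e y (0 : Scal n) = 0 := by simp [coadjDer]
  have h1 := hr (-compAd g y β) γ
  have h2 := hr β (-compAd g y γ)
  rw [hN] at h1 h2
  simp only [coadjDer_add, coadjDer_euler, coadjDer_pairF, coadjDerV_cst, map_zero,
    LinearMap.zero_apply, zero_add, hK, coadjDerV_lieF, hS0, heps, z0, map_add, map_sub, hpair,
    lieF_jacobi (cst y), hSy, LinearMap.add_apply, LinearMap.sub_apply, add_zero] at main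
  rw [map_neg Scal.euler] at main
  linear_combination main - h1 - h2

end Equivariance

/-! ### Flatness of solutions of the radial equation -/

section CurvForm

set_option linter.unusedSectionVars false

variable {A G M ι : Type*} [CommRing A] [AddCommGroup G] [Module A G] [AddCommGroup M] [Module A M]
  [Fintype ι] [DecidableEq ι]
  {p : M →ₗ[A] G →ₗ[A] A} {br : G →ₗ[A] G →ₗ[A] G} {co : G →ₗ[A] M →ₗ[A] M}
  {S : M →ₗ[A] G} {x : ι → G} {e : ι → M} {eps : M} {R : M →ₗ[A] G} {D : ι → M →ₗ[A] G}

theorem Frame.curvForm_cycle (h : Frame p br co S x e eps) (α β γ : M) :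
    curvForm p br S x R D α β γ = curvForm p br S x R D β γ α := by
  have h1 : ∑ i, (p α (x i) * p γ (D i β) + p β (x i) * p α (D i γ) + p γ (x i) * p β (D i α)) =
      ∑ i, (p β (x i) * p α (D i γ) + p γ (x i) * p β (D i α) + p α (x i) * p γ (D i β)) :=
    Finset.sum_congr rfl fun i _ => by ring
  rw [curvForm, curvForm, h.cubic_cycle, h1]
  ring

/-- The contraction of the curvature with two functionals. -/
def curvVec (br : G →ₗ[A] G →ₗ[A] G) (p : M →ₗ[A] G →ₗ[A] A) (co : G →ₗ[A] M →ₗ[A] M)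
    (S : M →ₗ[A] G) (x : ι → G) (R : M →ₗ[A] G) (D : ι → M →ₗ[A] G) (β γ : M) : G :=
  ∑ i, (p γ (D i β) • x i + p β (x i) • D i γ - p γ (x i) • D i β) + br (R β) (R γ) +
    R (co (R γ) β) - R (co (R β) γ) + br (S β) (S γ)

/-- Skew-symmetry of `R` and of the `D i` makes `α` the outer functional in every term. Thus
curvature that vanishes on constant functionals also vanishes when `α` is a series such as `ε`. -/
theorem Frame.pair_curvVec (h : Frame p br co S x e eps)
    (hR : ∀ α β, p β (R α) = -p α (R β)) (hD : ∀ i α β, p β (D i α) = -p α (D i β)) (α β γ : M) :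
    p α (curvVec br p co S x R D β γ) = curvForm p br S x R D α β γ := by
  simp only [curvVec, curvForm, map_add, map_sub, map_sum, map_smul, smul_eq_mul]
  rw [hR _ α, hR _ α, h.co_apply, h.co_apply, h.skew (R β) (R α), map_neg]
  have : ∑ i, (p γ (D i β) * p α (x i) + p β (x i) * p α (D i γ) - p γ (x i) * p α (D i β)) =
      ∑ i, (p α (x i) * p γ (D i β) + p β (x i) * p α (D i γ) + p γ (x i) * p β (D i α)) :=
    Finset.sum_congr rfl fun i _ => by rw [hD i α β]; ring
  rw [this]
  ring

theorem curvForm_sub (α α' β γ : M) : curvForm p br S x R D (α - α') β γ =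
    curvForm p br S x R D α β γ - curvForm p br S x R D α' β γ := by
  have h1 : ∑ i, (p (α - α') (x i) * p γ (D i β) + p β (x i) * p (α - α') (D i γ) +
      p γ (x i) * p β (D i (α - α'))) =
      ∑ i, (p α (x i) * p γ (D i β) + p β (x i) * p α (D i γ) + p γ (x i) * p β (D i α)) -
      ∑ i, (p α' (x i) * p γ (D i β) + p β (x i) * p α' (D i γ) + p γ (x i) * p β (D i α')) := by
    rw [← Finset.sum_sub_distrib]
    refine Finset.sum_congr rfl fun i _ => ?_
    simp only [map_sub, LinearMap.sub_apply]
    ring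
  rw [curvForm, curvForm, curvForm, h1]
  simp only [map_sub, LinearMap.sub_apply]
  ring

end CurvForm

section Flat

set_option linter.unusedSectionVars false

variable {n : ℕ} {g : Type*} [LieRing g] [LieAlgebra ℂ g]

/-- The curvature form of a formal function with values in `g ⊗ g`. -/
def curvF (x : Fin n → g) (Ω : g ⊗[ℂ] g) (r : Series n (g ⊗[ℂ] g))
    (α β γ : Series n (Module.Dual ℂ g)) : Scal n :=
  curvForm (pairF n g) (lieF n g) (opF (cst Ω)) (fun i => cst (x i)) (opF r)
    (fun i => opF (pderiv i r)) α β γ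

theorem flip_pderiv {r : Series n (g ⊗[ℂ] g)} (hskew : ∀ d, flip (r d) = -r d) (i : Fin n)
    (d : Fin n →₀ ℕ) : flip (pderiv i r d) = -pderiv i r d := by
  have := hskew (d + Finsupp.single i 1)
  simp only [flip, pderiv, map_smul] at this ⊢
  rw [this, smul_neg]

variable {x : Fin n → g} {e : Fin n → Module.Dual ℂ g} {Ω : g ⊗[ℂ] g} {r : Series n (g ⊗[ℂ] g)}

/-- The radial equation with `γ` stripped off: skew-symmetry of `r` and cyclicity of the cubic form
make every term a pairing with `γ`. This is the form used by `bianchi`. -/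
theorem IsRadial.vector_eq (hsym : flip Ω = Ω) (hinv : ∀ y : g, ⁅y, Ω⁆ = 0)
    (hdual : ∀ i j, e i (x j) = if i = j then 1 else 0)
    (hproj : ∀ k j y, e k ⁅x j, y⁆ = ∑ i, e i y * e k ⁅x j, x i⁆)
    (hskew : ∀ d, flip (r d) = -r d) (hr : IsRadial x e Ω r) (β : Module.Dual ℂ g) :
    euler (opF r (cst β)) + opF r (cst (projDual x e β)) +
      projG (pairF n g) (fun i => cst (x i)) (fun i => cst (e i)) (opF r (cst β)) +
      opF r (coF n g (opF r (cst β)) (epsF e)) -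
      lieF n g (opF (cst Ω) (cst β)) (opF (cst Ω) (epsF e)) = 0 := by
  have F := frame hsym hinv hdual hproj
  apply eq_zero_of_pairF
  intro γ
  have h := hr β γ
  rw [map_sub, map_add, map_add, map_add, Frame.pair_projG, ← Frame.pair_projM, projM_cst,
    pairF_opF_skew hskew (coF n g (opF r (cst β)) (epsF e)) (cst γ), F.co_apply, F.cubic_cycle, F.cubic_cycle, F.skew (opF (cst Ω) (cst γ)), map_neg,
    ← Scal.euler_pairF_cst]
  linear_combination h

/-- This is `bianchi` with Euler derivatives for the radial ones; the first group of terms there is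
then the Euler derivative of the curvature, the constant pairings and the `Ω` terms contributing
nothing. -/
theorem IsRadial.curvature_eq (hsym : flip Ω = Ω) (hinv : ∀ y : g, ⁅y, Ω⁆ = 0)
    (hdual : ∀ i j, e i (x j) = if i = j then 1 else 0)
    (hproj : ∀ k j y, e k ⁅x j, y⁆ = ∑ i, e i y * e k ⁅x j, x i⁆)
    (hskew : ∀ d, flip (r d) = -r d) (hr : IsRadial x e Ω r)
    (heq : ∀ j, equivDefect x e (x j) r = 0) (α β γ : Module.Dual ℂ g) :
    Scal.euler (curvF x Ω r (cst α) (cst β) (cst γ)) +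
      curvF x Ω r (cst (projDual x e α)) (cst β) (cst γ) +
      curvF x Ω r (cst α) (cst (projDual x e β)) (cst γ) +
      curvF x Ω r (cst α) (cst β) (cst (projDual x e γ)) +
      curvF x Ω r (coF n g (opF r (cst α)) (epsF e)) (cst β) (cst γ) +
      curvF x Ω r (cst α) (coF n g (opF r (cst β)) (epsF e)) (cst γ) +
      curvF x Ω r (cst α) (cst β) (coF n g (opF r (cst γ)) (epsF e)) = 0 := by
  have F := frame hsym hinv hdual hproj
  have hZ : ∀ β : Module.Dual ℂ g, euler (opF r (cst β)) +
      opF r (projM (pairF n g) (fun i => cst (x i)) (fun i => cst (e i)) (cst β)) +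
      projG (pairF n g) (fun i => cst (x i)) (fun i => cst (e i)) (opF r (cst β)) +
      opF r (coF n g (opF r (cst β)) (epsF e)) -
      lieF n g (opF (cst Ω) (cst β)) (opF (cst Ω) (epsF e)) = 0 := by
    intro β
    rw [projM_cst]
    exact hr.vector_eq hsym hinv hdual hproj hskew β
  have hS0 : ∀ (i : Fin n) (β : Module.Dual ℂ g), pderiv i (opF (cst Ω) (cst β)) = 0 := by
    intro i β
    rw [opF_cst_left, cst, mapValues_const]
    exact pderiv_cst i _
  have hSe : ∀ (β : Module.Dual ℂ g), euler (opF (cst Ω : Series n _) (cst β)) = 0 := by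
    intro β
    rw [opF_cst_left, cst, mapValues_const]
    exact euler_cst _
  have hX : ∀ (β γ : Module.Dual ℂ g) (i : Fin n),
      Scal.euler (pairF n g (cst γ) (opF (pderiv i r) (cst β))) +
      pairF n g (cst γ) (opF (pderiv i r) (cst β)) +
      pairF n g (cst γ) (opF (pderiv i r)
        (projM (pairF n g) (fun i => cst (x i)) (fun i => cst (e i)) (cst β))) +
      pairF n g (projM (pairF n g) (fun i => cst (x i)) (fun i => cst (e i)) (cst γ))
        (opF (pderiv i r) (cst β)) +
      pairF n g (cst (e i)) (lieF n g (opF r (cst β)) (opF r (cst γ))) +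
      pairF n g (epsF e) (lieF n g (opF (pderiv i r) (cst β)) (opF r (cst γ))) +
      pairF n g (epsF e) (lieF n g (opF r (cst β)) (opF (pderiv i r) (cst γ))) +
      pairF n g (cst (e i)) (lieF n g (opF (cst Ω) (cst β)) (opF (cst Ω) (cst γ))) = 0 := by
    intro β γ i
    -- The second summand of the claim comes from commuting the partial derivative with the Euler
    -- operator, and the terms with `e i` come from differentiating `ε`.
    have h1 := congrArg (Scal.pderiv i) (hr β γ)
    simp only [map_add, Scal.pderiv_euler, Scal.pderiv_pairF, pderiv_cst, pderiv_epsF, pderiv_lieF,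
      pderiv_opF_cst, map_zero, LinearMap.zero_apply, zero_add, hS0, add_zero] at h1
    rw [projM_cst, projM_cst]
    linear_combination h1
  have heq' : ∀ j (α : Series n (Module.Dual ℂ g)),
      lieF n g (cst (x j)) (opF r α) - opF r (coF n g (cst (x j)) α) +
      ∑ i, pairF n g (epsF e) (lieF n g (cst (x j)) (cst (x i))) • opF (pderiv i r) α = 0 := by
    intro j α
    rw [← opF_equivDefect, heq j]
    simp [opF]
  have main := bianchi F (R := opF r) (D := fun i => opF (pderiv i r))
    (fun α β => pairF_opF_skew hskew α β)
    (fun i α β => pairF_opF_skew (flip_pderiv hskew i) α β) heq'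
    (hZ α) (hZ β) (hZ γ) (hX β γ) (hX γ α) (hX α β)
  rw [projM_cst, projM_cst, projM_cst] at main
  rw [← main]
  have hE : Scal.euler (curvF x Ω r (cst α) (cst β) (cst γ)) =
      ∑ i, (pairF n g (cst α) (cst (x i)) *
          Scal.euler (pairF n g (cst γ) (opF (pderiv i r) (cst β))) +
        pairF n g (cst β) (cst (x i)) *
          Scal.euler (pairF n g (cst α) (opF (pderiv i r) (cst γ))) +
        pairF n g (cst γ) (cst (x i)) *
          Scal.euler (pairF n g (cst β) (opF (pderiv i r) (cst α)))) +
      pairF n g (cst α) (lieF n g (euler (opF r (cst β))) (opF r (cst γ))) +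
      pairF n g (cst α) (lieF n g (opF r (cst β)) (euler (opF r (cst γ)))) +
      pairF n g (cst β) (lieF n g (euler (opF r (cst γ))) (opF r (cst α))) +
      pairF n g (cst β) (lieF n g (opF r (cst γ)) (euler (opF r (cst α)))) +
      pairF n g (cst γ) (lieF n g (euler (opF r (cst α))) (opF r (cst β))) +
      pairF n g (cst γ) (lieF n g (opF r (cst α)) (euler (opF r (cst β)))) := by
    have hc : ∀ (α : Module.Dual ℂ g) i, Scal.euler (pairF n g (cst α) (cst (x i))) = 0 := by
      intro α i
      rw [Scal.euler_pairF_cst, euler_cst, map_zero]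
    simp only [curvF, curvForm, map_add, map_sum, Scal.euler_mul, hc, zero_mul, zero_add]
    rw [Scal.euler_pairF_cst _ (lieF n g (opF r _) _), Scal.euler_pairF_cst _ (lieF n g (opF r _) _),
      Scal.euler_pairF_cst _ (lieF n g (opF r _) _),
      Scal.euler_pairF_cst _ (lieF n g (opF (cst Ω) _) _)]
    simp only [euler_lieF, hSe, map_zero, LinearMap.zero_apply, add_zero, map_add]
    ring
  rw [hE]
  rfl

/-- A skew-symmetric equivariant solution of the radial equation whose curvature at the origin
vanishes in the quotient by the span of the `x i` has zero curvature. -/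
theorem IsRadial.curvF_eq_zero (hsym : flip Ω = Ω) (hinv : ∀ y : g, ⁅y, Ω⁆ = 0)
    (hdual : ∀ i j, e i (x j) = if i = j then 1 else 0)
    (hproj : ∀ k j y, e k ⁅x j, y⁆ = ∑ i, e i y * e k ⁅x j, x i⁆)
    (hskew : ∀ d, flip (r d) = -r d) (hr : IsRadial x e Ω r)
    (heq : ∀ j, equivDefect x e (x j) r = 0)
    (h0 : ∀ α β γ : Module.Dual ℂ g, (∀ i, α (x i) = 0) → (∀ i, β (x i) = 0) →
      (∀ i, γ (x i) = 0) → curvF x Ω r (cst α) (cst β) (cst γ) 0 = 0) (α β γ : Module.Dual ℂ g) :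
    curvF x Ω r (cst α) (cst β) (cst γ) = 0 := by
  have F := frame hsym hinv hdual hproj
  have cyc : ∀ α β γ, curvF x Ω r α β γ = curvF x Ω r β γ α := fun α β γ => F.curvForm_cycle α β γ
  have main : ∀ (k : ℕ) (d : Fin n →₀ ℕ), d.degree = k →
      ∀ α β γ : Module.Dual ℂ g, curvF x Ω r (cst α) (cst β) (cst γ) d = 0 := by
    intro k
    induction k using Nat.strong_induction_on with
    | _ k ih =>
    intro d hd
    -- By induction the contracted curvature vanishes below degree `k`, so pairing it with a
    -- functional that vanishes at the origin gives nothing in degree `k`.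
    have hV : ∀ (η : Series n (Module.Dual ℂ g)) (β γ : Module.Dual ℂ g), η 0 = 0 →
        curvF x Ω r η (cst β) (cst γ) d = 0 := by
      intro η β γ hη
      have hp : ∀ α, pairF n g α (curvVec (lieF n g) (pairF n g) (coF n g) (opF (cst Ω))
          (fun i => cst (x i)) (opF r) (fun i => opF (pderiv i r)) (cst β) (cst γ)) =
          curvF x Ω r α (cst β) (cst γ) :=
        fun α => F.pair_curvVec (fun α β => pairF_opF_skew hskew α β)
          (fun i α β => pairF_opF_skew (flip_pderiv hskew i) α β) _ _ _
      rw [← hp]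
      apply pairF_coeff_eq_zero hη _ hd
      intro q hq
      rw [← Module.forall_dual_apply_eq_zero_iff ℂ]
      intro α
      rw [← pairF_cst_coeff, hp, ih _ hq q rfl]
    have hco : ∀ α : Module.Dual ℂ g, coF n g (opF r (cst α)) (epsF e) 0 = 0 := by
      intro α
      have : coF n g (opF r (cst α)) (epsF e) 0 = -(bilin (compAd g) (opF r (cst α)) (epsF e) 0) :=
        rfl
      rw [this]
      simp [bilin, epsF_apply_zero]
    set w : Module.Dual ℂ g → Module.Dual ℂ g → Module.Dual ℂ g → ℂ :=
      fun α β γ => curvF x Ω r (cst α) (cst β) (cst γ) d with hw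
    set N := projDual x e with hN
    have hNN : ∀ α, N (N α) = N α := projDual_idem hdual
    have wcyc : ∀ α β γ, w α β γ = w β γ α := fun α β γ => congrFun (cyc _ _ _) d
    have wsub : ∀ α α' β γ, w (α - α') β γ = w α β γ - w α' β γ := by
      intro α α' β γ
      simp only [hw, cst_sub]
      have := curvForm_sub (p := pairF n g) (br := lieF n g) (S := opF (cst Ω))
        (x := fun i => cst (x i)) (R := opF r) (D := fun i => opF (pderiv i r))
        (cst α) (cst α') (cst β) (cst γ)
      exact congrFun this d
    have weq : ∀ α β γ, (k : ℂ) * w α β γ + w (N α) β γ + w α (N β) γ + w α β (N γ) = 0 := by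
      intro α β γ
      have h1 := congrFun (hr.curvature_eq hsym hinv hdual hproj hskew heq α β γ) d
      have h2 : (d.degree : ℂ) * w α β γ + w (N α) β γ + w α (N β) γ + w α β (N γ) +
          curvF x Ω r (coF n g (opF r (cst α)) (epsF e)) (cst β) (cst γ) d +
          curvF x Ω r (cst α) (coF n g (opF r (cst β)) (epsF e)) (cst γ) d +
          curvF x Ω r (cst α) (cst β) (coF n g (opF r (cst γ)) (epsF e)) d = 0 := h1
      rw [hV _ _ _ (hco α), cyc (cst α), hV _ _ _ (hco β), cyc (cst α), cyc (cst β),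
        hV _ _ _ (hco γ), hd] at h2
      linear_combination h2
    have k1 : (k : ℂ) + 1 ≠ 0 := by exact_mod_cast (Nat.succ_ne_zero k)
    have k2 : (k : ℂ) + 2 ≠ 0 := by exact_mod_cast (by omega : k + 2 ≠ 0)
    have k3 : (k : ℂ) + 3 ≠ 0 := by exact_mod_cast (by omega : k + 3 ≠ 0)
    -- Components with three, two and one legs in the span of the `x i` have weights `k + 3`, `k +
    -- 2`, `k + 1`, nonzero even for `k = 0`.
    have w3 : ∀ α β γ, w (N α) (N β) (N γ) = 0 := by
      intro α β γ
      have := weq (N α) (N β) (N γ)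
      rw [hNN, hNN, hNN] at this
      apply mul_left_cancel₀ k3; linear_combination this
    have w2 : ∀ α β γ, w (N α) (N β) γ = 0 := by
      intro α β γ
      have := weq (N α) (N β) γ
      rw [hNN, hNN, w3] at this
      apply mul_left_cancel₀ k2; linear_combination this
    have w1 : ∀ α β γ, w (N α) β γ = 0 := by
      intro α β γ
      have := weq (N α) β γ
      rw [hNN, w2, wcyc (N α) β (N γ), wcyc β, w2] at this
      apply mul_left_cancel₀ k1; linear_combination this
    -- The remaining component has weight `k`; only for `k = 0` is the hypothesis on the origin
    -- needed.
    rcases Nat.eq_zero_or_pos k with hk | hk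
    · rw [hk, Finsupp.degree_eq_zero_iff] at hd
      have hm : ∀ (α : Module.Dual ℂ g) i, (α - N α) (x i) = 0 := by
        intro α i
        simp [hN, projDual_apply_apply, hdual]
      intro α β γ
      have h1 : w (α - N α) (β - N β) (γ - N γ) = 0 := by
        have := h0 _ _ _ (hm α) (hm β) (hm γ)
        rw [← hd] at this
        exact this
      rw [wsub, w1, sub_zero, wcyc, wsub, w1, sub_zero, wcyc, wsub, w1, sub_zero, wcyc] at h1
      exact h1
    · intro α β γ
      have hk' : (k : ℂ) ≠ 0 := by exact_mod_cast hk.ne'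
      have := weq α β γ
      rw [w1, wcyc α (N β), w1, wcyc α β (N γ), wcyc β (N γ), w1] at this
      apply mul_left_cancel₀ hk'; linear_combination this
  funext d
  exact main _ d rfl α β γ

end Flat

/-! ### The classical dynamical Yang-Baxter equation in terms of functionals -/

section Pairing

set_option linter.unusedSectionVars false

variable {n : ℕ} {g : Type*} [LieRing g] [LieAlgebra ℂ g]

/-- The functional `α ⊗ β ⊗ γ`. -/
def triple (α β γ : Module.Dual ℂ g) : g ⊗[ℂ] (g ⊗[ℂ] g) →ₗ[ℂ] ℂ :=
  TensorProduct.lift (LinearMap.mk₂ ℂ (fun a s => α a * γ (sharpMap g s β))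
    (by intros; simp [add_mul]) (by intros; simp [mul_assoc])
    (by intros; simp [mul_add]) (by intros; simp [mul_left_comm]))

theorem triple_tmul (α β γ : Module.Dual ℂ g) (a : g) (s : g ⊗[ℂ] g) :
    triple α β γ (a ⊗ₜ s) = α a * γ (sharpMap g s β) := rfl

theorem triple_tmul_tmul (α β γ : Module.Dual ℂ g) (a c d : g) :
    triple α β γ (a ⊗ₜ (c ⊗ₜ d)) = α a * (β c * γ d) := by simp [triple_tmul]

/-- Triple tensors are separated by triples of functionals. -/
theorem eq_zero_of_triple {w : g ⊗[ℂ] (g ⊗[ℂ] g)}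
    (h : ∀ α β γ : Module.Dual ℂ g, triple α β γ w = 0) : w = 0 := by
  let c := Module.Free.chooseBasis ℂ g
  apply (c.tensorProduct (c.tensorProduct c)).ext_elem
  rintro ⟨i, j, k⟩
  have key : ∀ w : g ⊗[ℂ] (g ⊗[ℂ] g), (c.tensorProduct (c.tensorProduct c)).repr w (i, j, k) =
      triple (c.coord i) (c.coord j) (c.coord k) w := by
    intro w
    induction w using TensorProduct.induction_on with
    | zero => simp
    | tmul a s =>
      induction s using TensorProduct.induction_on with
      | zero => simp
      | tmul b d => simp [triple_tmul_tmul]; ring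
      | add r s hr hs => simp only [TensorProduct.tmul_add, map_add, Finsupp.add_apply, hr, hs]
    | add r s hr hs => simp only [map_add, Finsupp.add_apply, hr, hs]
  rw [key, h]
  simp

theorem triple_alt (α β γ : Module.Dual ℂ g) (y : g) (s : g ⊗[ℂ] g) :
    triple α β γ (alt g (y ⊗ₜ s)) =
      α y * γ (sharpMap g s β) - β y * γ (sharpMap g s α) + γ y * β (sharpMap g s α) := by
  induction s using TensorProduct.induction_on with
  | zero => simp
  | tmul a c => simp [alt, triple_tmul_tmul]; ring
  | add r s hr hs =>
    simp only [TensorProduct.tmul_add, map_add, LinearMap.add_apply, hr, hs]; ring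

/-- The operator of the flipped tensor, as a bilinear map. -/
def sharpFlip (g : Type*) [LieRing g] [LieAlgebra ℂ g] :
    g ⊗[ℂ] g →ₗ[ℂ] Module.Dual ℂ g →ₗ[ℂ] g :=
  sharpMap g ∘ₗ (TensorProduct.comm ℂ g g).toLinearMap

/-- In each of the three brackets one leg of each tensor is paired with a functional: `sharpMap`
appears when it is the first leg, `sharpFlip` when it is the second. -/
theorem cybBilin_compr (α β γ : Module.Dual ℂ g) :
    (cybBilin g).compr₂ (triple α β γ) =
      ((lieMap g).compl₁₂ ((sharpFlip g).flip β) ((sharpFlip g).flip γ)).compr₂ α +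
      ((lieMap g).compl₁₂ ((sharpMap g).flip α) ((sharpFlip g).flip γ)).compr₂ β +
      ((lieMap g).compl₁₂ ((sharpMap g).flip α) ((sharpMap g).flip β)).compr₂ γ := by
  apply TensorProduct.ext'
  intro a c
  apply TensorProduct.ext'
  intro a' c'
  simp [cybBilin, triple_tmul_tmul, sharpFlip]
  ring

theorem triple_bilin_cyb (α β γ : Module.Dual ℂ g) (r : Series n (g ⊗[ℂ] g)) (d : Fin n →₀ ℕ) :
    triple α β γ (bilin (cybBilin g) r r d) =
      (pairF n g (cst α) (lieF n g (opF (fun d => flip (r d)) (cst β))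
          (opF (fun d => flip (r d)) (cst γ))) +
        pairF n g (cst β) (lieF n g (opF r (cst α)) (opF (fun d => flip (r d)) (cst γ))) +
        pairF n g (cst γ) (lieF n g (opF r (cst α)) (opF r (cst β)))) d := by
  have h1 : ∀ β, opF (fun d => flip (r d)) (cst β) = mapValues ((sharpFlip g).flip β) r :=
    fun β => opF_cst_right _ _
  rw [h1, h1, opF_cst_right, opF_cst_right, pairF_cst, pairF_cst, pairF_cst]
  have h2 := congrFun (mapValues_bilin (triple α β γ) (cybBilin g) r r) d
  rw [cybBilin_compr, bilin_add_map, bilin_add_map] at h2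
  refine h2.trans ?_
  have h3 : ∀ (A B : g ⊗[ℂ] g →ₗ[ℂ] g) (α : Module.Dual ℂ g),
      bilin (((lieMap g).compl₁₂ A B).compr₂ α) r r =
        mapValues α (lieF n g (mapValues A r) (mapValues B r)) := by
    intro A B α
    change _ = mapValues α (bilin (lieMap g) (mapValues A r) (mapValues B r))
    rw [mapValues_bilin]
    rfl
  rw [h3, h3, h3]
  rfl

variable {x : Fin n → g} {e : Fin n → Module.Dual ℂ g} {Ω : g ⊗[ℂ] g} {r : Series n (g ⊗[ℂ] g)}

/-- The flip of `Ω + r` is `Ω - r`, and the terms mixing `Ω` and `r` cancel by the skew-symmetry of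
`α [S β, y]` in `α` and `β`, which is the invariance of `Ω`. -/
theorem curvForm_shift (hsym : flip Ω = Ω) (hinv : ∀ y : g, ⁅y, Ω⁆ = 0)
    (hdual : ∀ i j, e i (x j) = if i = j then 1 else 0)
    (hproj : ∀ k j y, e k ⁅x j, y⁆ = ∑ i, e i y * e k ⁅x j, x i⁆)
    (hskew : ∀ d, flip (r d) = -r d) (α β γ : Series n (Module.Dual ℂ g)) :
    pairF n g α (lieF n g (opF (fun d => flip ((cst Ω + r : Series n (g ⊗[ℂ] g)) d)) β)
          (opF (fun d => flip ((cst Ω + r : Series n (g ⊗[ℂ] g)) d)) γ)) +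
        pairF n g β (lieF n g (opF (cst Ω + r) α) (opF (fun d => flip ((cst Ω + r : Series n (g ⊗[ℂ] g)) d)) γ)) +
        pairF n g γ (lieF n g (opF (cst Ω + r) α) (opF (cst Ω + r) β)) =
      pairF n g α (lieF n g (opF r β) (opF r γ)) + pairF n g β (lieF n g (opF r γ) (opF r α)) +
      pairF n g γ (lieF n g (opF r α) (opF r β)) +
      pairF n g α (lieF n g (opF (cst Ω) β) (opF (cst Ω) γ)) := by
  have F := frame hsym hinv hdual hproj
  have h1 : (fun d => flip ((cst Ω + r : Series n (g ⊗[ℂ] g)) d)) = cst Ω + -r := by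
    funext d
    have : flip ((cst Ω + r : Series n (g ⊗[ℂ] g)) d) =
      flip (cst Ω d) + flip (r d) := map_add _ _ _
    rw [this, hskew, Pi.add_apply, Pi.neg_apply]
    congr 1
    simp only [cst_apply]
    split_ifs
    · exact hsym
    · simp [flip]
  rw [h1, opF_add, opF_add, opF_neg]
  simp only [LinearMap.add_apply, LinearMap.neg_apply, map_add, map_neg]
  have c1 := F.cubic_swap α β (opF r γ)
  have c2 := F.cubic_swap α γ (opF r β)
  have c3 := F.cubic_swap β γ (opF r α)
  have c4 := F.cubic_swap α β (opF (cst Ω) γ)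
  have c5 := F.cubic_swap γ α (opF (cst Ω) β)
  have s1 := F.skew (opF r β) (opF (cst Ω) γ)
  have s2 := F.skew (opF r α) (opF (cst Ω) γ)
  have s3 := F.skew (opF r α) (opF (cst Ω) β)
  have s4 := F.skew (opF r α) (opF r γ)
  have s5 := F.skew (opF (cst Ω) γ) (opF (cst Ω) β)
  rw [s5, map_neg] at c5
  rw [s1, s2, s3, s4]
  simp only [map_neg]
  linear_combination -c1 + c2 - c3 + c4 + c5

/-- The pairing of the classical dynamical Yang-Baxter equation with three functionals. -/
theorem triple_cdybe {l : LieSubalgebra ℂ g} (b : Module.Basis (Fin n) ℂ l)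
    (hsym : flip Ω = Ω) (hinv : ∀ y : g, ⁅y, Ω⁆ = 0)
    (hdual : ∀ i j, e i (b j : g) = if i = j then 1 else 0)
    (hproj : ∀ k j y, e k ⁅(b j : g), y⁆ = ∑ i, e i y * e k ⁅(b j : g), (b i : g)⁆)
    (hskew : ∀ d, flip (r d) = -r d) (α β γ : Module.Dual ℂ g) (d : Fin n →₀ ℕ) :
    triple α β γ ((mapValues (alt g) (dBar b (cst Ω + r)) +
      bilin (cybBilin g) (cst Ω + r) (cst Ω + r) : Series n (g ⊗[ℂ] (g ⊗[ℂ] g))) d) =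
      curvF (fun i => (b i : g)) Ω r (cst α) (cst β) (cst γ) d := by
  rw [Pi.add_apply, map_add, triple_bilin_cyb]
  rw [curvForm_shift hsym hinv hdual hproj hskew]
  have hd : ∀ i, pderiv i (cst Ω + r) = pderiv i r := by
    intro i
    rw [pderiv_add, pderiv_cst, zero_add]
  have hs : ∀ i (α β : Module.Dual ℂ g), β (sharpMap g (pderiv i r d) α) =
      -α (sharpMap g (pderiv i r d) β) := by
    intro i α β
    rw [← pair_sharpMap_flip, flip_pderiv hskew]
    simp
  have h1 : triple α β γ (mapValues (alt g) (dBar b (cst Ω + r)) d) =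
      (∑ i, (pairF n g (cst α) (cst (b i : g)) * pairF n g (cst γ) (opF (pderiv i r) (cst β)) +
        pairF n g (cst β) (cst (b i : g)) * pairF n g (cst α) (opF (pderiv i r) (cst γ)) +
        pairF n g (cst γ) (cst (b i : g)) * pairF n g (cst β) (opF (pderiv i r) (cst α)))) d := by
    simp only [mapValues, dBar, hd, map_sum, triple_alt]
    refine Eq.trans ?_ (Finset.sum_apply (M := fun _ => ℂ) d _ _).symm
    refine Finset.sum_congr rfl fun i _ => ?_
    have h2 : ∀ (α β γ : Module.Dual ℂ g),
        (pairF n g (cst α) (cst (b i : g)) * pairF n g (cst γ) (opF (pderiv i r) (cst β))) d =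
          α (b i : g) * γ (sharpMap g (pderiv i r d) β) := by
      intro α β γ
      rw [pairF_cst_cst, mul_comm, Scal.mul_const, pairF_cst_coeff, opF_cst_right, mul_comm]
      rfl
    refine Eq.trans ?_ (congrArg₂ (· + ·) (congrArg₂ (· + ·) (h2 α β γ) (h2 β γ α))
      (h2 γ α β)).symm
    rw [hs i α γ]
    ring
  rw [h1]
  exact congrFun (show _ + _ = curvF (fun i => (b i : g)) Ω r (cst α) (cst β) (cst γ) by
    rw [curvF, curvForm]; ring) d

end Pairing

/-! ### From the dynamical Yang-Baxter equation to the radial equation -/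

section RadialOfFlat

set_option linter.unusedSectionVars false

variable {n : ℕ} {g : Type*} [LieRing g] [LieAlgebra ℂ g]
variable {x : Fin n → g} {e : Fin n → Module.Dual ℂ g} {Ω : g ⊗[ℂ] g} {r : Series n (g ⊗[ℂ] g)}

theorem pderiv_opF (i : Fin n) (r : Series n (g ⊗[ℂ] g)) (α : Series n (Module.Dual ℂ g)) :
    pderiv i (opF r α) = opF (pderiv i r) α + opF r (pderiv i α) :=
  pderiv_bilin i (sharpMap g) r α

theorem Scal.euler_eq_sum (a : Scal n) :
    Scal.euler a = ∑ i, (MvPowerSeries.X i : Scal n) * Scal.pderiv i a := by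
  refine (DynR.euler_eq_sum (V := ℂ) a).trans (Finset.sum_congr rfl fun i _ => ?_)
  refine (X_smul i (DynR.pderiv (V := ℂ) i a)).symm.trans ?_
  exact (Scal.mul_eq _ _).symm

/-- Flat functions killed by the coordinate function satisfy the radial equation. -/
theorem isRadial_of_curvF_eq_zero (hsym : flip Ω = Ω) (hinv : ∀ y : g, ⁅y, Ω⁆ = 0)
    (hdual : ∀ i j, e i (x j) = if i = j then 1 else 0)
    (hproj : ∀ k j y, e k ⁅x j, y⁆ = ∑ i, e i y * e k ⁅x j, x i⁆)
    (hskew : ∀ d, flip (r d) = -r d) (heps : opF r (epsF e) = 0)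
    (hflat : ∀ α β γ : Module.Dual ℂ g, curvF x Ω r (cst α) (cst β) (cst γ) = 0) :
    IsRadial x e Ω r := by
  intro β γ
  have F := frame hsym hinv hdual hproj
  have hp : ∀ α, pairF n g α (curvVec (lieF n g) (pairF n g) (coF n g) (opF (cst Ω))
      (fun i => cst (x i)) (opF r) (fun i => opF (pderiv i r)) (cst β) (cst γ)) =
      curvF x Ω r α (cst β) (cst γ) :=
    fun α => F.pair_curvVec (fun α β => pairF_opF_skew hskew α β)
      (fun i α β => pairF_opF_skew (flip_pderiv hskew i) α β) _ _ _
  have hV := eq_zero_of_pairF fun α => (hp (cst α)).trans (hflat α β γ)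
  have h0 : curvF x Ω r (epsF e) (cst β) (cst γ) = 0 := by
    rw [← hp, hV, map_zero]
  -- Differentiating `r ε = 0`. This produces the two terms with `projDual` in the radial equation.
  have hD : ∀ i, opF (pderiv i r) (epsF e) = -opF r (cst (e i)) := by
    intro i
    have h := pderiv_opF i r (epsF e)
    rw [heps, pderiv_epsF] at h
    have z : pderiv i (0 : Series n g) = 0 := funext fun d => smul_zero _
    rw [z] at h
    exact eq_neg_of_add_eq_zero_left h.symm
  have hx : ∀ i, pairF n g (epsF e) (cst (x i)) = (MvPowerSeries.X i : Scal n) := by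
    intro i
    rw [pairF_epsF]
    simp [F.dual]
  have e1 : ∑ i, (pairF n g (epsF e) (cst (x i)) * pairF n g (cst γ) (opF (pderiv i r) (cst β)) +
      pairF n g (cst β) (cst (x i)) * pairF n g (epsF e) (opF (pderiv i r) (cst γ)) +
      pairF n g (cst γ) (cst (x i)) * pairF n g (cst β) (opF (pderiv i r) (epsF e))) =
      Scal.euler (pairF n g (cst γ) (opF r (cst β))) +
      pairF n g (cst γ) (opF r (cst (projDual x e β))) +
      pairF n g (cst (projDual x e γ)) (opF r (cst β)) := by
    rw [Scal.euler_eq_sum, ← projM_cst, ← projM_cst, Frame.pair_projM, projM_apply]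
    simp only [map_sum, map_smul, smul_eq_mul, ← Finset.sum_add_distrib]
    refine Finset.sum_congr rfl fun i _ => ?_
    rw [pairF_opF_skew (flip_pderiv hskew i) (cst γ) (epsF e), hD, hx, Scal.pderiv_pairF_cst,
      pderiv_opF_cst, map_neg, map_neg, pairF_opF_skew hskew (cst (e i)) (cst β)]
    ring
  have h1 : ∑ i, (pairF n g (epsF e) (cst (x i)) * pairF n g (cst γ) (opF (pderiv i r) (cst β)) +
      pairF n g (cst β) (cst (x i)) * pairF n g (epsF e) (opF (pderiv i r) (cst γ)) +
      pairF n g (cst γ) (cst (x i)) * pairF n g (cst β) (opF (pderiv i r) (epsF e))) +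
      pairF n g (epsF e) (lieF n g (opF r (cst β)) (opF r (cst γ))) +
      pairF n g (cst β) (lieF n g (opF r (cst γ)) (opF r (epsF e))) +
      pairF n g (cst γ) (lieF n g (opF r (epsF e)) (opF r (cst β))) +
      pairF n g (epsF e) (lieF n g (opF (cst Ω) (cst β)) (opF (cst Ω) (cst γ))) = 0 := h0
  rw [e1, heps] at h1
  simp only [map_zero, LinearMap.zero_apply, add_zero] at h1
  exact h1

end RadialOfFlat

/-! ### Reductive decompositions -/

section Decomposition

variable {n : ℕ} {g : Type*} [LieRing g] [LieAlgebra ℂ g]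
variable {l : LieSubalgebra ℂ g} (b : Module.Basis (Fin n) ℂ l)
  {m : Submodule ℂ g} (hcompl : IsCompl l.toSubmodule m)

/-- The projection to `l` along `m`. -/
def projL : g →ₗ[ℂ] l := Submodule.projectionOnto l.toSubmodule m hcompl

theorem projL_coe (y : l) : projL hcompl (y : g) = y :=
  Submodule.projectionOnto_apply_left hcompl y

theorem projL_of_mem {y : g} (hy : y ∈ m) : projL hcompl y = 0 :=
  (Submodule.projectionOnto_apply_eq_zero_iff hcompl).mpr hy

theorem sub_projL_mem (y : g) : y - (projL hcompl y : g) ∈ m := by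
  rw [← Submodule.projectionOnto_apply_eq_zero_iff hcompl]
  change projL hcompl (y - (projL hcompl y : g)) = 0
  rw [map_sub, projL_coe, sub_self]

/-- Extension by zero on `m` of the dual basis. -/
def extCoord (i : Fin n) : Module.Dual ℂ g := b.coord i ∘ₗ projL hcompl

theorem extCoord_coe (i : Fin n) (y : l) : extCoord b hcompl i (y : g) = b.repr y i := by
  simp [extCoord, projL_coe]

theorem extCoord_of_mem (i : Fin n) {y : g} (hy : y ∈ m) : extCoord b hcompl i y = 0 := by
  simp [extCoord, projL_of_mem hcompl hy]

theorem extCoord_dual (i j : Fin n) :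
    extCoord b hcompl i (b j : g) = if i = j then 1 else 0 := by
  rw [extCoord_coe]
  simp [Finsupp.single_apply, eq_comm]

theorem sum_extCoord_coe (y : l) : ∑ k, extCoord b hcompl k (y : g) • (b k : g) = y := by
  simp only [extCoord_coe]
  have := congrArg (l.incl : l →ₗ[ℂ] g) (b.sum_repr y)
  rw [map_sum] at this
  exact this

theorem sum_extCoord (j i : Fin n) :
    ∑ k, extCoord b hcompl k ⁅(b j : g), (b i : g)⁆ • (b k : g) = ⁅(b j : g), (b i : g)⁆ := by
  have := sum_extCoord_coe b hcompl ⁅b j, b i⁆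
  simpa using this

/-- The component of `y` in `m` stays in `m` under `b j`, where the coordinates vanish. -/
theorem extCoord_bracket (hinv : ∀ y : l, ∀ x ∈ m, ⁅(y : g), x⁆ ∈ m) (k j : Fin n) (y : g) :
    extCoord b hcompl k ⁅(b j : g), y⁆ =
      ∑ i, extCoord b hcompl i y * extCoord b hcompl k ⁅(b j : g), (b i : g)⁆ := by
  have h1 : ⁅(b j : g), y⁆ = ⁅(b j : g), (projL hcompl y : g)⁆ +
      ⁅(b j : g), y - (projL hcompl y : g)⁆ := by rw [← lie_add]; simp
  have h2 : (projL hcompl y : g) = ∑ i, extCoord b hcompl i y • (b i : g) := by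
    rw [← sum_extCoord_coe b hcompl (projL hcompl y)]
    refine Finset.sum_congr rfl fun i _ => ?_
    rw [extCoord_coe]
    rfl
  rw [h1, map_add, extCoord_of_mem b hcompl k (hinv (b j) _ (sub_projL_mem hcompl y)), add_zero,
    h2, lie_sum, map_sum]
  simp

/-- Equivariance, expressed by the vanishing of the defects of the basis elements. -/
theorem equivDefect_apply (j : Fin n) (r : Series n (g ⊗[ℂ] g)) (d : Fin n →₀ ℕ) :
    equivDefect (fun i => (b i : g)) (extCoord b hcompl) (b j : g) r d =
      ⁅(b j : g), r d⁆ + coadj b (b j) r d := by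
  rw [equivDefect, Pi.add_apply, coadj]
  congr 1
  refine congrFun (Finset.sum_congr rfl fun i _ => ?_) d
  rw [pairF_epsF, Finset.sum_smul]
  refine Finset.sum_congr rfl fun k _ => ?_
  rw [lieF_cst_cst, pairF_cst_cst, mul_comm, mul_smul, X_smul]
  have h1 : extCoord b hcompl k ⁅(b j : g), (b i : g)⁆ = b.repr ⁅b j, b i⁆ k :=
    extCoord_coe b hcompl k ⁅b j, b i⁆
  rw [h1]
  exact bilin_const_left (LinearMap.lsmul ℂ (g ⊗[ℂ] g)) _ _

theorem isEquivariant_iff (r : Series n (g ⊗[ℂ] g)) : IsEquivariant b r ↔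
    ∀ j, equivDefect (fun i => (b i : g)) (extCoord b hcompl) (b j : g) r = 0 := by
  constructor
  · intro h j
    funext d
    rw [equivDefect_apply]
    exact h (b j) d
  · intro h y d
    let f : l →ₗ[ℂ] g ⊗[ℂ] g :=
      { toFun := fun y => ⁅(y : g), r d⁆ + coadj b y r d
        map_add' := by
          intro y z
          simp [coadj, add_smul, Finset.sum_add_distrib]
          abel
        map_smul' := by
          intro c y
          simp [coadj, mul_smul, Finset.smul_sum] }
    have : f = 0 := b.ext fun j => by
      have := congrFun (h j) d
      rw [equivDefect_apply] at this
      exact this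
    exact LinearMap.congr_fun this y

end Decomposition

/-! ### The Alekseev-Meinrenken r-matrix -/

section FSeries

/-- The differential equation `s f' + 2 f = s f² - s / 4`. -/
theorem fSeries_ode :
    4 * (PowerSeries.X * PowerSeries.derivative ℂ fSeries) + 8 * fSeries =
      4 * (PowerSeries.X * (fSeries * fSeries)) - PowerSeries.X := by
  set s : PowerSeries ℂ := PowerSeries.X with hs
  set E := PowerSeries.exp ℂ with hE
  set f := fSeries with hf
  have h := fSeries_spec
  rw [← hs, ← hE, ← hf] at h
  have hE' : PowerSeries.derivative ℂ E = E := by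
    ext k
    simp [hE, PowerSeries.coeff_derivative, PowerSeries.coeff_exp, Nat.factorial_succ]
    field_simp
  have hs' : PowerSeries.derivative ℂ s = 1 := PowerSeries.derivative_X
  have h2 := congrArg (PowerSeries.derivative ℂ) h
  have h3 : PowerSeries.derivative ℂ (2 : PowerSeries ℂ) = 0 := by
    have : (2 : PowerSeries ℂ) = PowerSeries.C (2 : ℂ) := (map_ofNat _ 2).symm
    rw [this, PowerSeries.derivative_C]
  simp only [Derivation.leibniz, map_sub, map_add, hE', hs', h3, smul_eq_mul,
    Derivation.map_one_eq_zero, mul_one, mul_zero, sub_zero, add_zero] at h2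
  -- After clearing this denominator the claim is a combination of `fSeries_spec` and its
  -- derivative; power series form a domain.
  have hD : s * (E - 1) ^ 2 ≠ 0 := by
    apply mul_ne_zero PowerSeries.X_ne_zero
    apply pow_ne_zero
    intro h0
    have := congrArg (PowerSeries.coeff 1) h0
    simp [hE, PowerSeries.coeff_exp, PowerSeries.coeff_one] at this
  rw [← sub_eq_zero]
  apply mul_left_cancel₀ hD
  linear_combination (2 * s * (E - 1)) * h2 + (2 * (E - 1) - 2 * s * E -
    (2 * s * (E - 1) * f + (2 * (E - 1) - s * (E + 1)))) * h

/-- The differential equation, coefficient by coefficient. The convolution is written over a square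
with an indicator, the shape in which a product of two truncated sums produces it. -/
theorem coeff_fSeries_rec (k : ℕ) :
    ((k : ℂ) + 2) * PowerSeries.coeff k fSeries =
      ∑ p ∈ (Finset.range k ×ˢ Finset.range k), (if p.1 + p.2 + 1 = k then
        PowerSeries.coeff p.1 fSeries * PowerSeries.coeff p.2 fSeries else 0) -
      (if k = 1 then 1 / 4 else 0) := by
  have h := congrArg (PowerSeries.coeff k) fSeries_ode
  have e4 : (4 : PowerSeries ℂ) = PowerSeries.C (4 : ℂ) := (map_ofNat _ 4).symm
  have e8 : (8 : PowerSeries ℂ) = PowerSeries.C (8 : ℂ) := (map_ofNat _ 8).symm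
  rw [e4, e8] at h
  simp only [map_add, map_sub, PowerSeries.coeff_C_mul] at h
  rw [← Finset.sum_filter]
  rcases k with _ | k
  · simp [fSeries]
  · rw [PowerSeries.coeff_succ_X_mul, PowerSeries.coeff_succ_X_mul, PowerSeries.coeff_derivative,
      PowerSeries.coeff_mul, PowerSeries.coeff_X] at h
    have hset : (Finset.range (k + 1) ×ˢ Finset.range (k + 1)).filter
        (fun p => p.1 + p.2 + 1 = k + 1) = Finset.HasAntidiagonal.antidiagonal k := by
      ext p
      simp only [Finset.mem_filter, Finset.mem_product, Finset.mem_range,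
        Finset.HasAntidiagonal.mem_antidiagonal]
      omega
    rw [hset]
    have h4 : (if k + 1 = 1 then (1 / 4 : ℂ) else 0) = (1 / 4) * (if k + 1 = 1 then 1 else 0) := by
      split_ifs <;> simp
    rw [h4, Nat.cast_succ]
    linear_combination h / 4

/-- `f` is odd: its constant term is zero, and the other even coefficients are multiples of
Bernoulli numbers of odd index greater than one. -/
theorem coeff_fSeries_neg (k : ℕ) :
    (-1) ^ k * PowerSeries.coeff k fSeries = -PowerSeries.coeff k fSeries := by
  rcases Nat.even_or_odd k with h | h
  · have : PowerSeries.coeff k fSeries = 0 := by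
      rw [fSeries, PowerSeries.coeff_mk]
      split_ifs with h0
      · rfl
      · rw [bernoulli_eq_zero_of_odd (Even.add_one h) (by omega)]
        simp
    rw [this]; simp
  · rw [h.neg_one_pow]; ring

end FSeries

/-! ### Powers of `ad μ` and skew-symmetry of `f(ad μ)` -/

section AM

variable {k : Type*} [LieRing k] [LieAlgebra ℂ k] {n : ℕ} (b : Module.Basis (Fin n) ℂ k)
  (Ω : k ⊗[ℂ] k)

/-- The linear function `μ = ∑ x_i (x_i^* ⊗ 1) Ω`. -/
def muF : Series n k := opF (cst Ω) (epsF b.coord)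

/-- The bracket with `μ`. -/
def adMu : Module.End (Scal n) (Series n k) := lieF n k (muF b Ω)

theorem muF_eq_sum :
    muF b Ω = ∑ i, (MvPowerSeries.X i : Scal n) • cst (sharp Ω (b.coord i)) := by
  simp only [muF, epsF, map_sum, map_smul]
  refine Finset.sum_congr rfl fun i _ => ?_
  rw [opF_cst_left, cst, mapValues_const, sharpMap_eq]
  rfl

theorem adPow_apply (j : ℕ) (v : k) (d : Fin n →₀ ℕ) :
    adPow b Ω j d v = ((adMu b Ω ^ j) (cst v)) d := by
  induction j generalizing d with
  | zero =>
    simp only [adPow, const, pow_zero, Module.End.one_apply, cst_apply]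
    split_ifs <;> simp
  | succ j ih =>
    have h : (fun d => adPow b Ω j d v) = (adMu b Ω ^ j) (cst v) := funext ih
    rw [pow_succ', Module.End.mul_apply, ← h]
    simp only [adMu, muF_eq_sum, map_sum, map_smul, LinearMap.sum_apply, LinearMap.smul_apply,
      lieF_cst_left]
    simp only [X_smul, Finset.sum_apply, LinearMap.sum_apply, adPow]
    refine Finset.sum_congr rfl fun i _ => ?_
    simp only [mulX]
    split_ifs
    · simp
    · rfl

theorem adMu_pow_coeff {j : ℕ} (v : k) {d : Fin n →₀ ℕ} (h : d.degree ≠ j) :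
    ((adMu b Ω ^ j) (cst v)) d = 0 := by
  rw [← adPow_apply, adPow_eq_zero b Ω j d h, LinearMap.zero_apply]

/-- The nonconstant part of the Alekseev-Meinrenken r-matrix. -/
def rhoAM : Series n (k ⊗[ℂ] k) := fun d => endTensor Ω (fAd b Ω d)

/-- By homogeneity, a single power of `ad μ` contributes to each coefficient. -/
theorem opF_rhoAM (β : Module.Dual ℂ k) (d : Fin n →₀ ℕ) :
    opF (rhoAM b Ω) (cst β) d = PowerSeries.coeff d.degree fSeries •
      ((adMu b Ω ^ d.degree) (opF (cst Ω) (cst β))) d := by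
  have h1 : opF (cst Ω) (cst β) = (cst (sharp Ω β) : Series n k) := by
    rw [opF_cst_left, cst, mapValues_const, sharpMap_eq]
    rfl
  rw [h1, ← adPow_apply, opF_cst_right]
  change sharpMap k (endTensor Ω (fAd b Ω d)) β = _
  rw [sharpMap_eq, sharp_endTensor, fAd, LinearMap.sum_apply, Finset.sum_eq_single d.degree]
  · rfl
  · intro j _ hj
    rw [adPow_eq_zero b Ω j d (Ne.symm hj)]
    simp
  · simp

variable {Ω}

theorem frame_basis (hsym : flip Ω = Ω) (hinv : ∀ y : k, ⁅y, Ω⁆ = 0) :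
    Frame (pairF n k) (lieF n k) (coF n k) (opF (cst Ω)) (fun i => cst (b i))
      (fun i => cst (b.coord i)) (epsF b.coord) := by
  apply frame hsym hinv
  · intro i j
    simp [Finsupp.single_apply, eq_comm]
  · intro i j y
    have h : ⁅b j, y⁆ = ∑ i, b.repr y i • ⁅b j, b i⁆ := by
      simp only [← lie_smul, ← lie_sum, b.sum_repr]
    simp [h]

theorem adMu_opF (hsym : flip Ω = Ω) (hinv : ∀ y : k, ⁅y, Ω⁆ = 0) (j : ℕ)
    (γ : Series n (Module.Dual ℂ k)) :
    (adMu b Ω ^ j) (opF (cst Ω) γ) =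
      opF (cst Ω) (((coF n k (muF b Ω) : Module.End (Scal n) (Series n (Module.Dual ℂ k))) ^ j) γ) := by
  induction j with
  | zero => rfl
  | succ j ih =>
    rw [pow_succ', Module.End.mul_apply, ih, pow_succ', Module.End.mul_apply,
      (frame_basis b hsym hinv).inv]
    rfl

theorem pairF_coF_pow (j : ℕ) (γ : Series n (Module.Dual ℂ k)) (y : Series n k) :
    pairF n k (((coF n k (muF b Ω) : Module.End (Scal n) (Series n (Module.Dual ℂ k))) ^ j) γ) y =
      (-1) ^ j * pairF n k γ ((adMu b Ω ^ j) y) := by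
  induction j generalizing y with
  | zero => simp
  | succ j ih =>
    rw [pow_succ', Module.End.mul_apply, pairF_coF, ih, pow_succ (adMu b Ω), Module.End.mul_apply,
      pow_succ]
    simp [adMu]

/-- Invariance of `Ω` moves powers of `ad μ` to the functional, its symmetry exchanges `β` and `γ`,
and each `ad μ` moved back across the pairing costs a sign. -/
theorem pairF_adMu_skew (hsym : flip Ω = Ω) (hinv : ∀ y : k, ⁅y, Ω⁆ = 0) (j : ℕ)
    (β γ : Series n (Module.Dual ℂ k)) :
    pairF n k γ ((adMu b Ω ^ j) (opF (cst Ω) β)) =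
      (-1) ^ j * pairF n k β ((adMu b Ω ^ j) (opF (cst Ω) γ)) := by
  have h := pairF_coF_pow (Ω := Ω) b j β (opF (cst Ω) γ)
  rw [adMu_opF b hsym hinv, (frame_basis b hsym hinv).symm, h]

/-- Cyclicity of the cubic form brings `ε` under `Ω`, where it becomes `μ` and supplies the extra
factor `ad μ`. So the quadratic term of the radial equation is again a power of `ad μ`. -/
theorem pairF_epsF_adMu (hsym : flip Ω = Ω) (hinv : ∀ y : k, ⁅y, Ω⁆ = 0) (p q : ℕ)
    (β γ : Series n (Module.Dual ℂ k)) :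
    pairF n k (epsF b.coord) (lieF n k ((adMu b Ω ^ p) (opF (cst Ω) β))
        ((adMu b Ω ^ q) (opF (cst Ω) γ))) =
      (-1) ^ q * pairF n k γ ((adMu b Ω ^ (p + q + 1)) (opF (cst Ω) β)) := by
  have F := frame_basis b hsym hinv
  rw [adMu_opF b hsym hinv q, adMu_opF b hsym hinv p, F.cubic_cycle, F.cubic_cycle]
  have h1 : lieF n k (opF (cst Ω) (epsF b.coord)) (opF (cst Ω)
      (((coF n k (muF b Ω) : Module.End (Scal n) (Series n (Module.Dual ℂ k))) ^ p) β)) =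
      (adMu b Ω ^ (p + 1)) (opF (cst Ω) β) := by
    rw [← adMu_opF b hsym hinv p, pow_succ', Module.End.mul_apply]
    rfl
  rw [h1, pairF_coF_pow, ← Module.End.mul_apply, ← pow_add]
  congr 4
  omega

/-- The sign `(-1)^j` from transposing `(ad μ)^j` combines with the oddness of `f`. -/
theorem flip_rhoAM (hsym : flip Ω = Ω) (hinv : ∀ y : k, ⁅y, Ω⁆ = 0) (d : Fin n →₀ ℕ) :
    flip (rhoAM b Ω d) = -rhoAM b Ω d := by
  rw [← sub_eq_zero, sub_neg_eq_add]
  apply eq_zero_of_sharpMap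
  intro β γ
  have h : ∀ β γ : Module.Dual ℂ k, γ (sharpMap k (rhoAM b Ω d) β) =
      PowerSeries.coeff d.degree fSeries *
        pairF n k (cst γ) ((adMu b Ω ^ d.degree) (opF (cst Ω) (cst β))) d := by
    intro β γ
    rw [pairF_cst_coeff, ← smul_eq_mul, ← map_smul, ← opF_rhoAM, opF_cst_right]
    rfl
  rw [map_add, LinearMap.add_apply, map_add, pair_sharpMap_flip, h, h,
    pairF_adMu_skew b hsym hinv]
  have h2 : ∀ (j : ℕ) (a : Scal n), ((-1) ^ j * a) d = (-1) ^ j * a d := by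
    intro j a
    rcases Nat.even_or_odd j with hj | hj
    · simp [hj.neg_one_pow]
    · rw [hj.neg_one_pow, hj.neg_one_pow, neg_one_mul, neg_one_mul]; rfl
  rw [h2, ← mul_assoc, mul_comm (PowerSeries.coeff _ _), coeff_fSeries_neg]
  ring

end AM

/-! ### The Alekseev-Meinrenken r-matrix solves the radial equation -/

section AMRadial

variable {k : Type*} [LieRing k] [LieAlgebra ℂ k] {n : ℕ} (b : Module.Basis (Fin n) ℂ k)
  {Ω : k ⊗[ℂ] k}

theorem lieF_self (y : Series n k) : lieF n k y y = 0 := by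
  funext d
  have h := congrFun (lieF_skew y y) d
  have h2 : (2 : ℂ) • lieF n k y y d = 0 := by
    rw [two_smul]
    exact add_eq_zero_iff_eq_neg.mpr h
  exact (smul_eq_zero.mp h2).resolve_left two_ne_zero

theorem opF_rhoAM_epsF : opF (rhoAM b Ω) (epsF b.coord) = 0 := by
  funext d
  have h1 : opF (rhoAM b Ω) (epsF b.coord) =
      ∑ i, (MvPowerSeries.X i : Scal n) • opF (rhoAM b Ω) (cst (b.coord i)) := by
    simp [epsF]
  have h2 : ∀ m, (adMu b Ω ^ m) (muF b Ω) =
      ∑ i, (MvPowerSeries.X i : Scal n) • (adMu b Ω ^ m) (opF (cst Ω) (cst (b.coord i))) := by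
    intro m
    simp [muF, epsF]
  -- Each coordinate in `ε` takes up one degree, hence the shift; for `d = 0` the truncated
  -- subtraction is harmless, as both sides vanish.
  have h3 : opF (rhoAM b Ω) (epsF b.coord) d = PowerSeries.coeff (d.degree - 1) fSeries •
      ((adMu b Ω ^ (d.degree - 1)) (muF b Ω)) d := by
    rw [h1, h2, Finset.sum_apply, Finset.sum_apply, Finset.smul_sum]
    refine Finset.sum_congr rfl fun i _ => ?_
    rw [X_smul, X_smul]
    simp only [mulX]
    split_ifs with hi
    · simp
    · have hle : Finsupp.single i 1 ≤ d := by
        rw [Finsupp.single_le_iff]; omega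
      have hdeg := congrArg Finsupp.degree (tsub_add_cancel_of_le hle)
      rw [map_add, Finsupp.degree_single] at hdeg
      rw [opF_rhoAM, ← hdeg, Nat.add_sub_cancel]
  rw [h3]
  -- Either the constant term of `f` appears, which is zero, or a factor `[μ, μ]`.
  rcases hm : d.degree - 1 with _ | m
  · simp [fSeries]
  · rw [pow_succ, Module.End.mul_apply]
    simp [adMu, lieF_self]

theorem rhoAM_zero : rhoAM b Ω 0 = 0 := by
  simp [rhoAM, fAd, fSeries, endTensor]

theorem projDual_basis (β : Module.Dual ℂ k) : projDual b b.coord β = β := by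
  rw [projDual_apply]
  exact b.ext fun j => by simp

/-- Both legs lie in `k`, so the weight in degree `K` is `K + 2`. Every term there is a multiple of
the number `w` given by `(ad μ)^K`, and the multiples add up to zero by the recursion for the
coefficients of `f`; the term `-s/4` matches the contribution of `Ω/2`. -/
theorem isRadial_rhoAM (hsym : flip Ω = Ω) (hinv : ∀ y : k, ⁅y, Ω⁆ = 0) :
    IsRadial b b.coord ((1 / 2 : ℂ) • Ω) (rhoAM b Ω) := by
  intro β γ
  rw [projDual_basis, projDual_basis]
  funext d
  set K := d.degree with hK
  set c : ℕ → ℂ := fun j => PowerSeries.coeff j fSeries with hc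
  let Y : Module.Dual ℂ k → ℕ → Series n k := fun β j => (adMu b Ω ^ j) (opF (cst Ω) (cst β))
  have hS : ∀ β : Module.Dual ℂ k, opF (cst Ω) (cst β) = (cst (sharpMap k Ω β) : Series n k) :=
    fun β => by rw [opF_cst_left, cst, mapValues_const]; rfl
  have hY0 : ∀ β j (q : Fin n →₀ ℕ), q.degree ≠ j → Y β j q = 0 := by
    intro β j q hq
    change ((adMu b Ω ^ j) (opF (cst Ω) (cst β))) q = 0
    rw [hS, adMu_pow_coeff b Ω _ hq]
  let w : ℂ := pairF n k (cst γ) (Y β K) d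
  have hw : ∀ j, pairF n k (cst γ) (Y β j) d = if j = K then w else 0 := by
    intro j
    split_ifs with h
    · rw [h]
    · rw [pairF_cst_coeff, hY0 _ _ _ (Ne.symm h), map_zero]
  have hR : pairF n k (cst γ) (opF (rhoAM b Ω) (cst β)) d = c K * w := by
    rw [pairF_cst_coeff, opF_rhoAM, map_smul, smul_eq_mul, ← pairF_cst_coeff]
  -- Truncation below degree `K` replaces the formal function by a finite sum and does not change
  -- the bracket term, as `ε` takes up one degree.
  let T : Module.Dual ℂ k → Series n k := fun β =>
    ∑ p ∈ Finset.range K, Scal.const n (c p) • Y β p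
  have hconst : ∀ (a : ℂ) (f : Series n k) (q : Fin n →₀ ℕ), (Scal.const n a • f) q = a • f q := by
    intro a f q
    exact congrFun (bilin_const_left (LinearMap.lsmul ℂ k) a f) q
  have hRT : ∀ β (q : Fin n →₀ ℕ), q.degree < K →
      (opF (rhoAM b Ω) (cst β) - T β) q = 0 := by
    intro β q hq
    rw [Pi.sub_apply, sub_eq_zero, opF_rhoAM]
    simp only [T, Finset.sum_apply, hconst]
    rw [Finset.sum_eq_single q.degree]
    · intro j _ hj
      rw [hY0 _ _ _ (Ne.symm hj), smul_zero]
    · intro h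
      exact absurd (Finset.mem_range.mpr hq) h
  have hbr : pairF n k (epsF b.coord) (lieF n k (opF (rhoAM b Ω) (cst β))
      (opF (rhoAM b Ω) (cst γ))) d = pairF n k (epsF b.coord) (lieF n k (T β) (T γ)) d := by
    have e0 : lieF n k (opF (rhoAM b Ω) (cst β)) (opF (rhoAM b Ω) (cst γ)) =
        lieF n k (T β) (T γ) +
        (lieF n k (opF (rhoAM b Ω) (cst β) - T β) (opF (rhoAM b Ω) (cst γ)) -
          lieF n k (opF (rhoAM b Ω) (cst γ) - T γ) (T β)) := by
      rw [lieF_skew (opF (rhoAM b Ω) (cst γ) - T γ) (T β)]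
      simp only [map_sub, LinearMap.sub_apply]
      abel
    have e1 : pairF n k (epsF b.coord)
        (lieF n k (opF (rhoAM b Ω) (cst β) - T β) (opF (rhoAM b Ω) (cst γ))) d = 0 :=
      pairF_coeff_eq_zero (epsF_apply_zero _)
        (fun q hq => bil_coeff_eq_zero (lieMap k) (hRT β) _ hq) hK.symm
    have e2 : pairF n k (epsF b.coord)
        (lieF n k (opF (rhoAM b Ω) (cst γ) - T γ) (T β)) d = 0 :=
      pairF_coeff_eq_zero (epsF_apply_zero _)
        (fun q hq => bil_coeff_eq_zero (lieMap k) (hRT γ) _ hq) hK.symm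
    have e3 : ∀ u v w : Scal n, (u + (v - w)) d = u d + (v d - w d) := fun _ _ _ => rfl
    rw [e0, map_add, map_sub, e3, e1, e2, sub_zero, add_zero]
  have hcm : ∀ (a : ℂ) (f : Scal n), (Scal.const n a * f) d = a * f d := by
    intro a f
    rw [mul_comm, Scal.mul_const, mul_comm]
  have hneg : ∀ (j : ℕ) (a : Scal n), ((-1) ^ j * a) d = (-1) ^ j * a d := by
    intro j a
    rcases Nat.even_or_odd j with hj | hj
    · simp [hj.neg_one_pow]
    · rw [hj.neg_one_pow, hj.neg_one_pow, neg_one_mul, neg_one_mul]; rfl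
  have hpq : ∀ p q, pairF n k (epsF b.coord) (lieF n k (Y β p) (Y γ q)) d =
      (-1) ^ q * if p + q + 1 = K then w else 0 := by
    intro p q
    rw [pairF_epsF_adMu b hsym hinv, hneg]
    exact congrArg _ (hw (p + q + 1))
  have hTT : pairF n k (epsF b.coord) (lieF n k (T β) (T γ)) d =
      -(∑ p ∈ Finset.range K ×ˢ Finset.range K, if p.1 + p.2 + 1 = K then c p.1 * c p.2 else 0) *
        w := by
    have e0 : pairF n k (epsF b.coord) (lieF n k (T β) (T γ)) =
        ∑ p ∈ Finset.range K ×ˢ Finset.range K, Scal.const n (c p.1) * (Scal.const n (c p.2) *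
          pairF n k (epsF b.coord) (lieF n k (Y β p.1) (Y γ p.2))) := by
      simp only [T, map_sum, LinearMap.sum_apply, map_smul, LinearMap.smul_apply, smul_eq_mul,
        Finset.sum_product, Finset.mul_sum]
      rw [Finset.sum_comm]
      simp only [mul_left_comm]
    rw [e0]
    refine (Finset.sum_apply (M := fun _ => ℂ) d _ _).trans ?_
    rw [← Finset.sum_neg_distrib, Finset.sum_mul]
    refine Finset.sum_congr rfl fun p _ => ?_
    rw [hcm, hcm, hpq]
    -- The oddness of `f` turns the sign `(-1)^q` into the overall minus sign.
    have := coeff_fSeries_neg p.2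
    split_ifs
    · linear_combination c p.1 * w * this
    · simp
  have hhalf : pairF n k (epsF b.coord) (lieF n k (opF (cst ((1 / 2 : ℂ) • Ω)) (cst β))
      (opF (cst ((1 / 2 : ℂ) • Ω)) (cst γ))) d = if K = 1 then 1 / 4 * w else 0 := by
    have e0 : ∀ β : Module.Dual ℂ k, opF (cst ((1 / 2 : ℂ) • Ω)) (cst β) =
        Scal.const n (1 / 2) • Y β 0 := by
      intro β
      rw [← const_smul_cst]
      simp only [opF, map_smul, LinearMap.smul_apply]
      rfl
    rw [e0, e0]
    simp only [map_smul, LinearMap.smul_apply, smul_eq_mul]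
    rw [hcm, hcm, hpq]
    by_cases h : K = 1
    · simp [h]; ring
    · rw [if_neg h, if_neg (by omega)]; simp
  have hE : Scal.euler (pairF n k (cst γ) (opF (rhoAM b Ω) (cst β))) d = (K : ℂ) * (c K * w) := by
    rw [Scal.euler_coeff, hR]
  change Scal.euler _ d + _ + _ + _ + _ = (0 : ℂ)
  rw [hE, hR, hbr, hTT, hhalf]
  have hrec := coeff_fSeries_rec K
  by_cases h : K = 1
  · rw [if_pos h] at hrec ⊢
    linear_combination w * hrec
  · rw [if_neg h] at hrec ⊢
    linear_combination w * hrec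

end AMRadial

/-! ### Tensors over a subalgebra and its complement -/

section Transfer

variable {n : ℕ} {g : Type*} [LieRing g] [LieAlgebra ℂ g]
variable {l : LieSubalgebra ℂ g}

theorem sharpMap_tensorInclLie (r : l ⊗[ℂ] l) (β : Module.Dual ℂ g) :
    sharpMap g (tensorInclLie l r) β = (sharpMap l r (β ∘ₗ (l.incl : l →ₗ[ℂ] g)) : g) := by
  induction r using TensorProduct.induction_on with
  | zero => simp
  | tmul a c => simp [tensorInclLie]
  | add r s hr hs => simp only [map_add, LinearMap.add_apply, hr, hs]; rfl

theorem sharpMap_tensorIncl_mem {m : Submodule ℂ g} {s : g ⊗[ℂ] g}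
    (hs : s ∈ LinearMap.range (tensorIncl m)) (β : Module.Dual ℂ g) : sharpMap g s β ∈ m := by
  obtain ⟨s, rfl⟩ := hs
  induction s using TensorProduct.induction_on with
  | zero => simp
  | tmul a c => exact m.smul_mem _ c.2
  | add r s hr hs => simp only [map_add, LinearMap.add_apply]; exact m.add_mem hr hs

theorem sharpMap_tensorIncl_eq_zero {m : Submodule ℂ g} {s : g ⊗[ℂ] g}
    (hs : s ∈ LinearMap.range (tensorIncl m)) {β : Module.Dual ℂ g} (hβ : ∀ y ∈ m, β y = 0) :
    sharpMap g s β = 0 := by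
  obtain ⟨s, rfl⟩ := hs
  induction s using TensorProduct.induction_on with
  | zero => simp
  | tmul a c => simp [tensorIncl, hβ a a.2]
  | add r s hr hs => simp only [map_add, LinearMap.add_apply, hr, hs, add_zero]

theorem flip_tensorInclLie (r : l ⊗[ℂ] l) :
    flip (tensorInclLie l r) = tensorInclLie l (flip r) := by
  induction r using TensorProduct.induction_on with
  | zero => simp [flip]
  | tmul a c => simp [tensorInclLie, flip]
  | add r s hr hs => simp only [flip, map_add] at hr hs ⊢; rw [hr, hs]

theorem opF_tensorInclLie (ρ : Series n (l ⊗[ℂ] l)) (β : Module.Dual ℂ g) :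
    opF (mapValues (tensorInclLie l) ρ) (cst β) =
      mapValues (l.incl : l →ₗ[ℂ] g) (opF ρ (cst (β ∘ₗ (l.incl : l →ₗ[ℂ] g)))) := by
  rw [opF_cst_right, opF_cst_right]
  funext d
  exact sharpMap_tensorInclLie (ρ d) β

theorem lieF_incl (y z : Series n l) :
    lieF n g (mapValues (l.incl : l →ₗ[ℂ] g) y) (mapValues (l.incl : l →ₗ[ℂ] g) z) =
      mapValues (l.incl : l →ₗ[ℂ] g) (lieF n l y z) := by
  change bilin (lieMap g) _ _ = mapValues _ (bilin (lieMap l) y z)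
  rw [bilin_mapValues_left, bilin_mapValues_right, mapValues_bilin]
  rfl

variable (b : Module.Basis (Fin n) ℂ l) {m : Submodule ℂ g} (hcompl : IsCompl l.toSubmodule m)

theorem pairF_cst_incl (γ : Module.Dual ℂ g) (y : Series n l) :
    pairF n g (cst γ) (mapValues (l.incl : l →ₗ[ℂ] g) y) =
      pairF n l (cst (γ ∘ₗ (l.incl : l →ₗ[ℂ] g))) y := by
  rw [pairF_cst, pairF_cst]
  rfl

theorem extCoord_comp_incl (i : Fin n) :
    extCoord b hcompl i ∘ₗ (l.incl : l →ₗ[ℂ] g) = b.coord i :=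
  LinearMap.ext fun y => extCoord_coe b hcompl i y

theorem pairF_epsF_incl (y : Series n l) :
    pairF n g (epsF (extCoord b hcompl)) (mapValues (l.incl : l →ₗ[ℂ] g) y) =
      pairF n l (epsF b.coord) y := by
  simp only [pairF_epsF, pairF_cst_incl, extCoord_comp_incl]

theorem projDual_comp_incl (β : Module.Dual ℂ g) :
    projDual (fun i => (b i : g)) (extCoord b hcompl) β ∘ₗ (l.incl : l →ₗ[ℂ] g) =
      β ∘ₗ (l.incl : l →ₗ[ℂ] g) := by
  refine b.ext fun j => ?_
  change projDual (fun i => (b i : g)) (extCoord b hcompl) β (b j : g) = β (b j : g)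
  rw [projDual_apply_apply]
  simp [extCoord_dual]

theorem mapValues_cst {V W : Type*} [AddCommGroup V] [Module ℂ V] [AddCommGroup W] [Module ℂ W]
    (A : V →ₗ[ℂ] W) (v : V) : mapValues A (cst v : Series n V) = cst (A v) :=
  mapValues_const A v

/-- The radial equation for functions with values in `l ⊗ l`. -/
theorem IsRadial.incl {Ωl : l ⊗[ℂ] l} {ρ : Series n (l ⊗[ℂ] l)} (h : IsRadial b b.coord Ωl ρ) :
    IsRadial (fun i => (b i : g)) (extCoord b hcompl) (tensorInclLie l Ωl)
      (mapValues (tensorInclLie l) ρ) := by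
  intro β γ
  have := h (β ∘ₗ (l.incl : l →ₗ[ℂ] g)) (γ ∘ₗ (l.incl : l →ₗ[ℂ] g))
  rw [projDual_basis, projDual_basis] at this
  simp only [← mapValues_cst (n := n) (tensorInclLie l) Ωl, opF_tensorInclLie, lieF_incl,
    pairF_epsF_incl, pairF_cst_incl, projDual_comp_incl]
  exact this

theorem opF_incl_epsF {ρ : Series n (l ⊗[ℂ] l)} (h : opF ρ (epsF b.coord) = 0) :
    opF (mapValues (tensorInclLie l) ρ) (epsF (extCoord b hcompl)) = 0 := by
  have h1 : opF (mapValues (tensorInclLie l) ρ) (epsF (extCoord b hcompl)) =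
      mapValues (l.incl : l →ₗ[ℂ] g) (opF ρ (epsF b.coord)) := by
    simp only [epsF, map_sum, map_smul, opF_tensorInclLie, extCoord_comp_incl]
    simp only [X_smul]
    funext d
    simp only [mapValues, Finset.sum_apply, map_sum]
    refine Finset.sum_congr rfl fun i _ => ?_
    simp only [mulX]
    split_ifs <;> simp [mapValues]
  rw [h1, h]
  funext d
  exact map_zero _

theorem opF_mem {t : Series n (g ⊗[ℂ] g)} (ht : ∀ d, t d ∈ LinearMap.range (tensorIncl m))
    (β : Module.Dual ℂ g) (d : Fin n →₀ ℕ) : opF t (cst β) d ∈ m := by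
  rw [opF_cst_right]
  exact sharpMap_tensorIncl_mem (ht d) β

theorem opF_extCoord {t : Series n (g ⊗[ℂ] g)} (ht : ∀ d, t d ∈ LinearMap.range (tensorIncl m))
    (i : Fin n) : opF t (cst (extCoord b hcompl i)) = 0 := by
  rw [opF_cst_right]
  funext d
  exact sharpMap_tensorIncl_eq_zero (ht d) fun y hy => extCoord_of_mem b hcompl i hy

theorem opF_epsF_eq_zero {t : Series n (g ⊗[ℂ] g)}
    (ht : ∀ d, t d ∈ LinearMap.range (tensorIncl m)) : opF t (epsF (extCoord b hcompl)) = 0 := by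
  simp only [epsF, map_sum, map_smul, opF_extCoord b hcompl ht, smul_zero, Finset.sum_const_zero]

theorem opF_projDual_eq_zero {t : Series n (g ⊗[ℂ] g)}
    (ht : ∀ d, t d ∈ LinearMap.range (tensorIncl m)) (β : Module.Dual ℂ g) :
    opF t (cst (projDual (fun i => (b i : g)) (extCoord b hcompl) β)) = 0 := by
  rw [projDual_apply, cst_sum, map_sum]
  refine Finset.sum_eq_zero fun i _ => ?_
  rw [← const_smul_cst, map_smul, opF_extCoord b hcompl ht, smul_zero]

/-- The coordinates of `l` vanish on the brackets of `l` and its invariant complement. -/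
theorem pairF_epsF_lieF_incl (hinv : ∀ y : l, ∀ x ∈ m, ⁅(y : g), x⁆ ∈ m) (y : Series n l)
    {z : Series n g} (hz : ∀ d, z d ∈ m) :
    pairF n g (epsF (extCoord b hcompl)) (lieF n g (mapValues (l.incl : l →ₗ[ℂ] g) y) z) = 0 := by
  rw [pairF_epsF]
  refine Finset.sum_eq_zero fun i _ => ?_
  have : pairF n g (cst (extCoord b hcompl i))
      (lieF n g (mapValues (l.incl : l →ₗ[ℂ] g) y) z) = 0 := by
    funext d
    rw [pairF_cst_coeff]
    apply extCoord_of_mem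
    exact m.sum_mem fun p _ => hinv (y p.1) _ (hz p.2)
  rw [this, mul_zero]

/-- The radial equation for the sum of functions with values in `l ⊗ l` and in `m ⊗ m`. -/
theorem IsRadial.add (hinv : ∀ y : l, ∀ x ∈ m, ⁅(y : g), x⁆ ∈ m)
    {Ωl : l ⊗[ℂ] l} {ρ : Series n (l ⊗[ℂ] l)} {Ωm : g ⊗[ℂ] g} {t : Series n (g ⊗[ℂ] g)}
    (hρ : IsRadial (fun i => (b i : g)) (extCoord b hcompl) (tensorInclLie l Ωl)
      (mapValues (tensorInclLie l) ρ))
    (ht : IsRadial (fun i => (b i : g)) (extCoord b hcompl) Ωm t)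
    (hΩm : Ωm ∈ LinearMap.range (tensorIncl m)) (htm : ∀ d, t d ∈ LinearMap.range (tensorIncl m)) :
    IsRadial (fun i => (b i : g)) (extCoord b hcompl) (tensorInclLie l Ωl + Ωm)
      (mapValues (tensorInclLie l) ρ + t) := by
  -- The equation is quadratic, but brackets between `l` and `m` lie in `m` and are invisible to
  -- `ε`.
  have cross : ∀ (ρ : Series n (l ⊗[ℂ] l)) (t : Series n (g ⊗[ℂ] g)),
      (∀ d, t d ∈ LinearMap.range (tensorIncl m)) → ∀ β γ : Module.Dual ℂ g,
      pairF n g (epsF (extCoord b hcompl)) (lieF n g (opF (mapValues (tensorInclLie l) ρ) (cst β))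
        (opF t (cst γ))) = 0 := by
    intro ρ t ht β γ
    rw [opF_tensorInclLie]
    exact pairF_epsF_lieF_incl b hcompl hinv _ (opF_mem ht γ)
  have cross' : ∀ (ρ : Series n (l ⊗[ℂ] l)) (t : Series n (g ⊗[ℂ] g)),
      (∀ d, t d ∈ LinearMap.range (tensorIncl m)) → ∀ β γ : Module.Dual ℂ g,
      pairF n g (epsF (extCoord b hcompl)) (lieF n g (opF t (cst γ))
        (opF (mapValues (tensorInclLie l) ρ) (cst β))) = 0 := by
    intro ρ t ht β γ
    rw [lieF_skew, map_neg, cross ρ t ht, neg_zero]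
  have hcm : ∀ d : Fin n →₀ ℕ, (cst Ωm : Series n (g ⊗[ℂ] g)) d ∈ LinearMap.range (tensorIncl m) := by
    intro d
    rw [cst_apply]
    split_ifs
    · exact hΩm
    · exact zero_mem _
  intro β γ
  have h1 := hρ β γ
  have h2 := ht β γ
  have c1 := cross ρ t htm β γ
  have c2 := cross' ρ t htm γ β
  have c3 := cross (cst Ωl) (cst Ωm) hcm β γ
  have c4 := cross' (cst Ωl) (cst Ωm) hcm γ β
  rw [mapValues_cst] at c3 c4
  simp only [cst_add, opF_add, LinearMap.add_apply, map_add]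
  linear_combination h1 + h2 + c1 + c2 + c3 + c4

end Transfer

/-! ### Construction of solutions of the radial equation with values in `m ⊗ m` -/

section Recursion

/-- A map on formal functions, each coefficient of which depends on coefficients of smaller degree
only, has a fixed point, with coefficients in any set that the map preserves. -/
theorem exists_fixedPoint {n : ℕ} {V : Type*} (Φ : Series n V → Series n V)
    (hΦ : ∀ (φ ψ : Series n V) (d : Fin n →₀ ℕ),
      (∀ q : Fin n →₀ ℕ, q.degree < d.degree → φ q = ψ q) → Φ φ d = Φ ψ d)
    (S : Set V) {v : V} (hv : v ∈ S)
    (hS : ∀ φ, (∀ d, φ d ∈ S) → ∀ d, Φ φ d ∈ S) : ∃ φ, Φ φ = φ ∧ ∀ d, φ d ∈ S := by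
  let T : ℕ → Series n V := fun k => Φ^[k] fun _ => v
  have hT : ∀ k, T (k + 1) = Φ (T k) := fun k => Function.iterate_succ_apply' Φ k _
  have hTS : ∀ k d, T k d ∈ S := by
    intro k
    induction k with
    | zero => exact fun _ => hv
    | succ k ih => rw [hT]; exact hS _ ih
  -- After `k` iterations the coefficients of degree below `k` are final, so the fixed point is read
  -- off after `d.degree + 1` iterations.
  have h1 : ∀ (k : ℕ) (d : Fin n →₀ ℕ), d.degree < k → T (k + 1) d = T k d := by
    intro k
    induction k with
    | zero => intro d hd; omega
    | succ k ih =>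
      intro d hd
      rw [hT, hT]
      exact hΦ _ _ _ fun q hq => (congrFun (hT k).symm q).trans (ih q (by omega))
  have h2 : ∀ (k j : ℕ) (d : Fin n →₀ ℕ), d.degree < k → T (k + j) d = T k d := by
    intro k j d hd
    induction j with
    | zero => rfl
    | succ j ih => rw [← add_assoc, h1 _ _ (by omega), ih]
  refine ⟨fun d => T (d.degree + 1) d, ?_, fun d => hTS _ d⟩
  funext d
  rw [hT]
  apply hΦ
  intro q hq
  obtain ⟨j, hj⟩ := Nat.exists_eq_add_of_lt hq
  rw [hj, add_right_comm]
  exact (h2 _ _ _ (by omega)).symm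

variable {n : ℕ} {g : Type*} [LieRing g] [LieAlgebra ℂ g]

/-- The bilinear map `(a ⊗ c, a' ⊗ c') ↦ e([c, c']) a ⊗ a'`. -/
def contract (e : Module.Dual ℂ g) : g ⊗[ℂ] g →ₗ[ℂ] g ⊗[ℂ] g →ₗ[ℂ] g ⊗[ℂ] g :=
  TensorProduct.curry ((TensorProduct.rid ℂ (g ⊗[ℂ] g)).toLinearMap ∘ₗ
    TensorProduct.map LinearMap.id (e ∘ₗ bracket g) ∘ₗ
      (TensorProduct.tensorTensorTensorComm ℂ g g g g).toLinearMap)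

theorem contract_tmul (e : Module.Dual ℂ g) (a c a' c' : g) :
    contract e (a ⊗ₜ c) (a' ⊗ₜ c') = e ⁅c, c'⁆ • (a ⊗ₜ[ℂ] a') := by
  simp [contract]

theorem flip_contract (e : Module.Dual ℂ g) (r s : g ⊗[ℂ] g) :
    flip (contract e r s) = -contract e s r := by
  induction r using TensorProduct.induction_on with
  | zero => simp [flip]
  | tmul a c =>
    induction s using TensorProduct.induction_on with
    | zero => simp [flip]
    | tmul a' c' =>
      rw [contract_tmul, contract_tmul, ← lie_skew c' c, map_neg, neg_smul, neg_neg]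
      simp [flip]
    | add r s hr hs =>
      simp only [flip, map_add, LinearMap.add_apply] at hr hs ⊢; rw [hr, hs, neg_add]
  | add r s hr hs =>
    simp only [flip, map_add, LinearMap.add_apply] at hr hs ⊢; rw [hr, hs, neg_add]

theorem contract_mem (e : Module.Dual ℂ g) {m : Submodule ℂ g} {r s : g ⊗[ℂ] g}
    (hr : r ∈ LinearMap.range (tensorIncl m)) (hs : s ∈ LinearMap.range (tensorIncl m)) :
    contract e r s ∈ LinearMap.range (tensorIncl m) := by
  obtain ⟨r, rfl⟩ := hr
  obtain ⟨s, rfl⟩ := hs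
  induction r using TensorProduct.induction_on with
  | zero => simp
  | tmul a c =>
    induction s using TensorProduct.induction_on with
    | zero => simp
    | tmul a' c' =>
      have : contract e (tensorIncl m (a ⊗ₜ c)) (tensorIncl m (a' ⊗ₜ c')) =
        e ⁅(c : g), (c' : g)⁆ • tensorIncl m (a ⊗ₜ a') := contract_tmul e _ _ _ _
      rw [this]
      exact Submodule.smul_mem _ _ ⟨_, rfl⟩
    | add r s hr hs => simp only [map_add]; exact add_mem hr hs
  | add r s hr hs => simp only [map_add, LinearMap.add_apply]; exact add_mem hr hs

/-- This realizes the quadratic term of the radial equation by a tensor, so that the equation can be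
solved for the coefficients of `t`. -/
theorem sharpMap_contract (e : Module.Dual ℂ g) (r s : g ⊗[ℂ] g) (β γ : Module.Dual ℂ g) :
    γ (sharpMap g (contract e r s) β) = e ⁅sharpMap g r β, sharpMap g s γ⁆ := by
  induction r using TensorProduct.induction_on with
  | zero => simp
  | tmul a c =>
    induction s using TensorProduct.induction_on with
    | zero => simp
    | tmul a' c' =>
      rw [contract_tmul]
      simp
      ring
    | add r s hr hs => simp only [map_add, LinearMap.add_apply, lie_add, hr, hs]
  | add r s hr hs => simp only [map_add, LinearMap.add_apply, add_lie, hr, hs]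

/-- `wedgeSq m` as a submodule. -/
def wedgeSub (m : Submodule ℂ g) : Submodule ℂ (g ⊗[ℂ] g) where
  carrier := wedgeSq m
  zero_mem' := ⟨zero_mem _, by simp [flip]⟩
  add_mem' := by
    rintro x y ⟨hx, hx'⟩ ⟨hy, hy'⟩
    refine ⟨add_mem hx hy, ?_⟩
    rw [neg_add, ← hx', ← hy']
    exact map_add _ _ _
  smul_mem' := by
    rintro c x ⟨hx, hx'⟩
    refine ⟨Submodule.smul_mem _ c hx, ?_⟩
    rw [← smul_neg, ← hx']
    exact map_smul _ _ _

theorem bilin_contract_mem (e : Module.Dual ℂ g) {m : Submodule ℂ g} {t : Series n (g ⊗[ℂ] g)}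
    (ht : ∀ d, t d ∈ LinearMap.range (tensorIncl m)) (d : Fin n →₀ ℕ) :
    bilin (contract e) t t d ∈ wedgeSub m := by
  refine ⟨Submodule.sum_mem _ fun p _ => contract_mem e (ht _) (ht _), ?_⟩
  change mapValues (TensorProduct.comm ℂ g g).toLinearMap (bilin (contract e) t t) d = _
  have h : (contract e).compr₂ (TensorProduct.comm ℂ g g).toLinearMap = -(contract e).flip :=
    LinearMap.ext₂ (flip_contract e)
  rw [mapValues_bilin, h, bilin_neg_map, bilin_flip]
  rfl

theorem pairF_opF_contract (e : Module.Dual ℂ g) (r s : Series n (g ⊗[ℂ] g))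
    (β γ : Module.Dual ℂ g) : pairF n g (cst γ) (opF (bilin (contract e) r s) (cst β)) =
      pairF n g (cst e) (lieF n g (opF r (cst β)) (opF s (cst γ))) := by
  funext d
  rw [pairF_cst_coeff, pairF_cst_coeff, opF_cst_right, opF_cst_right, opF_cst_right]
  change γ (sharpMap g (∑ p ∈ Finset.HasAntidiagonal.antidiagonal d, contract e (r p.1) (s p.2)) β) =
    e (∑ p ∈ Finset.HasAntidiagonal.antidiagonal d, ⁅sharpMap g (r p.1) β, sharpMap g (s p.2) γ⁆)
  simp only [map_sum, LinearMap.sum_apply, sharpMap_contract]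

/-- Existence of solutions of the radial equation for functions with values in `m ⊗ m`. -/
theorem exists_isRadial {l : LieSubalgebra ℂ g} (b : Module.Basis (Fin n) ℂ l) {m : Submodule ℂ g}
    (hcompl : IsCompl l.toSubmodule m) {ω u : g ⊗[ℂ] g}
    (hω : ω ∈ LinearMap.range (tensorIncl m)) (hu : u ∈ wedgeSq m) :
    ∃ t : Series n (g ⊗[ℂ] g), t 0 = u ∧ (∀ d, t d ∈ wedgeSq m) ∧
      IsRadial (fun i => (b i : g)) (extCoord b hcompl) ω t := by
  let e := extCoord b hcompl
  let Ψ : Series n (g ⊗[ℂ] g) → Series n (g ⊗[ℂ] g) := fun t =>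
    ∑ i, mulX i (bilin (contract (e i)) t t + cst (contract (e i) ω ω))
  -- On `m ⊗ m` the terms with `projDual` vanish, and the radial equation is `euler t = -Ψ t`:
  -- division by the degree gives all coefficients but the constant one, which is set to `u`.
  let Φ : Series n (g ⊗[ℂ] g) → Series n (g ⊗[ℂ] g) := fun t d =>
    if d = 0 then u else (-(d.degree : ℂ)⁻¹) • Ψ t d
  have hdep : ∀ (φ ψ : Series n (g ⊗[ℂ] g)) (d : Fin n →₀ ℕ),
      (∀ q : Fin n →₀ ℕ, q.degree < d.degree → φ q = ψ q) → Φ φ d = Φ ψ d := by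
    intro φ ψ d h
    simp only [Φ]
    split_ifs with hd
    · rfl
    · congr 1
      simp only [Ψ, Finset.sum_apply]
      refine Finset.sum_congr rfl fun i _ => ?_
      simp only [mulX]
      split_ifs with hi
      · rfl
      · rw [Pi.add_apply, Pi.add_apply]
        congr 1
        have hle : Finsupp.single i 1 ≤ d := by
          rw [Finsupp.single_le_iff]; omega
        have hdeg := congrArg Finsupp.degree (tsub_add_cancel_of_le hle)
        rw [map_add, Finsupp.degree_single] at hdeg
        refine Finset.sum_congr rfl fun p hp => ?_
        have hp' := congrArg Finsupp.degree (Finset.HasAntidiagonal.mem_antidiagonal.mp hp)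
        rw [map_add] at hp'
        rw [h p.1 (by omega), h p.2 (by omega)]
  have hmem : ∀ φ, (∀ d, φ d ∈ wedgeSub m) → ∀ d, Φ φ d ∈ wedgeSub m := by
    intro φ hφ d
    simp only [Φ]
    split_ifs with hd
    · exact hu
    · refine Submodule.smul_mem _ _ ?_
      simp only [Ψ, Finset.sum_apply]
      refine Submodule.sum_mem _ fun i _ => ?_
      simp only [mulX]
      split_ifs with hi
      · exact zero_mem _
      · refine add_mem (bilin_contract_mem _ (fun d => (hφ d).1) _) ?_
        rw [cst_apply]
        split_ifs
        · refine ⟨contract_mem _ hω hω, flip_contract _ _ _⟩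
        · exact zero_mem _
  obtain ⟨t, htΦ, ht⟩ := exists_fixedPoint Φ hdep (wedgeSub m) (v := 0) (zero_mem _) hmem
  refine ⟨t, ?_, ht, ?_⟩
  · rw [← htΦ]
    exact if_pos rfl
  have htm : ∀ d, t d ∈ LinearMap.range (tensorIncl m) := fun d => (ht d).1
  have hskew : ∀ d, flip (t d) = -t d := fun d => (ht d).2
  have heuler : euler t = -∑ i, (MvPowerSeries.X i : Scal n) •
      (bilin (contract (e i)) t t + cst (contract (e i) ω ω)) := by
    funext d
    have h0 : (∑ i, (MvPowerSeries.X i : Scal n) •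
      (bilin (contract (e i)) t t + cst (contract (e i) ω ω))) = Ψ t := by
      simp only [X_smul, Ψ]
    rw [h0, Pi.neg_apply]
    by_cases hd : d = 0
    · subst hd
      simp [Ψ, euler, mulX]
    · have hd' : (d.degree : ℂ) ≠ 0 := by
        rw [Nat.cast_ne_zero, Ne, Finsupp.degree_eq_zero_iff]
        exact hd
      have h1 : t d = (-(d.degree : ℂ)⁻¹) • Ψ t d :=
        (congrFun htΦ d).symm.trans (if_neg hd)
      rw [euler, h1, smul_smul, mul_neg, mul_inv_cancel₀ hd', neg_one_smul]
  intro β γ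
  have h1 := opF_projDual_eq_zero b hcompl htm
  have h2 : pairF n g (cst (projDual (fun i => (b i : g)) (extCoord b hcompl) γ))
      (opF t (cst β)) = 0 := by
    rw [pairF_opF_skew hskew, h1, map_zero, neg_zero]
  have h3 : ∀ i, cst (contract (e i) ω ω) = bilin (contract (e i)) (cst ω) (cst ω : Series n _) := by
    intro i
    exact ((bilin_const_left (contract (e i)) ω (cst ω)).trans (mapValues_const _ _)).symm
  rw [h1, h2, map_zero, Scal.euler_pairF_cst, euler_opF_cst, heuler, opF_neg]
  have h4 : opF (∑ i, (MvPowerSeries.X i : Scal n) •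
      (bilin (contract (e i)) t t + cst (contract (e i) ω ω))) =
      ∑ i, (MvPowerSeries.X i : Scal n) • (opF (bilin (contract (e i)) t t) +
        opF (bilin (contract (e i)) (cst ω) (cst ω))) := by
    simp only [opF, map_sum, map_smul, map_add, h3]
  rw [h4]
  simp only [LinearMap.neg_apply, LinearMap.sum_apply, LinearMap.smul_apply, LinearMap.add_apply,
    map_neg, map_sum, map_smul, map_add, pairF_opF_contract, pairF_epsF, smul_eq_mul, mul_add,
    Finset.sum_add_distrib]
  simp only [e]
  ring

end Recursion

/-! ### The decomposition of the invariant tensor -/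

section Decompose

variable {n : ℕ} {g : Type*} [LieRing g] [LieAlgebra ℂ g] {l : LieSubalgebra ℂ g}
  {m : Submodule ℂ g} (hcompl : IsCompl l.toSubmodule m)

theorem projL_lie (hinv : ∀ y : l, ∀ x ∈ m, ⁅(y : g), x⁆ ∈ m) (y : l) (z : g) :
    projL hcompl ⁅(y : g), z⁆ = ⁅y, projL hcompl z⁆ := by
  have h1 : ⁅(y : g), z⁆ = ((⁅y, projL hcompl z⁆ : l) : g) +
      ⁅(y : g), z - (projL hcompl z : g)⁆ := by simp
  rw [h1, map_add, projL_coe, projL_of_mem hcompl (hinv y _ (sub_projL_mem hcompl z)), add_zero]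

/-- The projection of tensors to `l ⊗ l`. -/
def projLSq : g ⊗[ℂ] g →ₗ[ℂ] l ⊗[ℂ] l := TensorProduct.map (projL hcompl) (projL hcompl)

theorem projLSq_tensorInclLie (r : l ⊗[ℂ] l) : projLSq hcompl (tensorInclLie l r) = r := by
  induction r using TensorProduct.induction_on with
  | zero => simp
  | tmul a c => simp [projLSq, tensorInclLie, projL_coe]
  | add r s hr hs => rw [map_add, map_add, hr, hs]

theorem projLSq_tensorIncl (r : m ⊗[ℂ] m) : projLSq hcompl (tensorIncl m r) = 0 := by
  induction r using TensorProduct.induction_on with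
  | zero => simp
  | tmul a c => simp [projLSq, tensorIncl, projL_of_mem hcompl a.2]
  | add r s hr hs => rw [map_add, map_add, hr, hs, add_zero]

theorem projLSq_flip (r : g ⊗[ℂ] g) : projLSq hcompl (flip r) = flip (projLSq hcompl r) := by
  induction r using TensorProduct.induction_on with
  | zero => simp [flip]
  | tmul a c => simp [projLSq, flip]
  | add r s hr hs => simp only [flip, map_add] at hr hs ⊢; rw [hr, hs]

theorem projLSq_lie (hinv : ∀ y : l, ∀ x ∈ m, ⁅(y : g), x⁆ ∈ m) (y : l) (r : g ⊗[ℂ] g) :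
    projLSq hcompl ⁅(y : g), r⁆ = ⁅y, projLSq hcompl r⁆ := by
  induction r using TensorProduct.induction_on with
  | zero => simp
  | tmul a c => simp [projLSq, projL_lie hcompl hinv]
  | add r s hr hs => simp only [lie_add, map_add, hr, hs]

/-- The projection to `m` along `l`. -/
def projMEnd : g →ₗ[ℂ] g := LinearMap.id - (l.incl : l →ₗ[ℂ] g) ∘ₗ projL hcompl

theorem projMEnd_apply (y : g) : projMEnd hcompl y = y - (projL hcompl y : g) := rfl

theorem projMEnd_lie (hinv : ∀ y : l, ∀ x ∈ m, ⁅(y : g), x⁆ ∈ m) (y : l) (z : g) :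
    projMEnd hcompl ⁅(y : g), z⁆ = ⁅(y : g), projMEnd hcompl z⁆ := by
  simp [projMEnd_apply, projL_lie hcompl hinv]

/-- The projection of tensors to `m ⊗ m`. -/
def projMSq : g ⊗[ℂ] g →ₗ[ℂ] g ⊗[ℂ] g :=
  TensorProduct.map (projMEnd hcompl) (projMEnd hcompl)

theorem projMSq_tensorInclLie (r : l ⊗[ℂ] l) : projMSq hcompl (tensorInclLie l r) = 0 := by
  induction r using TensorProduct.induction_on with
  | zero => simp
  | tmul a c => simp [projMSq, tensorInclLie, projMEnd_apply, projL_coe]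
  | add r s hr hs => rw [map_add, map_add, hr, hs, add_zero]

theorem projMSq_of_mem {s : g ⊗[ℂ] g} (hs : s ∈ LinearMap.range (tensorIncl m)) :
    projMSq hcompl s = s := by
  obtain ⟨r, rfl⟩ := hs
  induction r using TensorProduct.induction_on with
  | zero => simp
  | tmul a c =>
    simp [projMSq, tensorIncl, projMEnd_apply, projL_of_mem hcompl a.2, projL_of_mem hcompl c.2]
  | add r s hr hs => rw [map_add, map_add, hr, hs]

theorem projMSq_lie (hinv : ∀ y : l, ∀ x ∈ m, ⁅(y : g), x⁆ ∈ m) (y : l) (r : g ⊗[ℂ] g) :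
    projMSq hcompl ⁅(y : g), r⁆ = ⁅(y : g), projMSq hcompl r⁆ := by
  induction r using TensorProduct.induction_on with
  | zero => simp
  | tmul a c => simp [projMSq, projMEnd_lie hcompl hinv]
  | add r s hr hs => simp only [lie_add, map_add, hr, hs]

variable (b : Module.Basis (Fin n) ℂ l)

theorem coadj_mapValues {V W : Type*} [AddCommGroup V] [Module ℂ V] [AddCommGroup W] [Module ℂ W]
    (A : V →ₗ[ℂ] W) (y : l) (φ : Series n V) :
    coadj b y (mapValues A φ) = mapValues A (coadj b y φ) := by
  funext d
  simp only [coadj, Finset.sum_apply, Pi.smul_apply, mapValues, map_sum, map_smul,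
    pderiv_mapValues]
  refine Finset.sum_congr rfl fun i _ => Finset.sum_congr rfl fun k _ => ?_
  simp only [mulX]
  split_ifs
  · simp
  · rfl

theorem coadj_cst_add {V : Type*} [AddCommGroup V] [Module ℂ V] (y : l) (v : V)
    (φ : Series n V) : coadj b y (cst v + φ) = coadj b y φ := by
  simp only [coadj, pderiv_add, pderiv_cst, zero_add]

/-- The component of an equivariant function with values in `m ⊗ m` is equivariant. -/
theorem IsEquivariant.of_add (hcompl : IsCompl l.toSubmodule m) (hinv : ∀ y : l, ∀ x ∈ m, ⁅(y : g), x⁆ ∈ m)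
    {ρ : Series n (l ⊗[ℂ] l)} {t : Series n (g ⊗[ℂ] g)}
    (ht : ∀ d, t d ∈ LinearMap.range (tensorIncl m))
    (h : IsEquivariant b (mapValues (tensorInclLie l) ρ + t)) : IsEquivariant b t := by
  have h1 : mapValues (projMSq hcompl) (mapValues (tensorInclLie l) ρ + t) = t := by
    funext d
    simp [mapValues, projMSq_tensorInclLie, projMSq_of_mem hcompl (ht d)]
  intro y d
  have h2 := congrArg (projMSq hcompl) (h y d)
  rw [map_add, projMSq_lie hcompl hinv, map_zero] at h2
  have h3 := congrFun (coadj_mapValues b (projMSq hcompl) y (mapValues (tensorInclLie l) ρ + t)) d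
  rw [h1] at h3
  rw [h3, ← congrFun h1 d]
  exact h2

theorem IsEquivariant.cst_add {Ω : g ⊗[ℂ] g} (hΩ : ∀ y : g, ⁅y, Ω⁆ = 0)
    {r : Series n (g ⊗[ℂ] g)} (h : IsEquivariant b r) : IsEquivariant b (cst Ω + r) := by
  intro y d
  rw [coadj_cst_add, ← h y d, Pi.add_apply, lie_add, cst_apply]
  split_ifs
  · rw [hΩ, zero_add]
  · rw [lie_zero, zero_add]

/-- Functionals which vanish on `p` do not see the kernel of the projection modulo `p`. -/
theorem triple_eq_zero_of_tripleMod {p : Submodule ℂ g} {w : g ⊗[ℂ] (g ⊗[ℂ] g)}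
    (hw : tripleMod p w = 0) {α β γ : Module.Dual ℂ g} (hα : ∀ y ∈ p, α y = 0)
    (hβ : ∀ y ∈ p, β y = 0) (hγ : ∀ y ∈ p, γ y = 0) : triple α β γ w = 0 := by
  let F : (g ⧸ p) ⊗[ℂ] ((g ⧸ p) ⊗[ℂ] (g ⧸ p)) →ₗ[ℂ] ℂ ⊗[ℂ] (ℂ ⊗[ℂ] ℂ) :=
    TensorProduct.map (p.liftQ α hα) (TensorProduct.map (p.liftQ β hβ) (p.liftQ γ hγ))
  let M : ℂ ⊗[ℂ] (ℂ ⊗[ℂ] ℂ) →ₗ[ℂ] ℂ := LinearMap.mul' ℂ ℂ ∘ₗ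
    TensorProduct.map LinearMap.id (LinearMap.mul' ℂ ℂ)
  have key : ∀ w, triple α β γ w = M (F (tripleMod p w)) := by
    intro w
    induction w using TensorProduct.induction_on with
    | zero => simp
    | tmul a s =>
      induction s using TensorProduct.induction_on with
      | zero => simp
      | tmul c d => simp [triple_tmul_tmul, M, F, tripleMod]; rfl
      | add r s hr hs => simp only [TensorProduct.tmul_add, map_add, hr, hs]
    | add r s hr hs => simp only [map_add, hr, hs]
  rw [key, hw, map_zero, map_zero]

end Decompose

/-! ### Dynamical r-matrices extending the Alekseev-Meinrenken r-matrix -/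

section Main

variable {n : ℕ} {g : Type*} [LieRing g] [LieAlgebra ℂ g] {l : LieSubalgebra ℂ g}
  {m : Submodule ℂ g}

/-- The halves of the two components of `Ω` combine to `Ω/2`, which leaves the part to which the
skew-symmetric theory applies. -/
theorem amShift_eq (b : Module.Basis (Fin n) ℂ l) {Ω : g ⊗[ℂ] g} {Ωl : l ⊗[ℂ] l} {Ωm : m ⊗[ℂ] m}
    (hdec : Ω = tensorInclLie l Ωl + tensorIncl m Ωm) (t : Series n (g ⊗[ℂ] g)) :
    amShift b m Ωl Ωm t =
      cst ((1 / 2 : ℂ) • Ω) + (mapValues (tensorInclLie l) (rhoAM b Ωl) + t) := by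
  have h : mapValues (tensorInclLie l) (rAM b Ωl) =
      cst ((1 / 2 : ℂ) • tensorInclLie l Ωl) + mapValues (tensorInclLie l) (rhoAM b Ωl) := by
    rw [← map_smul, ← mapValues_cst]
    funext d
    exact map_add _ _ _
  rw [amShift, h, hdec, smul_add, cst_add]
  change _ + cst _ + _ = _
  abel

theorem flip_smul (c : ℂ) (r : g ⊗[ℂ] g) : flip (c • r) = c • flip r := map_smul _ _ _

theorem flip_add (r s : g ⊗[ℂ] g) : flip (r + s) = flip r + flip s := map_add _ _ _

/-- The projection along an invariant complement commutes with `l`. This supplies the invariance of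
the `l` component of `Ω`, which is only given as a tensor. -/
theorem isInvariantSymmetric_projLSq (hcompl : IsCompl l.toSubmodule m)
    (hinv : ∀ y : l, ∀ x ∈ m, ⁅(y : g), x⁆ ∈ m) {Ω : g ⊗[ℂ] g} (hΩ : IsInvariantSymmetric Ω) :
    IsInvariantSymmetric (projLSq hcompl Ω) :=
  ⟨by rw [← projLSq_flip, hΩ.1], fun y => by rw [← projLSq_lie hcompl hinv, hΩ.2, map_zero]⟩

theorem flip_rhoAM_add (b : Module.Basis (Fin n) ℂ l) {Ωl : l ⊗[ℂ] l}
    (hΩl : IsInvariantSymmetric Ωl) {t : Series n (g ⊗[ℂ] g)} (ht : ∀ d, t d ∈ wedgeSq m)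
    (d : Fin n →₀ ℕ) : flip ((mapValues (tensorInclLie l) (rhoAM b Ωl) + t) d) =
      -(mapValues (tensorInclLie l) (rhoAM b Ωl) + t) d := by
  rw [Pi.add_apply, flip_add, (ht d).2, neg_add, mapValues, flip_tensorInclLie,
    flip_rhoAM b hΩl.1 hΩl.2, map_neg]

/-- Every term of `Alt(dr)` has a leg in `l`, so functionals vanishing on `l` only see `CYB` of the
value at the origin. -/
theorem tripleMod_flat {b : Module.Basis (Fin n) ℂ l} {hcompl : IsCompl l.toSubmodule m}
    (hinv : ∀ y : l, ∀ x ∈ m, ⁅(y : g), x⁆ ∈ m)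
    {Ω r₀ : g ⊗[ℂ] g} (hΩ : IsInvariantSymmetric Ω) {r : Series n (g ⊗[ℂ] g)}
    (hskew : ∀ d, flip (r d) = -r d) (hr : r₀ = Ω + r 0)
    (h0 : tripleMod l.toSubmodule (CYB r₀) = 0) (α β γ : Module.Dual ℂ g)
    (hα : ∀ i, α (b i : g) = 0) (hβ : ∀ i, β (b i : g) = 0) (hγ : ∀ i, γ (b i : g) = 0) :
    curvF (fun i => (b i : g)) Ω r (cst α) (cst β) (cst γ) 0 = 0 := by
  have hvan : ∀ δ : Module.Dual ℂ g, (∀ i, δ (b i : g) = 0) → ∀ y ∈ l.toSubmodule, δ y = 0 := by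
    intro δ hδ y hy
    have : δ ∘ₗ (l.incl : l →ₗ[ℂ] g) = 0 := b.ext hδ
    exact LinearMap.congr_fun this ⟨y, hy⟩
  rw [← triple_cdybe b hΩ.1 hΩ.2 (extCoord_dual b hcompl) (extCoord_bracket b hcompl hinv) hskew,
    Pi.add_apply, map_add]
  have h1 : triple α β γ (mapValues (alt g) (dBar b (cst Ω + r)) 0) = 0 := by
    simp only [mapValues, dBar, map_sum, triple_alt, hα, hβ, hγ]
    simp
  have h2 : bilin (cybBilin g) (cst Ω + r) (cst Ω + r) 0 = CYB r₀ := by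
    simp [bilin, CYB, hr, cst_apply]
  rw [h1, h2, zero_add]
  exact triple_eq_zero_of_tripleMod h0 (hvan α hα) (hvan β hβ) (hvan γ hγ)

end Main

end DynR

end

theorem theorem3 {g : Type*} [LieRing g] [LieAlgebra ℂ g]
    (l : LieSubalgebra ℂ g) {n : ℕ} (b : Module.Basis (Fin n) ℂ l)
    (m : Submodule ℂ g) (hcompl : IsCompl l.toSubmodule m)
    (hinv : ∀ y : l, ∀ x ∈ m, ⁅(y : g), x⁆ ∈ m)
    (Ω : g ⊗[ℂ] g) (hΩ : DynR.IsInvariantSymmetric Ω)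
    (Ωl : l ⊗[ℂ] l) (Ωm : m ⊗[ℂ] m)
    (hdec : Ω = DynR.tensorInclLie l Ωl + DynR.tensorIncl m Ωm)
    (r₀ : g ⊗[ℂ] g) (hr₀ : r₀ ∈ DynR.modVariety l m Ω) :
    ∃ r : DynR.Series n (g ⊗[ℂ] g),
      (∃ t : DynR.Series n (g ⊗[ℂ] g), (∀ d, t d ∈ DynR.wedgeSq m) ∧
        DynR.IsEquivariant b t ∧ r = DynR.amShift b m Ωl Ωm t) ∧
      DynR.IsDynamicalRMatrix b Ω r ∧ DynR.valueAtZero r = r₀ ∧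
      ∀ r' : DynR.Series n (g ⊗[ℂ] g),
        (∃ t' : DynR.Series n (g ⊗[ℂ] g), (∀ d, t' d ∈ DynR.wedgeSq m) ∧
          r' = DynR.amShift b m Ωl Ωm t') →
        DynR.IsDynamicalRMatrix b Ω r' → DynR.valueAtZero r' = r₀ → r' = r := by
  open DynR in
  obtain ⟨⟨u, hu, huinv, hr₀u⟩, hmod⟩ := hr₀
  have hΩl : IsInvariantSymmetric Ωl := by
    have h := isInvariantSymmetric_projLSq hcompl hinv hΩ
    rwa [hdec, map_add, projLSq_tensorInclLie, projLSq_tensorIncl, add_zero] at h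
  have hhalf : IsInvariantSymmetric ((1 / 2 : ℂ) • Ω) :=
    ⟨by rw [flip_smul, hΩ.1], fun y => by rw [lie_smul, hΩ.2, smul_zero]⟩
  have hωm : (1 / 2 : ℂ) • tensorIncl m Ωm ∈ LinearMap.range (tensorIncl m) :=
    Submodule.smul_mem _ _ ⟨Ωm, rfl⟩
  have hsplit : tensorInclLie l ((1 / 2 : ℂ) • Ωl) + (1 / 2 : ℂ) • tensorIncl m Ωm =
      (1 / 2 : ℂ) • Ω := by rw [hdec, map_smul, smul_add]
  have hdual := extCoord_dual b hcompl
  have hproj := extCoord_bracket b hcompl hinv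
  obtain ⟨t, ht0, ht, htrad⟩ := exists_isRadial b hcompl hωm hu
  set ρ := mapValues (tensorInclLie l) (rhoAM b Ωl) with hρ
  have hρ0 : ρ 0 = 0 := by
    change tensorInclLie l (rhoAM b Ωl 0) = 0
    rw [rhoAM_zero, map_zero]
  -- The separate solutions on `l ⊗ l` and `m ⊗ m` add up to a solution for `Ω/2`, with value `u` at
  -- the origin.
  have hrad := ((isRadial_rhoAM b hΩl.1 hΩl.2).incl b hcompl).add b hcompl hinv htrad hωm
    fun d => (ht d).1
  rw [hsplit, ← hρ] at hrad
  have hzero : (ρ + t) 0 = u := by rw [Pi.add_apply, hρ0, ht0, zero_add]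
  have hskew := flip_rhoAM_add b hΩl ht
  rw [← hρ] at hskew
  have hdef : ∀ j, equivDefect (fun i => (b i : g)) (extCoord b hcompl) (b j : g) (ρ + t) = 0 :=
    fun j => hrad.equivDefect_eq_zero hhalf.1 hhalf.2 hdual hproj (sum_extCoord b hcompl) j
      (by rw [hzero]; exact huinv (b j))
  have hequiv : IsEquivariant b (ρ + t) := (isEquivariant_iff b hcompl _).mpr hdef
  have hflat := hrad.curvF_eq_zero hhalf.1 hhalf.2 hdual hproj hskew hdef
    (tripleMod_flat (hcompl := hcompl) hinv hhalf hskew (by rw [hzero, hr₀u]) hmod)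
  refine ⟨amShift b m Ωl Ωm t, ⟨t, ht,
    hequiv.of_add b hcompl hinv fun d => (ht d).1, rfl⟩, ?_, ?_, ?_⟩
  · rw [amShift_eq b hdec]
    refine ⟨hequiv.cst_add b hhalf.2, ?_, ?_⟩
    · funext d
      refine eq_zero_of_triple fun α β γ => ?_
      rw [triple_cdybe b hhalf.1 hhalf.2 hdual hproj hskew, hflat]
      rfl
    · funext d
      rw [Pi.add_apply, flip_add, hskew, cst_apply, const]
      split_ifs
      · rw [hhalf.1, add_add_add_comm, add_neg_cancel, add_zero, ← add_smul]
        norm_num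
      · rw [zero_add, show DynR.flip (0 : g ⊗[ℂ] g) = 0 from map_zero _, zero_add, add_neg_cancel]
  · rw [amShift_eq b hdec, valueAtZero, Pi.add_apply, hzero, cst_apply, if_pos rfl, hr₀u]
  · rintro r' ⟨t', ht', rfl⟩ hdyn hval
    rw [amShift_eq b hdec] at hdyn hval ⊢
    rw [amShift_eq b hdec]
    rw [← hρ] at hdyn hval ⊢
    have hskew' := flip_rhoAM_add b hΩl ht'
    rw [← hρ] at hskew'
    -- The prescribed form of the candidate is used here: it makes contraction of the flatness
    -- equation with `ε` radial, and the common initial value then forces equality.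
    have heps : opF (ρ + t') (epsF (extCoord b hcompl)) = 0 := by
      rw [opF_add, LinearMap.add_apply, opF_incl_epsF b hcompl (opF_rhoAM_epsF b),
        opF_epsF_eq_zero b hcompl fun d => (ht' d).1, add_zero]
    have hflat' : ∀ α β γ : Module.Dual ℂ g,
        curvF (fun i => (b i : g)) ((1 / 2 : ℂ) • Ω) (ρ + t') (cst α) (cst β) (cst γ) = 0 := by
      intro α β γ
      funext d
      have h := congrFun hdyn.cdybe d
      rw [← triple_cdybe b hhalf.1 hhalf.2 hdual hproj hskew', h]
      exact map_zero _
    have hrad' := isRadial_of_curvF_eq_zero hhalf.1 hhalf.2 hdual hproj hskew' heps hflat'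
    congr 1
    refine hrad'.unique hdual hrad ?_
    rw [valueAtZero, Pi.add_apply, cst_apply, if_pos rfl, hr₀u] at hval
    rw [hzero]
    exact add_left_cancel hval
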